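/- **Interval-valued computations.** Interval-values are finite unions of half-open subintervals $[l,u)$ of $[0,1)$. $\mathrm{Flength}(A)$ is the length of the leftmost component (maximal subinterval) of $A$, and $0$ if $A=\emptyset$. $\mathrm{Lshift}(A,B)$ is $A$ shifted to the left by $\mathrm{Flength}(B)$, where what leaves $[0,1)$ is lost; $\mathrm{Rshift}(A,B)$ is $A$ shifted to the right by $\mathrm{Flength}(B)$ circularly in $[0,1)$. The fractal product $B*A$ is obtained by replacing each component $[l,u)$ of $B$ by the copy of $A$ scaled to $[l,u)$. A computation sequence is a nonempty finite sequence $S_1,\dots,S_N$ with $S_1=\mathrm{FIRSTHALF}$, while every $S_i$ with $i\ge 2$ is $(\mathrm{op},j,k)$ with $\mathrm{op}\in\{\mathrm{AND},\mathrm{OR},\mathrm{LSHIFT},\mathrm{RSHIFT},\mathrm{PRODUCT}\}$, or $(\mathrm{NOT},j)$, or $(\mathrm{OUTPUT},j)$, where $1\le j,k<i$. The values are: $[0,\frac12)$ for $\mathrm{FIRSTHALF}$; intersection, union, $\mathrm{Lshift}$, $\mathrm{Rshift}$ and the product $*$ of the values of $S_j$ and $S_k$ (in this order) for the binary operations; the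 complement in $[0,1)$ of the value of $S_j$ for $(\mathrm{NOT},j)$; the value of $S_j$ for $(\mathrm{OUTPUT},j)$. The output of the sequence is the bit string that has, for each $\mathrm{OUTPUT}$ instruction in order, a $1$ if its value is nonempty and a $0$ otherwise. A function $f:\{0,1\}^*\to\{0,1\}^*$ is computable by an interval-valued computation of size $O(s)$ if there is a logspace algorithm that constructs, for each $w\in\{0,1\}^*$, a computation sequence with output $f(w)$, whose length is at most a constant (independent of $w$) times $s(|w|)$ for all nonempty $w$. **Theorem 1.** The discrete logarithm can be computed by an interval-valued computation of size $O(n^3)$. That is, there is a function $f:\{0,1\}^*\to\{0,1\}^*$, computable by an interval-valued computation of size $O(|w|^3)$, such that for all $n$, all non-negative integers $a,b<2^n$ and all primes $p<2^n$ for which some $y\in\mathbb N$ satisfies $a^y\equiv b \pmod p$, the following holds: if $w$, of length $3n$, is the concatenation of the $n$-bit binary representations of $a$, $b$ and $p$, then $f(w)$ is the $n$-bit binary representation of an integer $x$ with $0\le x<2^n$ and $a^x\equiv b\pmod p$. -/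

import Mathlib

/-! ### Interval-values and their operators -/

namespace IntervalComputing

/-! Interval-values are finite unions of subintervals `[l, u)` of `[0, 1)`.  The operators are written
on sets of reals; they are applied only to values built from `[0, 1/2)` by the operations below, which
are all interval-values. -/

/-- `[t, s)` is the first (leftmost) component of `A`. -/
def IsFirstComponent (A : Set ℝ) (t s : ℝ) : Prop :=
  0 ≤ t ∧ t < s ∧ s ≤ 1 ∧ Disjoint (Set.Ico 0 t) A ∧ Set.Ico t s ⊆ A ∧
    ∀ s' > s, ¬ Set.Ico t s' ⊆ A

open Classical in
/-- The length of the first component of `A`, and `0` if `A = ∅`. -/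
noncomputable def flength (A : Set ℝ) : ℝ :=
  if h : ∃ q : ℝ × ℝ, IsFirstComponent A q.1 q.2 then h.choose.2 - h.choose.1 else 0

/-- The first component is unique, so `flength` does not depend on the choice made. -/
theorem flength_eq {A : Set ℝ} {t s : ℝ} (h : IsFirstComponent A t s) : flength A = s - t := by
  have key : ∀ {t s t' s' : ℝ}, IsFirstComponent A t s → IsFirstComponent A t' s' → t' ≤ t := by
    intro t s t' s' h h'
    by_contra hlt
    exact Set.disjoint_left.mp h'.2.2.2.1 ⟨h.1, not_le.mp hlt⟩
      (h.2.2.2.2.1 ⟨le_rfl, h.2.1⟩)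
  have hex : ∃ q : ℝ × ℝ, IsFirstComponent A q.1 q.2 := ⟨(t, s), h⟩
  have hc := hex.choose_spec
  unfold flength
  rw [dif_pos hex]
  have ht : hex.choose.1 = t := le_antisymm (key h hc) (key hc h)
  have hs : hex.choose.2 = s := by
    apply le_antisymm <;> by_contra hlt
    · exact h.2.2.2.2.2 _ (not_le.mp hlt) (ht ▸ hc.2.2.2.2.1)
    · exact hc.2.2.2.2.2 _ (not_le.mp hlt) (ht.symm ▸ h.2.2.2.2.1)
  rw [ht, hs]

/-- Shift `A` to the left by `flength B`; what leaves `[0, 1)` is lost. -/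
def lshift (A B : Set ℝ) : Set ℝ :=
  {x | x ∈ Set.Ico (0 : ℝ) 1 ∧ x + flength B ∈ Set.Ico (0 : ℝ) 1 ∧ x + flength B ∈ A}

/-- Shift `A` circularly to the right by `flength B`. -/
def rshift (A B : Set ℝ) : Set ℝ :=
  {x | x ∈ Set.Ico (0 : ℝ) 1 ∧ Int.fract (x - flength B) ∈ A}

/-- `[l, u)` is a component of `B`: a nonempty subinterval of `B` that is maximal among the
half-open subintervals of `B`. -/
def IsComponent (B : Set ℝ) (l u : ℝ) : Prop :=
  l < u ∧ Set.Ico l u ⊆ B ∧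
    ∀ l' u' : ℝ, l' ≤ l → u ≤ u' → Set.Ico l' u' ⊆ B → l' = l ∧ u' = u

/-- The fractal product `B * A`: a scaled copy of `A` is placed in every component of `B`. -/
def product (B A : Set ℝ) : Set ℝ :=
  {x | ∃ l u : ℝ, IsComponent B l u ∧ x ∈ Set.Ico l u ∧ (x - l) / (u - l) ∈ A}

/-! ### Computation sequences -/

/-- The binary operations. -/
inductive BinOp where
  | and | or | lshift | rshift | product

/-- The interval-value that a binary operation computes. -/
def BinOp.eval : BinOp → Set ℝ → Set ℝ → Set ℝ
  | .and, A, B => A ∩ B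
  | .or, A, B => A ∪ B
  | .lshift, A, B => IntervalComputing.lshift A B
  | .rshift, A, B => IntervalComputing.rshift A B
  | .product, A, B => IntervalComputing.product A B

/-- The instructions.  Operands are indices of earlier instructions, counted from `1`. -/
inductive Instr where
  | firstHalf
  | binary (op : BinOp) (l m : ℕ)
  | not (l : ℕ)
  | output (l : ℕ)

/-- An instruction may stand at position `i` (counted from `1`). -/
def Instr.AllowedAt (i : ℕ) : Instr → Prop
  | .firstHalf => i = 1
  | .binary _ l m => (1 ≤ l ∧ l < i) ∧ (1 ≤ m ∧ m < i)
  | .not l => 1 ≤ l ∧ l < i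
  | .output l => 1 ≤ l ∧ l < i

/-- An interval-valued computation sequence: nonempty, `FIRSTHALF` at the first position and only
there, and all operands refer to earlier positions. -/
def IsComputationSequence (S : List Instr) : Prop :=
  S.head? = some .firstHalf ∧ ∀ (i : ℕ) (h : i < S.length), (S[i]'h).AllowedAt (i + 1)

/-- The `l`-th value, counted from `1`, of a list of values. -/
def nth (vs : List (Set ℝ)) (l : ℕ) : Set ℝ := vs.getD (l - 1) ∅

/-- The interval-value of an instruction, given the values of the preceding instructions. -/
noncomputable def Instr.eval (vs : List (Set ℝ)) : Instr → Set ℝ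
  | .firstHalf => Set.Ico 0 (1 / 2)
  | .binary op l m => op.eval (nth vs l) (nth vs m)
  | .not l => Set.Ico 0 1 \ nth vs l
  | .output l => nth vs l

/-- The interval-values of all the nonempty prefixes of a sequence, in order. -/
noncomputable def values (S : List Instr) : List (Set ℝ) :=
  S.foldl (fun vs I => vs ++ [I.eval vs]) []

open Classical in
/-- The bit, if any, that an instruction with interval-value `A` appends to the output. -/
noncomputable def Instr.emit : Instr → Set ℝ → Option Bool
  | .output _, A => some (decide A.Nonempty)
  | _, _ => none

/-- The output sequence of a computation sequence. -/
noncomputable def answer (S : List Instr) : List Bool :=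
  (S.zip (values S)).filterMap fun q => q.1.emit q.2

/-! ### Computation sequences as words -/

/-- The letters in which computation sequences are written. -/
inductive Letter where
  | firstHalf
  | op (o : BinOp)
  | not
  | output
  | bit (b : Bool)
  | comma

/-- Binary notation of an index, most significant bit first, without leading zeros. -/
def indexWord (l : ℕ) : List Letter := (Nat.bits l).reverse.map .bit

/-- An instruction as a word. -/
def Instr.encode : Instr → List Letter
  | .firstHalf => [.firstHalf]
  | .binary o l m => .op o :: (indexWord l ++ .comma :: indexWord m)
  | .not l => .not :: indexWord l
  | .output l => .output :: indexWord l

/-- A computation sequence as a word. -/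
def encode (S : List Instr) : List Letter := S.flatMap Instr.encode

/-! ### Logspace algorithms -/

/-- Head moves. -/
inductive Move where
  | left | stay | right

/-- What the input head sees: an end marker or an input letter. -/
inductive InputCell (α : Type) where
  | leftEnd
  | letter (a : α)
  | rightEnd

/-- A deterministic Turing machine with a two-way read-only input tape, `k` one-way infinite work
tapes, and a write-only output tape.  In a step it sees its state, the input cell and the `k`
scanned work cells; it either halts (`none`), or changes its state, moves the input head, on every
work tape writes a symbol and moves the head, and appends at most one letter to the output. -/
structure Machine (α β : Type) where
  k : ℕ
  State : Type
  finiteState : Finite State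
  Symbol : Type
  finiteSymbol : Finite Symbol
  start : State
  blank : Symbol
  transition : State → InputCell α → (Fin k → Symbol) →
    Option (State × Move × (Fin k → Symbol × Move) × Option β)

namespace Machine

variable {α β : Type}

/-- Configurations of a machine (the input word is kept outside). -/
structure Config (M : Machine α β) where
  state : M.State
  inputPos : ℕ
  tape : Fin M.k → ℕ → M.Symbol
  pos : Fin M.k → ℕ
  out : List β

/-- The input tape: the left end marker at cell `0`, the input at the cells `1, …, |w|`, the right
end marker at cell `|w| + 1`. -/
def inputCell (w : List α) : ℕ → InputCell α
  | 0 => .leftEnd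
  | i + 1 => match w[i]? with
    | some a => .letter a
    | none => .rightEnd

/-- A head at the left end of its tape does not move to the left. -/
def movePos : Move → ℕ → ℕ
  | .left, i => i - 1
  | .stay, i => i
  | .right, i => i + 1

/-- The initial configuration. -/
def init (M : Machine α β) : M.Config where
  state := M.start
  inputPos := 0
  tape := fun _ _ => M.blank
  pos := fun _ => 0
  out := []

/-- One step on input `w`; `none` if the machine has halted.  The input head does not leave the
part of the input tape between the end markers. -/
def step (M : Machine α β) (w : List α) (c : M.Config) : Option M.Config :=
  (M.transition c.state (inputCell w c.inputPos) (fun j => c.tape j (c.pos j))).map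
    fun (q, mv, act, o) =>
      { state := q
        inputPos := min (movePos mv c.inputPos) (w.length + 1)
        tape := fun j => Function.update (c.tape j) (c.pos j) (act j).1
        pos := fun j => movePos (act j).2 (c.pos j)
        out := c.out ++ o.toList }

/-- On every input `w` the machine halts with output `f w`, and during the whole run it visits only
the first `s |w|` cells of each work tape. -/
def ComputesInSpace (M : Machine α β) (f : List α → List β) (s : ℕ → ℕ) : Prop :=
  ∀ w : List α,
    (∃ c, StateTransition.Reaches (M.step w) M.init c ∧ M.step w c = none ∧ c.out = f w) ∧
    ∀ c, StateTransition.Reaches (M.step w) M.init c → ∀ j, c.pos j < s w.length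

end Machine

/-- `f` is computed by a logspace algorithm. -/
def LogspaceComputable {α β : Type} (f : List α → List β) : Prop :=
  ∃ (M : Machine α β) (c : ℕ), M.ComputesInSpace f fun m => c * (Nat.log 2 m + 1)

/-! ### Computing functions by interval-values -/

/-- `f` is computable by an interval-valued computation of size `O(s(m))`, `m` the length of the
input: a logspace algorithm constructs, for every input word `w`, a computation sequence with output
`f w`, and the length of that sequence is at most a constant times `s |w|`. -/
def IntervalComputableInSize (f : List Bool → List Bool) (s : ℕ → ℕ) : Prop :=
  ∃ B : List Bool → List Instr,
    LogspaceComputable (fun w => encode (B w)) ∧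
    (∀ w, IsComputationSequence (B w) ∧ answer (B w) = f w) ∧
    ∃ C : ℕ, ∀ w, w ≠ [] → (B w).length ≤ C * s w.length

/-- The binary representation of `a` with `n` digits, most significant digit first
(for `a < 2 ^ n`). -/
def digits (n a : ℕ) : List Bool := ((List.range n).map a.testBit).reverse

end IntervalComputing

namespace IntervalComputing

/-! ### Structured programs for machines -/

/-! A Boolean operation on interval-values acts at every point of [0, 1) separately, so a Boolean
circuit run on interval-values is evaluated at all points at once. Products by the two halves of [0,
1) produce the sets `digitSet j` of points with a given binary digit equal to 1 (`digitSet_succ`).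
With the digits 0, …, N the circuit distinguishes the 2^(N+1) dyadic cells of length 2^-(N+1),
numbered by `cellIndex`. The last N of these digits form a candidate exponent x, so one circuit that
computes a^x mod p and compares it with b mod p tests all candidates simultaneously. Ripple-carry
addition modulo p takes O(N) gates, multiplication by doubling and adding O(N²), exponentiation by
repeated squaring O(N³); this is the size.

To read off one solution, digit 0 serves as a flag: only points of the second half count as hits
(`hit`). The least hit k is therefore positive, and the complement of the hit set begins with the
component [0, k/2^(N+1)), whose length encodes k (`flength_compl`). Shifting a digit set to the left
by this length moves cell k onto the cell at 0, and the intersection with that cell is nonempty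
exactly if the corresponding bit of k is 1 (`lshift_inter_nonempty`). The N low bits of k are the
output. A solution below 2^N exists by Fermat's little theorem (`exists_exponent_lt`);
`exists_exponent_of_answer` puts these facts together.

The sequence is regular enough to be written in logarithmic space: a fixed program needs only
finitely many registers, which hold positions in the sequence and loop counters, hence numbers of
O(log |w|) bits. `Prog` is a structured language, and `compile` turns a program into a machine whose
states are the lists of programs still to be executed (`compile_computesInSpace`). Above it lie
binary counters, register programs with the judgements `Exec` and `Step`, and `exec_block`, which
relates the gates that are written to their interval-values. A number that depends on the point is
stored as a `Vec`, with its bits at positions of stride 3.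

The functions `modAdd`, `mulMod` and `expIter` are truncated to N bits, so the circuits can be
described for every input word, whether or not it encodes a valid instance. Number theory enters
only when `hit` is interpreted, in `hit_iff`. -/

/-- What a machine does in one step, apart from changing its state. -/
abbrev Action (β ι σ : Type) := Move × (ι → σ × Move) × Option β

/-- The action that changes nothing, when the scanned symbols are `s`. -/
def idle {β ι σ : Type} (s : ι → σ) : Action β ι σ := (.stay, fun j => (s j, .stay), none)

/-- Structured programs over a single-step action, with work tapes indexed by `ι`. -/
inductive Prog (α β ι σ : Type) where
  | act (f : InputCell α → (ι → σ) → Action β ι σ)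
  | seq (a b : Prog α β ι σ)
  | ite (t : InputCell α → (ι → σ) → Bool) (a b : Prog α β ι σ)
  | loop (t : InputCell α → (ι → σ) → Bool) (a : Prog α β ι σ)

/-- A configuration of a machine without its state. -/
@[ext] structure Data (β ι σ : Type) where
  inputPos : ℕ
  tape : ι → ℕ → σ
  pos : ι → ℕ
  out : List β

section
variable {α β ι σ : Type}

/-- The scanned symbols. -/
def Data.scan (d : Data β ι σ) : ι → σ := fun j => d.tape j (d.pos j)

/-- The effect of an action. -/
def Data.apply (w : List α) (d : Data β ι σ) (a : Action β ι σ) : Data β ι σ where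
  inputPos := min (Machine.movePos a.1 d.inputPos) (w.length + 1)
  tape := fun j => Function.update (d.tape j) (d.pos j) (a.2.1 j).1
  pos := fun j => Machine.movePos (a.2.1 j).2 (d.pos j)
  out := d.out ++ a.2.2.toList

/-- The input head is on the tape and the work heads are on the first `s` cells. -/
def Data.Bounded (w : List α) (s : ℕ) (d : Data β ι σ) : Prop :=
  d.inputPos ≤ w.length + 1 ∧ ∀ j, d.pos j < s

theorem Data.apply_idle {w : List α} {d : Data β ι σ} (h : d.inputPos ≤ w.length + 1) :
    d.apply w (idle d.scan) = d := by
  ext <;> simp [Data.apply, idle, Machine.movePos, Data.scan, h]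

namespace Prog

/-- A step of a list of programs that are to be executed one after the other. -/
def next (x : InputCell α) (s : ι → σ) :
    List (Prog α β ι σ) → Option (List (Prog α β ι σ) × Action β ι σ)
  | [] => none
  | act f :: K => some (K, f x s)
  | seq a b :: K => some (a :: b :: K, idle s)
  | ite t a b :: K => some ((if t x s then a else b) :: K, idle s)
  | .loop t a :: K => some (if t x s then a :: .loop t a :: K else K, idle s)

/-- A step of a list of programs together with the data. -/
def stepData (w : List α) (q : List (Prog α β ι σ) × Data β ι σ) :
    Option (List (Prog α β ι σ) × Data β ι σ) :=
  (next (Machine.inputCell w q.2.inputPos) q.2.scan q.1).map fun r => (r.1, q.2.apply w r.2)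

/-- A step from bounded data. -/
def BoundedStep (w : List α) (s : ℕ) (x y : List (Prog α β ι σ) × Data β ι σ) : Prop :=
  stepData w x = some y ∧ x.2.Bounded w s

/-- The program `c` transforms the data `d` to `d'`, and only visits bounded data. -/
def Run (w : List α) (s : ℕ) (c : Prog α β ι σ) (d d' : Data β ι σ) : Prop :=
  ∀ K, Relation.ReflTransGen (BoundedStep w s) (c :: K, d) (K, d')

variable {w : List α} {s : ℕ} {d d₁ d₂ d₃ : Data β ι σ}

theorem Run.act {f : InputCell α → (ι → σ) → Action β ι σ} (h : d.Bounded w s) :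
    Run w s (.act f) d (d.apply w (f (Machine.inputCell w d.inputPos) d.scan)) :=
  fun _ => .single ⟨rfl, h⟩

theorem Run.seq {a b : Prog α β ι σ} (h : d₁.Bounded w s) (ha : Run w s a d₁ d₂)
    (hb : Run w s b d₂ d₃) : Run w s (.seq a b) d₁ d₃ := fun K =>
  .head ⟨by simp [stepData, next, Data.apply_idle h.1], h⟩ ((ha (b :: K)).trans (hb K))

theorem Run.ite {t : InputCell α → (ι → σ) → Bool} {a b : Prog α β ι σ} (h : d₁.Bounded w s)
    (hr : Run w s (if t (Machine.inputCell w d₁.inputPos) d₁.scan then a else b) d₁ d₂) :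
    Run w s (.ite t a b) d₁ d₂ := fun K =>
  .head ⟨by simp [stepData, next, Data.apply_idle h.1], h⟩ (hr K)

theorem Run.loop_false {t : InputCell α → (ι → σ) → Bool} {a : Prog α β ι σ}
    (h : d.Bounded w s) (ht : t (Machine.inputCell w d.inputPos) d.scan = false) :
    Run w s (.loop t a) d d := fun K =>
  .single ⟨by simp [stepData, next, Data.apply_idle h.1, ht], h⟩

theorem Run.loop_true {t : InputCell α → (ι → σ) → Bool} {a : Prog α β ι σ}
    (h : d₁.Bounded w s) (ht : t (Machine.inputCell w d₁.inputPos) d₁.scan = true)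
    (ha : Run w s a d₁ d₂) (hw : Run w s (.loop t a) d₂ d₃) :
    Run w s (.loop t a) d₁ d₃ := fun K =>
  .head ⟨by simp [stepData, next, Data.apply_idle h.1, ht], h⟩
    ((ha (.loop t a :: K)).trans (hw K))

/-- The lists of programs that may have to be executed while `c :: K` is executed. -/
def conts : Prog α β ι σ → List (Prog α β ι σ) → Set (List (Prog α β ι σ))
  | act f, K => {.act f :: K, K}
  | seq a b, K => insert (.seq a b :: K) (conts a (b :: K) ∪ conts b K)
  | ite t a b, K => insert (.ite t a b :: K) (conts a K ∪ conts b K)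
  | .loop t a, K => insert (.loop t a :: K) (insert K (conts a (.loop t a :: K)))

/-- The body of a loop is followed by the same list `.loop t a :: K` in every round, so the
recursion in `conts` is structural and iteration creates no new lists. This makes the control of the
compiled machine finite. -/
theorem conts_finite (c : Prog α β ι σ) : ∀ K, (conts c K).Finite := by
  induction c with
  | act f => intro K; simp [conts]
  | seq a b ha hb => intro K; exact ((ha _).union (hb _)).insert _
  | ite t a b ha hb => intro K; exact ((ha _).union (hb _)).insert _
  | loop t a ha => intro K; exact ((ha _).insert _).insert _

theorem cons_mem_conts (c : Prog α β ι σ) (K : List (Prog α β ι σ)) : c :: K ∈ conts c K := by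
  cases c <;> simp [conts]

theorem mem_conts (c : Prog α β ι σ) : ∀ K, K ∈ conts c K := by
  induction c with
  | act f => intro K; simp [conts]
  | seq a b ha hb => intro K; exact Or.inr (Or.inr (hb _))
  | ite t a b ha hb => intro K; exact Or.inr (Or.inr (hb _))
  | loop t a ha => intro K; exact Or.inr (Or.inl rfl)

/-- The list `K` itself has to be excluded, because a step from it belongs to what follows `c`. When
a sub-program has come to its own final list, the enclosing construct makes the step; this is the
case distinction for `seq` and `loop`. -/
theorem next_mem_conts (c : Prog α β ι σ) (x : InputCell α) (s : ι → σ) :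
    ∀ K, ∀ L ∈ conts c K, L ≠ K → ∀ r, next x s L = some r → r.1 ∈ conts c K := by
  induction c with
  | act f =>
    rintro K L (rfl | h) hne r hr
    · simp [next] at hr; subst hr; simp [conts]
    · exact absurd h hne
  | seq a b ha hb =>
    rintro K L (rfl | h | h) hne r hr
    · simp [next] at hr; subst hr; exact Or.inr (Or.inl (cons_mem_conts _ _))
    · by_cases hL : L = b :: K
      · subst hL
        exact Or.inr (Or.inr (hb _ _ (cons_mem_conts _ _) (by simp) r hr))
      · exact Or.inr (Or.inl (ha _ _ h hL r hr))
    · exact Or.inr (Or.inr (hb _ _ h hne r hr))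
  | ite t a b ha hb =>
    rintro K L (rfl | h | h) hne r hr
    · simp only [next, Option.some.injEq] at hr
      subst hr
      by_cases ht : t x s
      · simp only [ht, ↓reduceIte]; exact Or.inr (Or.inl (cons_mem_conts a K))
      · simp only [ht, ↓reduceIte, Bool.false_eq_true]; exact Or.inr (Or.inr (cons_mem_conts b K))
    · exact Or.inr (Or.inl (ha _ _ h hne r hr))
    · exact Or.inr (Or.inr (hb _ _ h hne r hr))
  | loop t a ha =>
    rintro K L (rfl | h | h) hne r hr
    · simp only [next, Option.some.injEq] at hr
      subst hr
      by_cases ht : t x s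
      · simp only [ht, ↓reduceIte]; exact Or.inr (Or.inr (cons_mem_conts a _))
      · simp only [ht, ↓reduceIte, Bool.false_eq_true]; exact Or.inr (Or.inl rfl)
    · exact absurd h hne
    · by_cases hL : L = .loop t a :: K
      · subst hL
        simp only [next, Option.some.injEq] at hr
        subst hr
        by_cases ht : t x s
        · simp only [ht, ↓reduceIte]; exact Or.inr (Or.inr (cons_mem_conts a _))
        · simp only [ht, ↓reduceIte, Bool.false_eq_true]; exact Or.inr (Or.inl rfl)
      · exact Or.inr (Or.inr (ha _ _ h hL r hr))

/-! ### Compilation of programs into Turing machines. -/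

variable [Fintype ι] [Finite σ]

open Classical in
/-- The machine that executes a program. -/
noncomputable def compile (c : Prog α β ι σ) (blank : σ) : Machine α β where
  k := Fintype.card ι
  State := {K // K ∈ conts c []}
  finiteState := (conts_finite c []).to_subtype
  Symbol := σ
  finiteSymbol := inferInstance
  start := ⟨[c], cons_mem_conts c []⟩
  blank := blank
  transition := fun q x s =>
    match next x (fun j => s (Fintype.equivFin ι j)) q.1 with
    | none => none
    | some r => if h : r.1 ∈ conts c [] then
        some (⟨r.1, h⟩, r.2.1, fun j => r.2.2.1 ((Fintype.equivFin ι).symm j), r.2.2.2) else none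

/-- The configuration of the compiled machine with given state and data. -/
noncomputable def toConfig (c : Prog α β ι σ) (blank : σ) (K : {K // K ∈ conts c []})
    (d : Data β ι σ) : (compile c blank).Config where
  state := K
  inputPos := d.inputPos
  tape := fun j => d.tape ((Fintype.equivFin ι).symm j)
  pos := fun j => d.pos ((Fintype.equivFin ι).symm j)
  out := d.out

theorem step_toConfig_nil (c : Prog α β ι σ) (blank : σ) (h : [] ∈ conts c []) (d : Data β ι σ) :
    (compile c blank).step w (toConfig c blank ⟨[], h⟩ d) = none := by
  simp [Machine.step, toConfig, compile, next]

theorem step_toConfig {c : Prog α β ι σ} {blank : σ} {K K' : List (Prog α β ι σ)}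
    {d d' : Data β ι σ} (hK : K ∈ conts c []) (h : stepData w (K, d) = some (K', d')) :
    ∃ hK' : K' ∈ conts c [], (compile c blank).step w (toConfig c blank ⟨K, hK⟩ d) =
      some (toConfig c blank ⟨K', hK'⟩ d') := by
  simp only [stepData, Option.map_eq_some_iff, Prod.mk.injEq] at h
  obtain ⟨r, hr, rfl, rfl⟩ := h
  have hne : K ≠ [] := by rintro rfl; simp [next] at hr
  have hm := next_mem_conts c _ _ [] K hK hne r hr
  refine ⟨hm, ?_⟩
  have hs : (fun j => d.tape ((Fintype.equivFin ι).symm ((Fintype.equivFin ι) j))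
      (d.pos ((Fintype.equivFin ι).symm ((Fintype.equivFin ι) j)))) = d.scan := by
    funext j; simp [Data.scan]
  simp only [Machine.step, toConfig, compile, hs, hr, hm, dif_pos, Option.map_some]
  rfl

/-- The data in the beginning. -/
def initData (blank : σ) : Data β ι σ where
  inputPos := 0
  tape := fun _ _ => blank
  pos := fun _ => 0
  out := []

/-- The machine is deterministic, so every reachable configuration lies on the one run that `Run`
describes, and each of its data is bounded. Induction from the end of the run gives halting and the
space bound together. -/
theorem compile_computesInSpace (c : Prog α β ι σ) (blank : σ) (f : List α → List β) (S : ℕ → ℕ)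
    (h : ∀ w : List α, ∃ d, Run w (S w.length) c (initData blank) d ∧ d.Bounded w (S w.length) ∧
      d.out = f w) : (compile c blank).ComputesInSpace f S := by
  intro w
  obtain ⟨d, hr, hb, ho⟩ := h w
  have key : ∀ x : List (Prog α β ι σ) × Data β ι σ,
      Relation.ReflTransGen (BoundedStep w (S w.length)) x ([], d) → ∀ hx : x.1 ∈ conts c [],
      StateTransition.Reaches ((compile c blank).step w) (toConfig c blank ⟨x.1, hx⟩ x.2)
        (toConfig c blank ⟨[], mem_conts c []⟩ d) ∧
      ∀ q, StateTransition.Reaches ((compile c blank).step w) (toConfig c blank ⟨x.1, hx⟩ x.2) q →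
        ∀ j, q.pos j < S w.length := by
    intro x hx
    induction hx using Relation.ReflTransGen.head_induction_on with
    | refl =>
      intro hx
      refine ⟨.refl, fun q hq j => ?_⟩
      rcases Relation.ReflTransGen.cases_head hq with rfl | ⟨e, he, -⟩
      · exact hb.2 _
      · rw [Option.mem_def, step_toConfig_nil] at he
        cases he
    | head h' _ ih =>
      intro hx
      rename_i y z _
      obtain ⟨hz, hs⟩ := step_toConfig (blank := blank) hx (show stepData w (y.1, y.2) =
        some (z.1, z.2) from h'.1)
      obtain ⟨h1, h2⟩ := ih hz
      refine ⟨.head hs h1, fun q hq j => ?_⟩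
      rcases Relation.ReflTransGen.cases_head hq with rfl | ⟨e, he, hq'⟩
      · exact h'.2.2 _
      · rw [Option.mem_def, hs, Option.some.injEq] at he
        subst he
        exact h2 q hq' j
  obtain ⟨h1, h2⟩ := key ([c], initData blank) (hr []) (cons_mem_conts c [])
  exact ⟨⟨_, h1, step_toConfig_nil _ _ _ _, ho⟩, h2⟩

end Prog
end

/-! ### Binary counters on work tapes -/

/-- Tape symbols: blank, the left end mark, and bits. -/
abbrev Cell := Option (Option Bool)

/-- The tape with the mark in cell `0`, followed by the bits of a list. -/
def enc (l : List Bool) : ℕ → Cell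
  | 0 => some none
  | i + 1 => l[i]?.map some

theorem enc_mid (l : List Bool) (b : Bool) (m : List Bool) :
    enc (l ++ b :: m) (l.length + 1) = some (some b) := by simp [enc]

theorem enc_end (l : List Bool) : enc l (l.length + 1) = none := by simp [enc]

theorem update_enc_mid (l : List Bool) (b c : Bool) (m : List Bool) :
    Function.update (enc (l ++ b :: m)) (l.length + 1) (some (some c)) = enc (l ++ c :: m) := by
  funext i
  rcases i with _ | i
  · simp [enc]
  · rcases lt_trichotomy i l.length with h | rfl | h
    · simp [enc, h.ne, List.getElem?_append_left h]
    · simp [enc]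
    · obtain ⟨j, rfl⟩ := Nat.exists_eq_add_of_lt h
      simp [enc, List.getElem?_append_right, Nat.add_assoc]

theorem update_enc_end (l : List Bool) (c : Bool) :
    Function.update (enc l) (l.length + 1) (some (some c)) = enc (l ++ [c]) := by
  funext i
  rcases i with _ | i
  · simp [enc]
  · rcases lt_trichotomy i l.length with h | rfl | h
    · simp [enc, h.ne, List.getElem?_append_left h]
    · simp [enc]
    · obtain ⟨j, rfl⟩ := Nat.exists_eq_add_of_lt h
      simp [enc, Nat.add_assoc]

theorem update_enc_last (l : List Bool) (c : Bool) :
    Function.update (enc (l ++ [c])) (l.length + 1) none = enc l := by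
  funext i
  rcases i with _ | i
  · simp [enc]
  · rcases lt_trichotomy i l.length with h | rfl | h
    · simp [enc, h.ne, List.getElem?_append_left h]
    · simp [enc]
    · obtain ⟨j, rfl⟩ := Nat.exists_eq_add_of_lt h
      simp [enc, Nat.add_assoc]

section
variable {α β ι : Type} [DecidableEq ι]

/-- The data with the tape `r` changed to `enc l`, its head at `p`, and the output changed to `o`. -/
def Data.put (d : Data β ι Cell) (r : ι) (l : List Bool) (p : ℕ) (o : List β) :
    Data β ι Cell where
  inputPos := d.inputPos
  tape := Function.update d.tape r (enc l)
  pos := Function.update d.pos r p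
  out := o

theorem Data.Bounded.put {w : List α} {s : ℕ} {d : Data β ι Cell} (h : d.Bounded w s) (r : ι)
    (l : List Bool) {p : ℕ} (hp : p < s) (o : List β) : (d.put r l p o).Bounded w s := by
  refine ⟨h.1, fun j => ?_⟩
  by_cases hj : j = r
  · subst hj; simpa [Data.put] using hp
  · simpa [Data.put, hj] using h.2 j

theorem Data.scan_put (d : Data β ι Cell) (r : ι) (l : List Bool) (p : ℕ) (o : List β) :
    (d.put r l p o).scan r = enc l p := by simp [Data.scan, Data.put]

namespace Prog

/-- An action on one tape. -/
def onTape (r : ι) (f : Cell → Cell × Move) (o : Cell → Option β) : Prog α β ι Cell :=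
  .act fun _ s => (.stay, fun j => if j = r then f (s r) else (s j, .stay), o (s r))

/-- A test on the symbol scanned on one tape. -/
def test (α : Type) (r : ι) (t : Cell → Bool) : InputCell α → (ι → Cell) → Bool :=
  fun _ s => t (s r)

variable {w : List α} {s : ℕ} {d : Data β ι Cell} {r : ι}

theorem Run.onTape {f : Cell → Cell × Move} {o : Cell → Option β} {l l' : List Bool} {p p' : ℕ}
    {u u' : List β} (h : d.Bounded w s) (hp : p < s)
    (hl : Function.update (enc l) p (f (enc l p)).1 = enc l')
    (hm : Machine.movePos (f (enc l p)).2 p = p') (hu : u ++ (o (enc l p)).toList = u') :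
    Run w s (onTape r f o) (d.put r l p u) (d.put r l' p' u') := by
  have := Run.act (f := fun (_ : InputCell α) s => ((.stay, fun j => if j = r then f (s r)
    else (s j, .stay), o (s r)) : Action β ι Cell)) (h.put r l hp u)
  refine (congrArg (Run w s (Prog.onTape r f o) (d.put r l p u)) ?_).mpr this
  rw [Data.ext_iff]
  refine ⟨?_, ?_, ?_, ?_⟩
  · simp only [Data.put, Data.apply, Machine.movePos]
    exact (min_eq_left h.1).symm
  · funext j
    by_cases hj : j = r
    · subst hj; simp [Data.put, Data.apply, Data.scan, hl]
    · simp [Data.put, Data.apply, Data.scan, hj]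
  · funext j
    by_cases hj : j = r
    · subst hj; simp [Data.put, Data.apply, Data.scan, hm]
    · simp [Data.put, Data.apply, Data.scan, hj, Machine.movePos]
  · simp [Data.apply, Data.scan_put, ← hu]
    rfl

/-- Move the head of a tape without writing. -/
def move (r : ι) (m : Move) : Prog α β ι Cell := onTape r (fun c => (c, m)) fun _ => none

theorem Run.move {m : Move} {l : List Bool} {p p' : ℕ} {u : List β} (h : d.Bounded w s)
    (hp : p < s) (hm : Machine.movePos m p = p') :
    Run w s (move r m) (d.put r l p u) (d.put r l p' u) :=
  Run.onTape h hp (Function.update_eq_self _ _) hm (by simp)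

/-- Move the head of a tape to cell `1`. -/
def rewind (r : ι) : Prog α β ι Cell :=
  .seq (.loop (test α r fun c => c != some none) (move r .left)) (move r .right)

theorem Run.rewind {l : List Bool} {p : ℕ} {u : List β} (h : d.Bounded w s) (hp : p < s) :
    Run w s (rewind r) (d.put r l p u) (d.put r l 1 u) := by
  refine Run.seq (h.put _ _ hp _) (d₂ := d.put r l 0 u) ?_ (Run.move h (by omega) rfl)
  induction p with
  | zero =>
    exact Run.loop_false (h.put _ _ hp _) (by simp [test, Data.scan_put, enc])
  | succ p ih =>
    refine Run.loop_true (h.put _ _ hp _) ?_ (Run.move h hp rfl) (ih (by omega))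
    cases hh : l[p]? <;> simp [test, Data.scan_put, enc, hh]

/-- Binary increment, least significant bit first. -/
def incBits : List Bool → List Bool
  | [] => [true]
  | false :: l => true :: l
  | true :: l => false :: incBits l

/-- Binary decrement. -/
def decBits : List Bool → List Bool
  | [] => []
  | false :: l => true :: decBits l
  | [true] => []
  | true :: b :: l => false :: b :: l

theorem bits_succ (v : ℕ) : (v + 1).bits = incBits v.bits := by
  induction v using Nat.binaryRec' with
  | zero => simp [incBits]
  | bit b v h ih =>
    rw [Nat.bits_append_bit _ _ h]
    cases b
    · have : Nat.bit false v + 1 = Nat.bit true v := by simp [Nat.bit]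
      rw [this, Nat.bits_append_bit _ _ (by simp)]; rfl
    · have : Nat.bit true v + 1 = Nat.bit false (v + 1) := by simp [Nat.bit]; ring
      rw [this, Nat.bits_append_bit _ _ (by simp), ih]; rfl

/-- The clause `[true] => []` of `decBits` removes a leading bit that has become 0, so that counters
remain in the form `Nat.bits` without leading zeros. The test for zero relies on this form. -/
theorem bits_pred (v : ℕ) : v.bits = decBits (v + 1).bits := by
  rw [bits_succ]
  induction v using Nat.binaryRec' with
  | zero => simp [incBits, decBits]
  | bit b v h ih =>
    rw [Nat.bits_append_bit _ _ h]
    cases b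
    · have hv : v ≠ 0 := fun h0 => by simpa using h h0
      cases hl : v.bits with
      | nil => 
        have h0 := Nat.size_eq_bits_len v
        rw [hl, List.length_nil] at h0
        exact absurd (Nat.size_eq_zero.mp h0.symm) hv
      | cons c l => rfl
    · simp only [incBits, decBits, ← ih]

/-- Increment a counter. -/
def inc (r : ι) : Prog α β ι Cell :=
  .seq (.loop (test α r fun c => c == some (some true))
      (onTape r (fun _ => (some (some false), .right)) fun _ => none))
    (.seq (onTape r (fun _ => (some (some true), .stay)) fun _ => none) (rewind r))

theorem Run.incBits {l : List Bool} {u : List β} (h : d.Bounded w s) (hp : l.length + 1 < s) :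
    Run w s (inc r) (d.put r l 1 u) (d.put r (incBits l) 1 u) := by
  -- Generalised over the prefix `pre` that the head has already passed; `d₂` is the configuration
  -- in which the carry loop stops.
  suffices H : ∀ (m pre : List Bool), pre.length + m.length + 1 < s → ∃ d₂,
      Run w s (.loop (test α r fun c => c == some (some true))
        (Prog.onTape r (fun _ => (some (some false), .right)) fun _ => none))
        (d.put r (pre ++ m) (pre.length + 1) u) d₂ ∧
      Run w s (.seq (Prog.onTape r (fun _ => (some (some true), .stay)) fun _ => none)
        (Prog.rewind r)) d₂ (d.put r (pre ++ Prog.incBits m) 1 u) by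
    obtain ⟨d₂, h1, h2⟩ := H l [] (by simpa using hp)
    exact Run.seq (h.put _ _ (by omega) _) h1 h2
  intro m
  induction m with
  | nil =>
    intro pre hs
    simp only [List.length_nil, Nat.add_zero] at hs
    refine ⟨_, Run.loop_false (h.put _ _ hs _) ?_, Run.seq (h.put _ _ hs _)
      (Run.onTape h hs (l' := pre ++ [true]) (p' := pre.length + 1) (u' := u) ?_ rfl (by simp)) (Run.rewind h hs)⟩
    · simp [test, Data.scan_put, enc_end]
    · simpa using update_enc_end pre true
  | cons b m ih =>
    intro pre hs
    simp only [List.length_cons] at hs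
    have hs' : pre.length + 1 < s := by omega
    cases b
    · refine ⟨_, Run.loop_false (h.put _ _ hs' _) ?_, Run.seq (h.put _ _ hs' _)
        (Run.onTape h hs' (l' := pre ++ true :: m) (p' := pre.length + 1) (u' := u) ?_ rfl (by simp)) (Run.rewind h hs')⟩
      · simp [test, Data.scan_put, enc_mid]
      · exact update_enc_mid pre _ _ m
    · obtain ⟨d₂, h1, h2⟩ := ih (pre ++ [false]) (by simp; omega)
      refine ⟨d₂, Run.loop_true (h.put _ _ hs' _) ?_ ?_ h1, ?_⟩
      · simp [test, Data.scan_put, enc_mid]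
      · refine Run.onTape h hs' ?_ ?_ (by simp)
        · simpa using update_enc_mid pre true false m
        · simp [Machine.movePos]
      · simpa [Prog.incBits] using h2

/-- Decrement a positive counter. -/
def dec (r : ι) : Prog α β ι Cell :=
  .seq (.loop (test α r fun c => c == some (some false))
      (onTape r (fun _ => (some (some true), .right)) fun _ => none))
    (.seq (onTape r (fun _ => (some (some false), .right)) fun _ => none)
      (.seq (.ite (test α r fun c => c == none)
        (.seq (move r .left) (onTape r (fun _ => (none, .stay)) fun _ => none)) (move r .stay))
        (rewind r)))

/-- The borrow runs over the low zeros and stops at the first 1, which exists by `ht`. A blank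
behind this 1 shows that it is the leading bit; then the cell is erased instead of keeping a 0. -/
theorem Run.decBits {l : List Bool} {u : List β} (h : d.Bounded w s) (hp : l.length + 1 < s)
    (ht : true ∈ l) : Run w s (dec r) (d.put r l 1 u) (d.put r (decBits l) 1 u) := by
  suffices H : ∀ (m pre : List Bool), pre.length + m.length + 1 < s → true ∈ m → ∃ d₂,
      Run w s (.loop (test α r fun c => c == some (some false))
        (Prog.onTape r (fun _ => (some (some true), .right)) fun _ => none))
        (d.put r (pre ++ m) (pre.length + 1) u) d₂ ∧
      Run w s (.seq (Prog.onTape r (fun _ => (some (some false), .right)) fun _ => none)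
        (.seq (.ite (test α r fun c => c == none)
        (.seq (Prog.move r .left) (Prog.onTape r (fun _ => (none, .stay)) fun _ => none))
          (Prog.move r .stay))
        (Prog.rewind r))) d₂ (d.put r (pre ++ Prog.decBits m) 1 u) by
    obtain ⟨d₂, h1, h2⟩ := H l [] (by simpa using hp) ht
    exact Run.seq (h.put _ _ (by omega) _) h1 h2
  intro m
  induction m with
  | nil => intro pre _ hm; simp at hm
  | cons b m ih =>
    intro pre hs hm
    simp only [List.length_cons] at hs
    have hs' : pre.length + 1 < s := by omega
    have hs2 : pre.length + 2 < s := by omega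
    cases b
    · obtain ⟨d₂, h1, h2⟩ := ih (pre ++ [true]) (by simp; omega) (by simpa using hm)
      refine ⟨d₂, Run.loop_true (h.put _ _ hs' _) ?_ ?_ h1, ?_⟩
      · simp [test, Data.scan_put, enc_mid]
      · refine Run.onTape h hs' ?_ ?_ (by simp)
        · simpa using update_enc_mid pre false true m
        · simp [Machine.movePos]
      · simpa [Prog.decBits] using h2
    · refine ⟨_, Run.loop_false (h.put _ _ hs' _) ?_, Run.seq (h.put _ _ hs' _)
        (Run.onTape h hs' (update_enc_mid pre true false m) rfl (by simp; rfl)) ?_⟩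
      · simp [test, Data.scan_put, enc_mid]
      · cases m with
        | nil =>
          refine Run.seq (h.put _ _ hs2 _) (Run.ite (h.put _ _ hs2 _) ?_)
            (Run.rewind (p := pre.length + 1) h hs')
          have : enc (pre ++ [false]) (pre.length + 2) = none := by simp [enc]
          simp only [test, Data.scan_put, Machine.movePos, this]
          refine Run.seq (h.put _ _ hs2 _) (Run.move (p' := pre.length + 1) h hs2 rfl)
            (Run.onTape h hs' ?_ rfl (by simp))
          simpa [Prog.decBits] using update_enc_last pre false
        | cons c m =>
          refine Run.seq (h.put _ _ hs2 _) (Run.ite (h.put _ _ hs2 _) ?_)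
            (Run.rewind (p := pre.length + 2) h hs2)
          have : enc (pre ++ false :: c :: m) (pre.length + 2) = some (some c) := by
            simp [enc]
          simp only [test, Data.scan_put, Machine.movePos, this]
          exact Run.move h hs2 rfl

/-- Write the value of a counter, most significant bit first. -/
def emitNum (r : ι) : Prog α Letter ι Cell :=
  .seq (.loop (test α r fun c => c != none) (move r .right))
    (.seq (move r .left)
      (.seq (.loop (test α r fun c => c != some none)
        (onTape r (fun c => (c, .left)) fun c => c.join.map .bit)) (move r .right)))

/-- Counters are stored with the least significant bit first, whereas indices are written with the
most significant bit first. So the head runs to the first blank and the bits are written on the way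
back to the mark. -/
theorem Run.emitBits {d : Data Letter ι Cell} {l : List Bool} {u : List Letter}
    (h : d.Bounded w s) (hp : l.length + 1 < s) :
    Run w s (emitNum r) (d.put r l 1 u) (d.put r l 1 (u ++ l.reverse.map .bit)) := by
  have right : ∀ (m pre : List Bool), pre.length + m.length + 1 < s →
      Run w s (.loop (test α r fun c => c != none) (Prog.move r .right))
        (d.put r (pre ++ m) (pre.length + 1) u) (d.put r (pre ++ m) (pre.length + m.length + 1) u) := by
    intro m
    induction m with
    | nil =>
      intro pre hs
      refine Run.loop_false (h.put _ _ hs _) ?_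
      simp [test, Data.scan_put, enc_end]
    | cons b m ih =>
      intro pre hs
      simp only [List.length_cons] at hs
      have hs' : pre.length + 1 < s := by omega
      refine Run.loop_true (h.put _ _ hs' _) ?_ (Run.move h hs' rfl) ?_
      · simp [test, Data.scan_put, enc_mid]
      · have := ih (pre ++ [b]) (by simp; omega)
        simp only [List.append_assoc, List.singleton_append, List.length_append,
          List.length_singleton] at this
        simpa [Machine.movePos, Nat.add_assoc, Nat.add_comm, Nat.add_left_comm] using this
  have left : ∀ (pre m : List Bool) (u : List Letter), pre.length + 1 < s →
      Run w s (.loop (test α r fun c => c != some none)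
        (Prog.onTape r (fun c => (c, .left)) fun c => c.join.map .bit))
        (d.put r (pre ++ m) pre.length u) (d.put r (pre ++ m) 0 (u ++ pre.reverse.map .bit)) := by
    intro pre
    induction pre using List.reverseRecOn with
    | nil =>
      intro m u hs
      have := Run.loop_false (w := w) (s := s) (t := test α r fun c => c != some none)
        (a := Prog.onTape r (fun c => (c, .left)) fun c => c.join.map .bit)
        (h.put r ([] ++ m) (p := 0) (by simpa using Nat.lt_of_succ_lt hs) u)
        (by simp [test, Data.scan_put, enc])
      simpa using this
    | append_singleton pre b ih =>
      intro m u hs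
      simp only [List.length_append, List.length_singleton] at hs ⊢
      have he : enc (pre ++ [b] ++ m) (pre.length + 1) = some (some b) := by
        simpa using enc_mid pre b m
      refine Run.loop_true (h.put _ _ (by omega) _) ?_
        (Run.onTape (l' := pre ++ [b] ++ m) (u' := u ++ [.bit b]) (p' := pre.length)
          h (by omega) (by simp) rfl (by rw [he]; rfl)) ?_
      · rw [test, Data.scan_put, he]; rfl
      · have := ih ([b] ++ m) (u ++ [.bit b]) (by omega)
        simpa using this
  refine Run.seq (h.put _ _ (by omega) _) (by simpa using right l [] (by simpa using hp))
    (Run.seq (h.put _ _ (by omega) _) (Run.move (p' := l.length) h (by omega) (by simp [Machine.movePos]))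
      (Run.seq (h.put _ _ (by omega) _) (by simpa using left l [] u hp) (Run.move h (by omega) rfl)))

end Prog
end

/-! ### Register programs that write computation sequences -/

/-- The registers. -/
inductive Reg where
  | cur | tmp | n | ctr | mulCtr | expCtr
  | empty | full | fst | snd
  | baseP | baseB | baseA | baseX | expBit | one | zero
  | res | sq | fac | mulBit | acc
  | ptrU | ptrV | ptrP | ptrS | ptrT | sel | nsel | cell | gap
  deriving DecidableEq

instance : Fintype Reg := Fintype.ofList [.cur, .tmp, .n, .ctr, .mulCtr, .expCtr, .empty, .full, .fst,
  .snd, .baseP, .baseB, .baseA, .baseX, .expBit, .one, .zero, .res, .sq, .fac, .mulBit, .acc,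
  .ptrU, .ptrV, .ptrP, .ptrS, .ptrT, .sel, .nsel, .cell, .gap] (by intro r; cases r <;> simp)

/-- The state of a register program: the registers, the position of the input head, and the
computation sequence that has been written. -/
structure St where
  env : Reg → ℕ
  ip : ℕ
  prog : List Instr

/-- Change a register. -/
def St.set (st : St) (r : Reg) (v : ℕ) : St := { st with env := Function.update st.env r v }

@[simp] theorem St.set_env (st : St) (r : Reg) (v : ℕ) :
    (st.set r v).env = Function.update st.env r v := rfl
@[simp] theorem St.set_prog (st : St) (r : Reg) (v : ℕ) : (st.set r v).prog = st.prog := rfl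

/-- The configuration with given registers, input head position, and output. -/
def conf (env : Reg → ℕ) (ip : ℕ) (out : List Letter) : Data Letter Reg Cell where
  inputPos := ip
  tape := fun r => enc (env r).bits
  pos := fun _ => 1
  out := out

/-- The configuration of a state. -/
def St.data (st : St) : Data Letter Reg Cell := conf st.env st.ip (encode st.prog)

theorem conf_put (env : Reg → ℕ) (ip : ℕ) (out : List Letter) (r : Reg) (v : ℕ)
    (out' : List Letter) :
    (conf env ip out).put r v.bits 1 out' = conf (Function.update env r v) ip out' := by
  rw [Data.ext_iff]
  refine ⟨rfl, ?_, ?_, rfl⟩ <;> funext j <;> by_cases h : j = r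
  · subst h; simp [Data.put, conf]
  · simp [Data.put, conf, h]
  · subst h; simp [Data.put, conf]
  · simp [Data.put, conf]

theorem conf_put_self (env : Reg → ℕ) (ip : ℕ) (out : List Letter) (r : Reg) (out' : List Letter) :
    (conf env ip out).put r (env r).bits 1 out' = conf env ip out' := by
  rw [conf_put, Function.update_eq_self]

theorem conf_bounded {w : List Bool} {b : ℕ} {env : Reg → ℕ} {ip : ℕ} {out : List Letter}
    (h : ip ≤ w.length + 1) : (conf env ip out).Bounded w (b + 3) :=
  ⟨h, fun _ => by simp [conf]⟩

theorem bits_length_le {v b : ℕ} (h : v < 2 ^ b) : v.bits.length ≤ b := by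
  rw [Nat.size_eq_bits_len]; exact Nat.size_le.mpr h

/-- Programs over the registers. -/
abbrev RProg := Prog Bool Letter Reg Cell

namespace Prog

section
variable {w : List Bool} {b : ℕ} {env : Reg → ℕ} {ip : ℕ} {out : List Letter} {r : Reg}

theorem run_inc (h : ip ≤ w.length + 1) (hr : env r < 2 ^ b) :
    Run w (b + 3) (inc r) (conf env ip out) (conf (Function.update env r (env r + 1)) ip out) := by
  have := Run.incBits (r := r) (l := (env r).bits) (u := out) (conf_bounded (b := b) (env := env)
    (out := out) h) (by have := bits_length_le hr; omega)
  rwa [← bits_succ, conf_put_self, conf_put] at this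

theorem run_dec (h : ip ≤ w.length + 1) (hr : env r < 2 ^ b) (h0 : env r ≠ 0) :
    Run w (b + 3) (dec r) (conf env ip out) (conf (Function.update env r (env r - 1)) ip out) := by
  obtain ⟨v, hv⟩ := Nat.exists_eq_succ_of_ne_zero h0
  have ht : ∀ v : ℕ, true ∈ (v + 1).bits := by
    intro v
    by_contra hh
    have hz : ∀ l : List Bool, true ∉ incBits l → False := by
      intro l
      induction l with
      | nil => simp [incBits]
      | cons c l ih => cases c <;> simp [incBits]; exact by_contra ih
    exact hz _ (bits_succ v ▸ hh)
  have := Run.decBits (r := r) (l := (env r).bits) (u := out) (conf_bounded (b := b) (env := env)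
    (out := out) h) (by have := bits_length_le hr; omega) (by rw [hv]; exact ht v)
  rw [conf_put_self, hv, Nat.succ_eq_add_one, ← bits_pred, conf_put] at this
  simpa [hv] using this

theorem run_emitNum (h : ip ≤ w.length + 1) (hr : env r < 2 ^ b) :
    Run w (b + 3) (emitNum r) (conf env ip out) (conf env ip (out ++ indexWord (env r))) := by
  have := Run.emitBits (r := r) (l := (env r).bits) (u := out) (conf_bounded (b := b) (env := env)
    (out := out) h) (by have := bits_length_le hr; omega)
  rwa [conf_put_self, conf_put_self] at this

/-- Write a letter. -/
def letter (l : Letter) : RProg := .act fun _ s => (.stay, fun j => (s j, .stay), some l)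

theorem run_letter (h : ip ≤ w.length + 1) (l : Letter) :
    Run w (b + 3) (letter l) (conf env ip out) (conf env ip (out ++ [l])) := by
  refine (congrArg (Run w (b + 3) (letter l) (conf env ip out)) ?_).mpr
    (Run.act (conf_bounded h))
  rw [Data.ext_iff]
  refine ⟨?_, ?_, ?_, ?_⟩ <;> simp [Data.apply, Data.scan, conf, Machine.movePos, h]

end

/-- Do nothing. -/
def skip : RProg := .act fun _ s => idle s

/-- Repeat a program. -/
def rep : ℕ → RProg → RProg
  | 0, _ => skip
  | k + 1, c => .seq c (rep k c)

theorem run_skip {w : List Bool} {b : ℕ} {d : Data Letter Reg Cell} (h : d.Bounded w b) :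
    Run w b skip d d := by
  refine (congrArg (Run w b skip d) ?_).mpr (Run.act h)
  exact (Data.apply_idle h.1).symm

theorem run_rep_inc {w : List Bool} {b ip : ℕ} {out : List Letter} {r : Reg}
    (h : ip ≤ w.length + 1) (k : ℕ) : ∀ env : Reg → ℕ, env r + k ≤ 2 ^ b →
    Run w (b + 3) (rep k (inc r)) (conf env ip out)
      (conf (Function.update env r (env r + k)) ip out) := by
  induction k with
  | zero => intro env _; simpa [rep] using run_skip (conf_bounded h)
  | succ k ih =>
    intro env hr
    refine Run.seq (conf_bounded h) (run_inc h (by omega)) ?_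
    have := ih (Function.update env r (env r + 1)) (by simp; omega)
    simpa [Nat.add_assoc, Nat.add_comm 1 k] using this

theorem run_rep_dec {w : List Bool} {b ip : ℕ} {out : List Letter} {r : Reg}
    (h : ip ≤ w.length + 1) (k : ℕ) : ∀ env : Reg → ℕ, env r < 2 ^ b → k ≤ env r →
    Run w (b + 3) (rep k (dec r)) (conf env ip out)
      (conf (Function.update env r (env r - k)) ip out) := by
  induction k with
  | zero => intro env _ _; simpa [rep] using run_skip (conf_bounded h)
  | succ k ih =>
    intro env hr hk
    refine Run.seq (conf_bounded h) (run_dec h hr (by omega)) ?_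
    have := ih (Function.update env r (env r - 1)) (by simp; omega) (by simp; omega)
    simpa [Nat.sub_sub, Nat.add_comm 1 k] using this

/-- The program `c` leads from `st` to `st'`, with registers of `b` bits. -/
def Exec (w : List Bool) (b : ℕ) (c : RProg) (st st' : St) : Prop :=
  st.ip ≤ w.length + 1 → st'.ip ≤ w.length + 1 ∧ Run w (b + 3) c st.data st'.data

variable {w : List Bool} {b : ℕ} {st st₁ st₂ st₃ : St} {r : Reg}

theorem Exec.seq {c₁ c₂ : RProg} (h₁ : Exec w b c₁ st₁ st₂) (h₂ : Exec w b c₂ st₂ st₃) :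
    Exec w b (.seq c₁ c₂) st₁ st₃ := fun h =>
  ⟨(h₂ (h₁ h).1).1, Run.seq (conf_bounded h) (h₁ h).2 (h₂ (h₁ h).1).2⟩

theorem exec_skip : Exec w b skip st st := fun h => ⟨h, run_skip (conf_bounded h)⟩

theorem exec_dec (hr : st.env r < 2 ^ b) (h0 : st.env r ≠ 0) :
    Exec w b (dec r) st (st.set r (st.env r - 1)) := fun h => ⟨h, run_dec h hr h0⟩

theorem exec_inc (hr : st.env r < 2 ^ b) :
    Exec w b (inc r) st (st.set r (st.env r + 1)) := fun h => ⟨h, run_inc h hr⟩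

theorem exec_rep_inc {k : ℕ} (hr : st.env r + k ≤ 2 ^ b) :
    Exec w b (rep k (inc r)) st (st.set r (st.env r + k)) := fun h =>
  ⟨h, run_rep_inc h k _ hr⟩

theorem exec_rep_dec {k : ℕ} (hr : st.env r < 2 ^ b) (hk : k ≤ st.env r) :
    Exec w b (rep k (dec r)) st (st.set r (st.env r - k)) := fun h =>
  ⟨h, run_rep_dec h k _ hr hk⟩

/-- A register is not zero. -/
def nonzero (r : Reg) : InputCell Bool → (Reg → Cell) → Bool := test Bool r fun c => c != none

/-- Without leading zeros, only the number 0 leaves cell 1 blank, so one scanned symbol decides the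
test. -/
theorem nonzero_scan (x : InputCell Bool) (st : St) (r : Reg) :
    nonzero r x st.data.scan = decide (st.env r ≠ 0) := by
  have h : st.data.scan r = (st.env r).bits[0]?.map some := rfl
  rw [nonzero, test, h]
  cases hv : st.env r with
  | zero => simp
  | succ v =>
    rw [bits_succ]
    rcases v.bits with _ | ⟨_ | _, _⟩ <;> simp [incBits]

/-- A test on the input cell. -/
def onInput (t : InputCell Bool → Bool) : InputCell Bool → (Reg → Cell) → Bool := fun x _ => t x

/-- Move the input head. -/
def moveInput (m : Move) : RProg := .act fun _ s => (m, fun j => (s j, .stay), none)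

theorem exec_moveInput (m : Move) : Exec w b (moveInput m) st
    { st with ip := min (Machine.movePos m st.ip) (w.length + 1) } := by
  refine fun h => ⟨min_le_right _ _, ?_⟩
  refine (congrArg (Run w (b + 3) (moveInput m) st.data) ?_).mpr (Run.act (conf_bounded h))
  rw [Data.ext_iff]
  refine ⟨?_, ?_, ?_, ?_⟩ <;> simp [Data.apply, Data.scan, conf, Machine.movePos, St.data]

theorem exec_ite {t : InputCell Bool → (Reg → Cell) → Bool} {c₁ c₂ : RProg}
    (h : Exec w b (if t (Machine.inputCell w st₁.ip) st₁.data.scan then c₁ else c₂) st₁ st₂) :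
    Exec w b (.ite t c₁ c₂) st₁ st₂ :=
  fun hip => ⟨(h hip).1, Run.ite (conf_bounded hip) (h hip).2⟩

theorem exec_loop {t : InputCell Bool → (Reg → Cell) → Bool} {c : RProg} {N : ℕ}
    (Inv : ℕ → St → Prop)
    (hstep : ∀ i st, i < N → Inv i st → t (Machine.inputCell w st.ip) st.data.scan = true ∧
      ∃ st', Exec w b c st st' ∧ Inv (i + 1) st')
    (hend : ∀ st, Inv N st → t (Machine.inputCell w st.ip) st.data.scan = false)
    (h0 : Inv 0 st) : ∃ st', Exec w b (.loop t c) st st' ∧ Inv N st' := by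
  suffices H : ∀ k i st, i + k = N → Inv i st →
      ∃ st', Exec w b (.loop t c) st st' ∧ Inv N st' from H N 0 st (by omega) h0
  intro k
  induction k with
  | zero =>
    intro i st hi h
    obtain rfl : i = N := hi
    exact ⟨st, fun hip => ⟨hip, Run.loop_false (conf_bounded hip) (hend st h)⟩, h⟩
  | succ k ih =>
    intro i st hi h
    obtain ⟨ht, st', he, h'⟩ := hstep i st (by omega) h
    obtain ⟨st'', he', h''⟩ := ih (i + 1) st' (by omega) h'
    exact ⟨st'', fun hip => ⟨(he' (he hip).1).1,
      Run.loop_true (conf_bounded hip) ht (he hip).2 (he' (he hip).1).2⟩, h''⟩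

/-- Set the register `dst` to the value of the register `src`. -/
def copy (dst src : Reg) : RProg :=
  .seq (.loop (nonzero dst) (dec dst))
    (.seq (.loop (nonzero src) (.seq (dec src) (.seq (inc dst) (inc .tmp))))
      (.loop (nonzero .tmp) (.seq (dec .tmp) (inc src))))

/-- The source is counted down into `dst` and `.tmp` at once and then restored from `.tmp`. Hence
`.tmp` must be 0 before and is 0 again afterwards. The three loops have invariants that give all
registers explicitly. -/
theorem exec_copy {dst src : Reg} (hd : dst ≠ .tmp) (hs : src ≠ .tmp) (hds : dst ≠ src)
    (ht : st.env .tmp = 0) (hb : ∀ r, st.env r < 2 ^ b) :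
    Exec w b (copy dst src) st (st.set dst (st.env src)) := by
  obtain ⟨s₁, e₁, i₁⟩ := exec_loop (w := w) (b := b) (t := nonzero dst) (c := dec dst) (N := st.env dst)
    (st := st) (fun i s => s = st.set dst (st.env dst - i))
    (by
      rintro i _ hi rfl
      have := hb dst
      refine ⟨by rw [nonzero_scan]; simp; omega, _, exec_dec (by simp; omega) (by simp; omega), ?_⟩
      simp [St.set, Nat.sub_sub])
    (by rintro _ rfl; rw [nonzero_scan]; simp) (by simp [St.set])
  obtain ⟨s₂, e₂, i₂⟩ := exec_loop (w := w) (b := b) (t := nonzero src)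
    (c := .seq (dec src) (.seq (inc dst) (inc .tmp))) (N := st.env src) (st := s₁)
    (fun i s => s = ((st.set dst i).set src (st.env src - i)).set .tmp i)
    (by
      rintro i _ hi rfl
      have := hb src
      refine ⟨by rw [nonzero_scan]; simp [hs]; omega, _, .seq (exec_dec ?_ ?_) (.seq (exec_inc ?_)
        (exec_inc ?_)), ?_⟩
      · simp [hs]; omega
      · simp [hs]; omega
      · simp [hd, hds]; omega
      · simp [hd.symm, hs.symm]; omega
      · simp only [St.set, St.mk.injEq, and_true]
        funext r
        by_cases h1 : r = .tmp <;> by_cases h2 : r = src <;> by_cases h3 : r = dst <;>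
          simp_all [Function.update_apply, Nat.sub_sub])
    (by rintro _ rfl; rw [nonzero_scan]; simp [hs])
    (by
      rw [i₁]
      simp only [St.set, St.mk.injEq, and_true]
      funext r
      by_cases h1 : r = .tmp <;> by_cases h2 : r = src <;> by_cases h3 : r = dst <;>
        simp_all)
  obtain ⟨s₃, e₃, i₃⟩ := exec_loop (w := w) (b := b) (t := nonzero .tmp)
    (c := .seq (dec .tmp) (inc src)) (N := st.env src) (st := s₂)
    (fun i s => s = ((st.set dst (st.env src)).set src i).set .tmp (st.env src - i))
    (by
      rintro i _ hi rfl
      have := hb src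
      refine ⟨by rw [nonzero_scan]; simp; omega, _, .seq (exec_dec ?_ ?_) (exec_inc ?_), ?_⟩
      · simp; omega
      · simp; omega
      · simp [hs]; omega
      · simp only [St.set, St.mk.injEq, and_true]
        funext r
        by_cases h1 : r = .tmp <;> by_cases h2 : r = src <;> by_cases h3 : r = dst <;>
          simp_all [Nat.sub_sub])
    (by rintro _ rfl; rw [nonzero_scan]; simp)
    (by rw [i₂]; simp)
  have : s₃ = st.set dst (st.env src) := by
    rw [i₃]
    simp only [St.set, St.mk.injEq, and_true]
    funext r
    by_cases h1 : r = .tmp <;> by_cases h2 : r = src <;> by_cases h3 : r = dst <;>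
      simp_all
  exact this ▸ e₁.seq (e₂.seq e₃)

/-- Execute `c` as often as the register `num` says. -/
def forLoop (cnt num : Reg) (c : RProg) : RProg :=
  .seq (copy cnt num) (.loop (nonzero cnt) (.seq c (dec cnt)))

/-- The counter runs down while the index of the invariant runs up. The body must leave the counter
alone, and the invariant is asserted after the decrement. -/
theorem exec_forLoop {cnt num : Reg} {c : RProg} (hc : cnt ≠ .tmp) (hn : num ≠ .tmp)
    (hcn : cnt ≠ num) (ht : st.env .tmp = 0) (hb : ∀ r, st.env r < 2 ^ b) (Inv : ℕ → St → Prop)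
    (h0 : Inv 0 (st.set cnt (st.env num)))
    (hstep : ∀ i s, i < st.env num → Inv i s → s.env cnt = st.env num - i →
      ∃ s', Exec w b c s s' ∧ s'.env cnt = s.env cnt ∧ Inv (i + 1) (s'.set cnt (st.env num - i - 1))) :
    ∃ s, Exec w b (forLoop cnt num c) st s ∧ Inv (st.env num) s := by
  obtain ⟨s, e, i⟩ := exec_loop (w := w) (b := b) (t := nonzero cnt) (c := .seq c (dec cnt))
    (N := st.env num) (st := st.set cnt (st.env num))
    (fun i s => Inv i s ∧ s.env cnt = st.env num - i)
    (by
      rintro i s hi ⟨h1, h2⟩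
      obtain ⟨s', e, h3, h4⟩ := hstep i s hi h1 h2
      have := hb num
      refine ⟨by rw [nonzero_scan, h2]; simp; omega, _, e.seq (exec_dec (by omega) (by omega)), ?_⟩
      rw [h3, h2]
      exact ⟨h4, by simp; omega⟩)
    (by rintro s ⟨-, h⟩; rw [nonzero_scan, h]; simp) ⟨h0, by simp⟩
  exact ⟨s, (exec_copy hc hn hcn ht hb).seq e, i.1⟩

end Prog

/-! ### Gates -/

/-- An operand of a gate: the instruction whose index is in a register, or the instruction that
stands `j + 1` positions before the gate. -/
inductive Ref where
  | reg (r : Reg)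
  | back (j : ℕ)

/-- Instructions with symbolic operands. -/
inductive Gate where
  | bin (o : BinOp) (x y : Ref)
  | not (x : Ref)
  | out (x : Ref)

/-- The index of an operand. -/
def Ref.index (env : Reg → ℕ) : Ref → ℕ
  | .reg r => env r
  | .back j => env .cur - (j + 1)

/-- The instruction of a gate. -/
def Gate.instr (env : Reg → ℕ) : Gate → Instr
  | .bin o x y => .binary o (x.index env) (y.index env)
  | .not x => .not (x.index env)
  | .out x => .output (x.index env)

/-- `m` instructions precede, and the registers in `V` point to some of them. -/
def Ref.Wf (V : Reg → Prop) (m : ℕ) : Ref → Prop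
  | .reg r => V r
  | .back j => j < m

/-- The operands of a gate are well-formed. -/
def Gate.Wf (V : Reg → Prop) (m : ℕ) : Gate → Prop
  | .bin _ x y => x.Wf V m ∧ y.Wf V m
  | .not x => x.Wf V m
  | .out x => x.Wf V m

/-- The operands of successive gates are well-formed. -/
def BlockWf (V : Reg → Prop) : ℕ → List Gate → Prop
  | _, [] => True
  | m, g :: gs => g.Wf V m ∧ BlockWf V (m + 1) gs

/-- The value of an operand, given the values of the registers and the preceding values. -/
def Ref.eval (ρ : Reg → Set ℝ) (h : List (Set ℝ)) : Ref → Set ℝ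
  | .reg r => ρ r
  | .back j => h.getD j ∅

/-- The value of a gate. -/
def Gate.eval (ρ : Reg → Set ℝ) (h : List (Set ℝ)) : Gate → Set ℝ
  | .bin o x y => o.eval (x.eval ρ h) (y.eval ρ h)
  | .not x => Set.Ico 0 1 \ x.eval ρ h
  | .out x => x.eval ρ h

/-- The values after successive gates, the most recent one first. -/
def evalBlock (ρ : Reg → Set ℝ) : List (Set ℝ) → List Gate → List (Set ℝ)
  | h, [] => h
  | h, g :: gs => evalBlock ρ (g.eval ρ h :: h) gs

open Classical in
/-- The output of a gate. -/
noncomputable def Gate.emit (ρ : Reg → Set ℝ) (h : List (Set ℝ)) : Gate → List Bool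
  | .out x => [decide (x.eval ρ h).Nonempty]
  | _ => []

/-- The output of successive gates. -/
noncomputable def emitBlock (ρ : Reg → Set ℝ) : List (Set ℝ) → List Gate → List Bool
  | _, [] => []
  | h, g :: gs => g.emit ρ h ++ emitBlock ρ (g.eval ρ h :: h) gs

theorem values_append (S : List Instr) (I : Instr) :
    values (S ++ [I]) = values S ++ [I.eval (values S)] := by simp [values]

@[simp] theorem values_length (S : List Instr) : (values S).length = S.length := by
  induction S using List.reverseRecOn with
  | nil => rfl
  | append_singleton S I ih => simp [values_append, ih]

theorem answer_append (S : List Instr) (I : Instr) :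
    answer (S ++ [I]) = answer S ++ (I.emit (I.eval (values S))).toList := by
  rw [answer, values_append, List.zip_append (by simp), List.filterMap_append]
  congr 1

theorem values_prefix {S T : List Instr} (h : S <+: T) : values S <+: values T := by
  obtain ⟨U, rfl⟩ := h
  induction U using List.reverseRecOn with
  | nil => simp
  | append_singleton U I ih =>
    rw [← List.append_assoc, values_append]
    exact ih.trans (List.prefix_append _ _)

theorem encode_append (S : List Instr) (I : Instr) : encode (S ++ [I]) = encode S ++ I.encode := by
  simp [encode]

/-- The `p`-th value of `S` exists and is `A`. -/
def Val (S : List Instr) (p : ℕ) (A : Set ℝ) : Prop :=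
  1 ≤ p ∧ p ≤ S.length ∧ nth (values S) p = A

theorem Val.mono {S T : List Instr} {p : ℕ} {A : Set ℝ} (h : Val S p A) (hST : S <+: T) :
    Val T p A := by
  refine ⟨h.1, h.2.1.trans hST.length_le, ?_⟩
  rw [← h.2.2]
  obtain ⟨U, hU⟩ := values_prefix hST
  have := h.1
  have := h.2.1
  rw [nth, nth, ← hU, List.getD_append _ _ _ _ (by simp; omega)]

/-- Blocks are evaluated with the most recent value first, whereas pointers count from the beginning
and from 1; an entry with `j` later values has position `S.length - j`. -/
theorem Val.of_reverse {S : List Instr} {j : ℕ} {A : Set ℝ}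
    (h : (values S).reverse[j]? = some A) : Val S (S.length - j) A := by
  obtain ⟨hj, h⟩ := List.getElem?_eq_some_iff.mp h
  simp only [List.length_reverse, values_length] at hj
  refine ⟨by omega, by omega, ?_⟩
  rw [List.getElem_reverse] at h
  simp only [values_length] at h
  rw [nth, List.getD_eq_getElem _ _ (by simp; omega), ← h]
  congr 1
  omega

/-- The state is in order, and the registers have less than `b` bits. -/
structure Good (b : ℕ) (st : St) : Prop where
  cur : st.env .cur = st.prog.length + 1
  tmp : st.env .tmp = 0
  lt : ∀ r, st.env r < 2 ^ b
  head : st.prog.head? = some .firstHalf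
  allowed : ∀ (i : ℕ) (h : i < st.prog.length), (st.prog[i]'h).AllowedAt (i + 1)

theorem Good.set {b : ℕ} {st : St} (h : Good b st) {r : Reg} (hc : r ≠ .cur) (ht : r ≠ .tmp)
    {v : ℕ} (hv : v < 2 ^ b) : Good b (st.set r v) where
  cur := by simpa [hc.symm] using h.cur
  tmp := by simpa [ht.symm] using h.tmp
  lt := by
    intro q
    by_cases hq : q = r
    · subst hq; simpa using hv
    · simpa [hq] using h.lt q
  head := h.head
  allowed := h.allowed

namespace Prog

/-- Write an operand. -/
def emitRef : Ref → RProg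
  | .reg r => emitNum r
  | .back j => .seq (rep (j + 1) (dec .cur)) (.seq (emitNum .cur) (rep (j + 1) (inc .cur)))

theorem run_emitRef {w : List Bool} {b ip : ℕ} {env : Reg → ℕ} {out : List Letter}
    (h : ip ≤ w.length + 1) (hb : ∀ r, env r < 2 ^ b) {m : ℕ} (hm : m < env .cur)
    {x : Ref} {V : Reg → Prop} (hx : x.Wf V m) :
    Run w (b + 3) (emitRef x) (conf env ip out) (conf env ip (out ++ indexWord (x.index env))) := by
  cases x with
  | reg r => exact run_emitNum h (hb r)
  | back j =>
    have hj : j < m := hx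
    have hc := hb .cur
    refine Run.seq (conf_bounded h) (run_rep_dec h _ _ hc (by omega))
      (Run.seq (conf_bounded h) (run_emitNum h (by simp; omega)) ?_)
    have := run_rep_inc (w := w) (b := b) (ip := ip) (r := .cur) h (j + 1)
      (out := out ++ indexWord (env .cur - (j + 1)))
      (Function.update env .cur (env .cur - (j + 1))) (by simp; omega)
    have h2 : env .cur - (j + 1) + (j + 1) = env .cur := by omega
    simpa [h2, Ref.index] using this

/-- Write a gate. -/
def emitGate : Gate → RProg
  | .bin o x y => .seq (letter (.op o)) (.seq (emitRef x) (.seq (letter .comma)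
      (.seq (emitRef y) (inc .cur))))
  | .not x => .seq (letter .not) (.seq (emitRef x) (inc .cur))
  | .out x => .seq (letter .output) (.seq (emitRef x) (inc .cur))

/-- The state after a gate. -/
def _root_.IntervalComputing.St.push (st : St) (g : Gate) : St where
  env := Function.update st.env .cur (st.env .cur + 1)
  ip := st.ip
  prog := st.prog ++ [g.instr st.env]

theorem exec_emitGate {w : List Bool} {b : ℕ} {st : St} (hb : ∀ r, st.env r < 2 ^ b) {m : ℕ}
    (hm : m < st.env .cur) {g : Gate} {V : Reg → Prop} (hg : g.Wf V m) :
    Exec w b (emitGate g) st (st.push g) := by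
  refine fun h => ⟨h, ?_⟩
  cases g with
  | bin o x y =>
    have := Run.seq (conf_bounded h) (run_letter h (.op o)) (Run.seq (conf_bounded h)
      (run_emitRef (out := encode st.prog ++ [.op o]) h hb hm hg.1) (Run.seq (conf_bounded h)
      (run_letter h .comma) (Run.seq (conf_bounded h) (run_emitRef h hb hm hg.2)
      (run_inc h (hb .cur)))))
    simpa [St.data, St.push, encode_append, Instr.encode, Gate.instr, emitGate] using this
  | not x =>
    have := Run.seq (conf_bounded h) (run_letter h .not) (Run.seq (conf_bounded h)
      (run_emitRef (out := encode st.prog ++ [.not]) h hb hm hg) (run_inc h (hb .cur)))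
    simpa [St.data, St.push, encode_append, Instr.encode, Gate.instr, emitGate] using this
  | out x =>
    have := Run.seq (conf_bounded h) (run_letter h .output) (Run.seq (conf_bounded h)
      (run_emitRef (out := encode st.prog ++ [.output]) h hb hm hg) (run_inc h (hb .cur)))
    simpa [St.data, St.push, encode_append, Instr.encode, Gate.instr, emitGate] using this

/-- Write successive gates. -/
def block : List Gate → RProg
  | [] => skip
  | g :: gs => .seq (emitGate g) (block gs)

/-- The register points to an instruction. -/
def _root_.IntervalComputing.St.Ptr (st : St) (r : Reg) : Prop :=
  r ≠ .cur ∧ 1 ≤ st.env r ∧ st.env r ≤ st.prog.length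

/-- The value that a register points to. -/
noncomputable def _root_.IntervalComputing.St.val (st : St) (r : Reg) : Set ℝ :=
  nth (values st.prog) (st.env r)

/-- Well-formed operands point to earlier instructions: a `back` operand because it is smaller than
the number of instructions so far, a register by `St.Ptr`. -/
theorem push_good {b : ℕ} {st : St} (h : Good b st) (hs : st.prog.length + 2 < 2 ^ b) {g : Gate}
    (hg : g.Wf st.Ptr st.prog.length) : Good b (st.push g) where
  cur := by simp [St.push, h.cur]
  tmp := by simpa [St.push] using h.tmp
  lt := by
    intro r
    by_cases hr : r = .cur
    · subst hr; simpa [St.push, h.cur] using hs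
    · simpa [St.push, hr] using h.lt r
  head := by simp [St.push, h.head]
  allowed := by
    intro i hi
    simp only [St.push, List.length_append, List.length_singleton] at hi
    rcases Nat.lt_succ_iff_lt_or_eq.mp hi with hi | rfl
    · simpa [St.push, List.getElem_append_left hi] using h.allowed i hi
    · have key : ∀ x : Ref, x.Wf st.Ptr st.prog.length →
          1 ≤ x.index st.env ∧ x.index st.env ≤ st.prog.length := by
        intro x hx
        cases x with
        | reg r => exact hx.2
        | back j =>
          have : j < st.prog.length := hx
          simp only [Ref.index, h.cur]
          omega
      cases g with
      | bin o x y => simpa [St.push, Gate.instr, Instr.AllowedAt] using ⟨key x hg.1, key y hg.2⟩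
      | not x => simpa [St.push, Gate.instr, Instr.AllowedAt] using key x hg
      | out x => simpa [St.push, Gate.instr, Instr.AllowedAt] using key x hg

theorem index_val {b : ℕ} {st : St} (h : Good b st) {x : Ref}
    (hx : x.Wf st.Ptr st.prog.length) :
    nth (values st.prog) (x.index st.env) = x.eval st.val (values st.prog).reverse := by
  cases x with
  | reg r => rfl
  | back j =>
    have hj : j < st.prog.length := hx
    have : (values st.prog).reverse[j]? = some (((values st.prog).reverse).getD j ∅) := by
      rw [List.getD_eq_getElem _ _ (by simpa using hj), List.getElem?_eq_getElem]
    have := (Val.of_reverse this).2.2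
    rw [Ref.index, h.cur, Ref.eval, ← this]
    congr 1
    omega

theorem push_values {b : ℕ} {st : St} (h : Good b st) {g : Gate}
    (hg : g.Wf st.Ptr st.prog.length) : (values (st.push g).prog).reverse =
      g.eval st.val (values st.prog).reverse :: (values st.prog).reverse := by
  rw [St.push, values_append, List.reverse_append]
  cases g with
  | bin o x y => simp [Gate.instr, Instr.eval, Gate.eval, index_val h hg.1, index_val h hg.2]
  | not x => simp [Gate.instr, Instr.eval, Gate.eval, index_val h (x := x) hg]
  | out x => simp [Gate.instr, Instr.eval, Gate.eval, index_val h (x := x) hg]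

theorem push_answer {b : ℕ} {st : St} (h : Good b st) {g : Gate}
    (hg : g.Wf st.Ptr st.prog.length) : answer (st.push g).prog =
      answer st.prog ++ g.emit st.val (values st.prog).reverse := by
  rw [St.push, answer_append]
  congr 1
  cases g with
  | bin o x y => rfl
  | not x => rfl
  | out x => simp [Gate.instr, Instr.eval, Instr.emit, Gate.emit, index_val h (x := x) hg]

theorem Ref.Wf.mono {V V' : Reg → Prop} (h : ∀ r, V r → V' r) {m : ℕ} {x : Ref}
    (hx : x.Wf V m) : x.Wf V' m := by
  cases x with
  | reg r => exact h r hx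
  | back j => exact hx

theorem BlockWf.mono {V V' : Reg → Prop} (h : ∀ r, V r → V' r) (gs : List Gate) :
    ∀ {m : ℕ}, BlockWf V m gs → BlockWf V' m gs := by
  induction gs with
  | nil => intros; trivial
  | cons g gs ih =>
    intro m hg
    refine ⟨?_, ih hg.2⟩
    have h1 := hg.1
    cases g with
    | bin o x y => exact ⟨Ref.Wf.mono h h1.1, Ref.Wf.mono h h1.2⟩
    | not x => exact Ref.Wf.mono h (x := x) h1
    | out x => exact Ref.Wf.mono h (x := x) h1

theorem ref_eval_congr {V : Reg → Prop} {ρ ρ' : Reg → Set ℝ} (h : ∀ r, V r → ρ r = ρ' r) {m : ℕ}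
    {x : Ref} (hx : x.Wf V m) (l : List (Set ℝ)) : x.eval ρ l = x.eval ρ' l := by
  cases x with
  | reg r => exact h r hx
  | back j => rfl

theorem gate_eval_congr {V : Reg → Prop} {ρ ρ' : Reg → Set ℝ} (h : ∀ r, V r → ρ r = ρ' r) {m : ℕ}
    {g : Gate} (hg : g.Wf V m) (l : List (Set ℝ)) : g.eval ρ l = g.eval ρ' l := by
  cases g with
  | bin o x y => simp only [Gate.eval, ref_eval_congr h hg.1, ref_eval_congr h hg.2]
  | not x => simp only [Gate.eval, ref_eval_congr h (x := x) hg]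
  | out x => simp only [Gate.eval, ref_eval_congr h (x := x) hg]

theorem gate_emit_congr {V : Reg → Prop} {ρ ρ' : Reg → Set ℝ} (h : ∀ r, V r → ρ r = ρ' r) {m : ℕ}
    {g : Gate} (hg : g.Wf V m) (l : List (Set ℝ)) : g.emit ρ l = g.emit ρ' l := by
  cases g with
  | bin o x y => rfl
  | not x => rfl
  | out x => simp only [Gate.emit]; rw [ref_eval_congr h (x := x) hg]

theorem block_eval_congr {V : Reg → Prop} {ρ ρ' : Reg → Set ℝ} (h : ∀ r, V r → ρ r = ρ' r)
    (gs : List Gate) : ∀ {m : ℕ} (_ : BlockWf V m gs) (l : List (Set ℝ)),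
      evalBlock ρ l gs = evalBlock ρ' l gs ∧ emitBlock ρ l gs = emitBlock ρ' l gs := by
  induction gs with
  | nil => intros; exact ⟨rfl, rfl⟩
  | cons g gs ih =>
    intro m hg l
    rw [evalBlock, evalBlock, emitBlock, emitBlock, gate_eval_congr h hg.1, gate_emit_congr h hg.1]
    exact ⟨(ih hg.2 _).1, by rw [(ih hg.2 _).2]⟩

/-- Appending gates changes no earlier value and no register except `.cur`, which `St.Ptr` excludes.
The whole block can therefore be evaluated with the register values from before it, and the
semantics of the written instructions reduces to `evalBlock` and `emitBlock`. -/
theorem exec_block {w : List Bool} {b : ℕ} (gs : List Gate) : ∀ {st : St}, Good b st →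
    st.prog.length + gs.length + 1 < 2 ^ b → BlockWf st.Ptr st.prog.length gs →
    ∃ st', Exec w b (block gs) st st' ∧ Good b st' ∧ st.prog <+: st'.prog ∧
      st'.prog.length = st.prog.length + gs.length ∧ st'.ip = st.ip ∧
      (∀ r, r ≠ .cur → st'.env r = st.env r) ∧
      (values st'.prog).reverse = evalBlock st.val (values st.prog).reverse gs ∧
      answer st'.prog = answer st.prog ++ emitBlock st.val (values st.prog).reverse gs := by
  induction gs with
  | nil => exact fun {st} h _ _ => ⟨st, exec_skip, h, List.prefix_rfl, rfl, rfl, fun _ _ => rfl, rfl,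
      by simp [emitBlock]⟩
  | cons g gs ih =>
    intro st h hl hg
    simp only [List.length_cons] at hl
    have hpre : st.prog <+: (st.push g).prog := List.prefix_append _ _
    have henv : ∀ r, r ≠ .cur → (st.push g).env r = st.env r := fun r hr => by simp [St.push, hr]
    have hlen : (st.push g).prog.length = st.prog.length + 1 := by simp [St.push]
    have hval : ∀ r, st.Ptr r → (st.push g).val r = st.val r := fun r hr => by
      rw [St.val, henv r hr.1]
      exact (Val.mono ⟨hr.2.1, hr.2.2, rfl⟩ hpre).2.2
    have hptr : ∀ r, st.Ptr r → (st.push g).Ptr r := fun r hr => by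
      refine ⟨hr.1, ?_⟩
      rw [henv r hr.1, hlen]
      exact ⟨hr.2.1, hr.2.2.trans (Nat.le_succ _)⟩
    obtain ⟨st', e, h1, h2, h3, h4, h5, h6, h7⟩ := ih (push_good h (by omega) hg.1)
      (by rw [hlen]; omega) (by rw [hlen]; exact BlockWf.mono hptr gs hg.2)
    obtain ⟨c1, c2⟩ := block_eval_congr hval gs hg.2
      (g.eval st.val (values st.prog).reverse :: (values st.prog).reverse)
    rw [push_values h hg.1] at h6 h7
    refine ⟨st', .seq (exec_emitGate h.lt (m := st.prog.length) (by rw [h.cur]; omega) hg.1) e, h1,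
      hpre.trans h2, by rw [h3, hlen, List.length_cons]; omega, h4,
      fun r hr => (h5 r hr).trans (henv r hr), ?_, ?_⟩
    · rw [h6, evalBlock, c1]
    · rw [h7, emitBlock, c2, push_answer h hg.1, List.append_assoc]

end Prog

/-! ### Arithmetic modulo `p` on numbers with `N` bits -/

/-- The carry into the `i`-th bit of `x + y + c`. -/
def carry (x y : ℕ) (c : Bool) (i : ℕ) : Bool := decide (2 ^ i ≤ x % 2 ^ i + y % 2 ^ i + c.toNat)

theorem carry_zero (x y : ℕ) (c : Bool) : carry x y c 0 = c := by
  cases c <;> simp [carry, Nat.mod_one]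

/-- Splitting both summands at bit `i`, the low parts contribute to the quotient only their carry,
which is at most 1. The parity of this identity is the sum bit of an adder. -/
theorem add_div_two_pow (x y : ℕ) (c : Bool) (i : ℕ) :
    (x + y + c.toNat) / 2 ^ i = x / 2 ^ i + y / 2 ^ i + (carry x y c i).toNat := by
  have hp : 0 < 2 ^ i := by positivity
  have hx := Nat.mod_add_div x (2 ^ i)
  have hy := Nat.mod_add_div y (2 ^ i)
  have hxl := Nat.mod_lt x hp
  have hyl := Nat.mod_lt y hp
  have hc : c.toNat ≤ 1 := Bool.toNat_le c
  have h : x + y + c.toNat = (x % 2 ^ i + y % 2 ^ i + c.toNat) + 2 ^ i * (x / 2 ^ i + y / 2 ^ i) := by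
    rw [Nat.mul_add]; omega
  rw [h, Nat.add_mul_div_left _ _ hp, Nat.add_comm]
  congr 1
  rw [carry]
  by_cases hh : 2 ^ i ≤ x % 2 ^ i + y % 2 ^ i + c.toNat
  · simp only [hh, decide_true, Bool.toNat_true]
    exact Nat.div_eq_of_lt_le (by omega) (by omega)
  · simp only [hh, decide_false, Bool.toNat_false]
    exact Nat.div_eq_of_lt (by omega)

theorem testBit_add_carry (x y : ℕ) (c : Bool) (i : ℕ) :
    (x + y + c.toNat).testBit i = (x.testBit i ^^ y.testBit i ^^ carry x y c i) := by
  simp only [Nat.testBit_eq_decide_div_mod_eq, add_div_two_pow]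
  rcases Nat.mod_two_eq_zero_or_one (x / 2 ^ i) with h1 | h1 <;>
  rcases Nat.mod_two_eq_zero_or_one (y / 2 ^ i) with h2 | h2 <;>
  cases carry x y c i <;> simp [h1, h2, Nat.add_mod]

theorem carry_succ (x y : ℕ) (c : Bool) (i : ℕ) : carry x y c (i + 1) =
    ((x.testBit i && y.testBit i) || ((x.testBit i ^^ y.testBit i) && carry x y c i)) := by
  have hp : 0 < 2 ^ i := by positivity
  have hxl := Nat.mod_lt x hp
  have hyl := Nat.mod_lt y hp
  have hc : c.toNat ≤ 1 := Bool.toNat_le c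
  simp only [carry, Nat.testBit_eq_decide_div_mod_eq, Nat.mod_pow_succ]
  rw [pow_succ]
  rcases Nat.mod_two_eq_zero_or_one (x / 2 ^ i) with h1 | h1 <;>
  rcases Nat.mod_two_eq_zero_or_one (y / 2 ^ i) with h2 | h2 <;>
  simp [h1, h2] <;> omega

/-- Addition modulo `p` (with result truncated to `N` bits). -/
def modAdd (N p u m : ℕ) : ℕ := (if p ≤ u + m then u + m - p else u + m) % 2 ^ N

theorem modAdd_lt (N p u m : ℕ) : modAdd N p u m < 2 ^ N := Nat.mod_lt _ (by positivity)

theorem modAdd_eq {N p u m : ℕ} (hp : p ≤ 2 ^ N) (hu : u < p) (hm : m < p) :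
    modAdd N p u m = (u + m) % p := by
  rw [modAdd]
  split_ifs with h
  · rw [Nat.mod_eq_of_lt (a := u + m - p) (by omega), Nat.mod_eq_sub_mod h,
      Nat.mod_eq_of_lt (a := u + m - p) (by omega)]
  · rw [Nat.mod_eq_of_lt (a := u + m) (b := 2 ^ N) (by omega), Nat.mod_eq_of_lt (by omega)]

/-- The complement of `p` with respect to `N` bits. -/
def complBits (N p : ℕ) : ℕ := 2 ^ N - (p + 1)

theorem testBit_complBits {N p i : ℕ} (hp : p < 2 ^ N) (hi : i < N) :
    (complBits N p).testBit i = !p.testBit i := by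
  rw [complBits, Nat.testBit_two_pow_sub_succ hp]; simp [hi]

/-- Subtraction of `p` is addition of its complement with carry-in 1. The comparison `p ≤ u + m`
holds if the first sum overflows `N` bits, or if adding the complement to its low part overflows. In
this case the second sum is 2^N + (u + m - p), and the bits below `N` are those of the difference.
-/
theorem testBit_modAdd {N p u m i : ℕ} (hp : p < 2 ^ N) (hu : u < 2 ^ N) (hm : m < 2 ^ N)
    (hi : i < N) : (modAdd N p u m).testBit i =
      if carry u m false N || carry (u + m) (complBits N p) true N then
        (u + m + complBits N p + 1).testBit i else (u + m).testBit i := by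
  have hq : (carry u m false N || carry (u + m) (complBits N p) true N) = decide (p ≤ u + m) := by
    rw [Bool.eq_iff_iff]
    have h1 : complBits N p % 2 ^ N = 2 ^ N - (p + 1) :=
      Nat.mod_eq_of_lt (by rw [complBits]; omega)
    simp only [carry, h1, Nat.mod_eq_of_lt hu, Nat.mod_eq_of_lt hm, Bool.or_eq_true,
      decide_eq_true_eq, Bool.toNat_true, Bool.toNat_false]
    by_cases h : 2 ^ N ≤ u + m
    · simp [h]; omega
    · rw [Nat.mod_eq_of_lt (a := u + m) (by omega)]; omega
  rw [hq, modAdd, Nat.testBit_mod_two_pow]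
  by_cases h : p ≤ u + m
  · have : u + m + complBits N p + 1 = 2 ^ N + (u + m - p) := by rw [complBits]; omega
    simp [h, hi, this, Nat.testBit_two_pow_add_gt hi]
  · simp [h, hi]

/-- Multiplication modulo `p` by repeated doubling, after the `j` most significant bits of `y`. -/
def mulIter (N p y r : ℕ) : ℕ → ℕ
  | 0 => 0
  | j + 1 => modAdd N p (modAdd N p (mulIter N p y r j) (mulIter N p y r j))
      (if y.testBit (N - 1 - j) then r else 0)

theorem mulIter_lt (N p y r j : ℕ) : mulIter N p y r j < 2 ^ N := by
  cases j with
  | zero => simp [mulIter]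
  | succ j => exact modAdd_lt _ _ _ _

theorem div_two_pow_succ {N j : ℕ} (x : ℕ) (hj : j < N) : x / 2 ^ (N - (j + 1)) =
    2 * (x / 2 ^ (N - j)) + (x.testBit (N - 1 - j)).toNat := by
  have h1 : N - j = (N - 1 - j) + 1 := by omega
  have h2 : N - (j + 1) = N - 1 - j := by omega
  rw [h1, h2, pow_succ, ← Nat.div_div_eq_div_mul, Nat.testBit_eq_decide_div_mod_eq]
  rcases Nat.mod_two_eq_zero_or_one (x / 2 ^ (N - 1 - j)) with h | h <;> simp [h] <;> omega

/-- Horner's scheme over the bits of `y` from the top. Only `r` must be reduced modulo `p`; `y` may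
be any `N`-bit number. So the unreduced inputs `a` and `b` can be used as first factors, and
multiplying `b` by 1 reduces it. -/
theorem mulIter_eq {N p y r : ℕ} (hp : p ≤ 2 ^ N) (hr : r < p) (hy : y < 2 ^ N) :
    ∀ j ≤ N, mulIter N p y r j = (y / 2 ^ (N - j) * r) % p := by
  intro j
  induction j with
  | zero => intro _; simp [mulIter, Nat.div_eq_of_lt hy]
  | succ j ih =>
    intro hj
    have hp0 : 0 < p := by omega
    have h1 : (if y.testBit (N - 1 - j) then r else 0) = (y.testBit (N - 1 - j)).toNat * r := by
      cases y.testBit (N - 1 - j) <;> simp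
    have h2 : (y.testBit (N - 1 - j)).toNat * r < p := by
      rw [← h1]; split_ifs <;> omega
    have h3 := Nat.mod_lt (y / 2 ^ (N - j) * r) hp0
    rw [mulIter, ih (by omega), modAdd_eq hp h3 h3, h1, modAdd_eq hp (Nat.mod_lt _ hp0) h2,
      div_two_pow_succ y (by omega), ← Nat.add_mod, Nat.mod_add_mod]
    congr 1
    ring

/-- Multiplication modulo `p`. -/
def mulMod (N p y r : ℕ) : ℕ := mulIter N p y r N

theorem mulMod_lt (N p y r : ℕ) : mulMod N p y r < 2 ^ N := mulIter_lt _ _ _ _ _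

theorem mulMod_eq {N p y r : ℕ} (hp : p ≤ 2 ^ N) (hr : r < p) (hy : y < 2 ^ N) :
    mulMod N p y r = (y * r) % p := by
  simp [mulMod, mulIter_eq hp hr hy N le_rfl]

/-- Exponentiation modulo `p` by repeated squaring, after the `i` most significant bits of `x`. -/
def expIter (N p a x : ℕ) : ℕ → ℕ
  | 0 => 1 % 2 ^ N
  | i + 1 => if x.testBit (N - 1 - i) then
      mulMod N p a (mulMod N p (expIter N p a x i) (expIter N p a x i)) else
      mulMod N p (expIter N p a x i) (expIter N p a x i)

theorem expIter_lt (N p a x i : ℕ) : expIter N p a x i < 2 ^ N := by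
  cases i with
  | zero => exact Nat.mod_lt _ (by positivity)
  | succ i => rw [expIter]; split_ifs <;> exact mulMod_lt _ _ _ _

/-- Each new top bit of the exponent squares the result and perhaps multiplies it by `a`. The square
is already reduced and takes the place of the second factor, `a` that of the first. -/
theorem expIter_eq {N p a x : ℕ} (hp : p < 2 ^ N) (hp1 : 1 < p) (ha : a < 2 ^ N) (hx : x < 2 ^ N) :
    ∀ i ≤ N, expIter N p a x i = a ^ (x / 2 ^ (N - i)) % p := by
  intro i
  induction i with
  | zero =>
    intro _
    simp [expIter, Nat.div_eq_of_lt hx, Nat.mod_eq_of_lt hp1, Nat.mod_eq_of_lt (hp1.trans hp)]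
  | succ i ih =>
    intro hi
    have hp0 : 0 < p := by omega
    have h3 := Nat.mod_lt (a ^ (x / 2 ^ (N - i))) hp0
    rw [expIter, ih (by omega), mulMod_eq hp.le h3 (h3.trans hp), div_two_pow_succ x (by omega),
      mulMod_eq hp.le (Nat.mod_lt _ hp0) ha]
    cases x.testBit (N - 1 - i)
    · simp [← pow_add, two_mul]
    · simp [← pow_add, two_mul, pow_succ, mul_comm]

/-- If `p` does not divide `a`, Fermat's little theorem reduces the exponent modulo `p - 1`. If it
does, all positive powers are 0 modulo `p`, and the exponent 0 or 1 suffices. -/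
theorem exists_exponent_lt {N a b p : ℕ} (hp : p.Prime) (hpN : p < 2 ^ N)
    (h : ∃ y : ℕ, a ^ y ≡ b [MOD p]) : ∃ x < 2 ^ N, a ^ x ≡ b [MOD p] := by
  obtain ⟨y, hy⟩ := h
  have h1 := hp.one_lt
  by_cases hd : p ∣ a
  · rcases Nat.eq_zero_or_pos y with rfl | hy0
    · exact ⟨0, by positivity, hy⟩
    · refine ⟨1, by omega, ?_⟩
      have h2 : ∀ k, 0 < k → a ^ k ≡ 0 [MOD p] := fun k hk =>
        (Nat.modEq_zero_iff_dvd).mpr (dvd_pow hd hk.ne')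
      exact (h2 1 one_pos).trans ((h2 y hy0).symm.trans hy)
  · refine ⟨y % (p - 1), (Nat.mod_lt _ (by omega)).trans (by omega), ?_⟩
    have hc : a.Coprime p := ((Nat.Prime.coprime_iff_not_dvd hp).mpr hd).symm
    have h2 : a ^ (p - 1) ≡ 1 [MOD p] := by
      simpa [Nat.totient_prime hp] using Nat.ModEq.pow_totient hc
    refine Nat.ModEq.trans ?_ hy
    conv_rhs => rw [← Nat.mod_add_div y (p - 1), pow_add, pow_mul]
    simpa using ((h2.pow (y / (p - 1))).mul_left (a ^ (y % (p - 1)))).symm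

/-! ### Interval-values of Boolean functions -/

/-- The points of `[0, 1)` where a Boolean function is true. -/
def bset (φ : ℝ → Bool) : Set ℝ := {t | t ∈ Set.Ico (0 : ℝ) 1 ∧ φ t = true}

theorem bset_inter (φ ψ : ℝ → Bool) : bset φ ∩ bset ψ = bset fun t => φ t && ψ t := by
  ext t; simp [bset]; tauto

theorem bset_union (φ ψ : ℝ → Bool) : bset φ ∪ bset ψ = bset fun t => φ t || ψ t := by
  ext t; simp [bset]; tauto

theorem bset_compl (φ : ℝ → Bool) : Set.Ico 0 1 \ bset φ = bset fun t => !φ t := by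
  ext t; simp only [bset, Set.mem_sdiff, Set.mem_ofPred_eq, Bool.not_eq_true']
  cases φ t <;> simp

theorem bset_false : bset (fun _ => false) = ∅ := by ext t; simp [bset]

theorem bset_congr {φ ψ : ℝ → Bool} (h : ∀ t, 0 ≤ t → t < 1 → φ t = ψ t) : bset φ = bset ψ := by
  ext t
  simp only [bset, Set.mem_ofPred_eq, Set.mem_Ico]
  constructor <;> rintro ⟨⟨h0, h1⟩, h2⟩
  · exact ⟨⟨h0, h1⟩, h t h0 h1 ▸ h2⟩
  · exact ⟨⟨h0, h1⟩, (h t h0 h1).symm ▸ h2⟩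

/-- All products in the computation have a half of [0, 1) as first factor, so this is the only case
in which components have to be determined. -/
theorem isComponent_Ico {a b l u : ℝ} (hab : a < b) :
    IsComponent (Set.Ico a b) l u ↔ l = a ∧ u = b := by
  constructor
  · rintro ⟨hlu, hs, hm⟩
    obtain ⟨h1, h2⟩ := (Set.Ico_subset_Ico_iff hlu).mp hs
    obtain ⟨h3, h4⟩ := hm a b h1 h2 subset_rfl
    exact ⟨h3.symm, h4.symm⟩
  · rintro ⟨rfl, rfl⟩
    refine ⟨hab, subset_rfl, fun l' u' h1 h2 h => ?_⟩
    obtain ⟨h3, h4⟩ := (Set.Ico_subset_Ico_iff (by linarith)).mp h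
    exact ⟨le_antisymm h1 h3, le_antisymm h4 h2⟩

theorem product_Ico {a b : ℝ} (hab : a < b) (A : Set ℝ) :
    product (Set.Ico a b) A = {x | x ∈ Set.Ico a b ∧ (x - a) / (b - a) ∈ A} := by
  ext x
  simp only [product, isComponent_Ico hab, Set.mem_ofPred_eq]
  constructor
  · rintro ⟨l, u, ⟨rfl, rfl⟩, h⟩; exact h
  · exact fun h => ⟨a, b, ⟨rfl, rfl⟩, h⟩

/-- The points whose `j`-th binary digit after the first is `1`. -/
noncomputable def digitSet (j : ℕ) : Set ℝ := bset fun t => decide (⌊2 ^ (j + 1) * t⌋₊ % 2 = 1)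

theorem digitSet_zero : digitSet 0 = Set.Ico (1 / 2) 1 := by
  ext t
  simp only [digitSet, bset, Set.mem_ofPred_eq, Set.mem_Ico, decide_eq_true_eq, zero_add, pow_one]
  constructor
  · rintro ⟨⟨h0, h1⟩, h⟩
    refine ⟨?_, h1⟩
    by_contra hlt
    rw [Nat.floor_eq_zero.mpr (by linarith)] at h
    simp at h
  · rintro ⟨h0, h1⟩
    refine ⟨⟨by linarith, h1⟩, ?_⟩
    have : ⌊2 * t⌋₊ = 1 := by
      rw [Nat.floor_eq_iff (by linarith)]; constructor <;> push_cast <;> linarith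
    rw [this]

/-- Both halves carry a copy of the picture compressed by 2. The copies are given by t ↦ 2t and t ↦
2t - 1, which delete the first binary digit of t and move the others forward. -/
theorem digitSet_succ (j : ℕ) : product (Set.Ico 0 (1 / 2)) (digitSet j) ∪
    product (Set.Ico (1 / 2) 1) (digitSet j) = digitSet (j + 1) := by
  rw [product_Ico (by norm_num), product_Ico (by norm_num)]
  ext t
  simp only [digitSet, bset, Set.mem_union, Set.mem_ofPred_eq, Set.mem_Ico, decide_eq_true_eq]
  have e3 : (t - 0) / (1 / 2 - 0) = 2 * t := by ring
  have e4 : (t - 1 / 2) / (1 - 1 / 2) = 2 * t - 1 := by ring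
  have e1 : (2 : ℝ) ^ (j + 1) * (2 * t) = 2 ^ (j + 1 + 1) * t := by ring
  have e2 : (2 : ℝ) ^ (j + 1) * (2 * t - 1) = 2 ^ (j + 1 + 1) * t - (2 ^ (j + 1) : ℕ) := by
    push_cast; ring
  rw [e3, e4, e1, e2, Nat.floor_sub_natCast]
  constructor
  · rintro (⟨⟨h0, h1⟩, ⟨h2, h3⟩, h4⟩ | ⟨⟨h0, h1⟩, ⟨h2, h3⟩, h4⟩)
    · exact ⟨⟨h0, by linarith⟩, h4⟩
    · refine ⟨⟨by linarith, h1⟩, ?_⟩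
      -- The bound makes the truncated subtraction exact; the number subtracted is even, so the
      -- parity does not change.
      have hle : 2 ^ (j + 1) ≤ ⌊(2 : ℝ) ^ (j + 1 + 1) * t⌋₊ := by
        apply Nat.le_floor; push_cast; rw [pow_succ _ (j + 1)]; nlinarith [pow_pos (two_pos (α := ℝ)) (j + 1)]
      have : 2 ^ (j + 1) = 2 * 2 ^ j := by ring
      omega
  · rintro ⟨⟨h0, h1⟩, h⟩
    rcases lt_or_ge t (1 / 2) with ht | ht
    · exact Or.inl ⟨⟨h0, ht⟩, ⟨by linarith, by linarith⟩, h⟩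
    · refine Or.inr ⟨⟨ht, h1⟩, ⟨by linarith, by linarith⟩, ?_⟩
      have hle : 2 ^ (j + 1) ≤ ⌊(2 : ℝ) ^ (j + 1 + 1) * t⌋₊ := by
        apply Nat.le_floor; push_cast; rw [pow_succ _ (j + 1)]; nlinarith [pow_pos (two_pos (α := ℝ)) (j + 1)]
      have : 2 ^ (j + 1) = 2 * 2 ^ j := by ring
      omega

theorem product_half_Ico {c : ℝ} (hc : c ≤ 1) :
    product (Set.Ico 0 (1 / 2)) (Set.Ico 0 c) = Set.Ico 0 (c / 2) := by
  rw [product_Ico (by norm_num)]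
  ext t
  have e : (t - 0) / (1 / 2 - 0) = 2 * t := by ring
  simp only [Set.mem_ofPred_eq, Set.mem_Ico, e]
  constructor
  · rintro ⟨⟨h0, h1⟩, ⟨h2, h3⟩⟩; exact ⟨h0, by linarith⟩
  · rintro ⟨h0, h1⟩; exact ⟨⟨h0, by linarith⟩, by linarith, by linarith⟩

/-- The number of the dyadic cell of length `2 ^ -(N + 1)` that contains a point. -/
noncomputable def cellIndex (N : ℕ) (t : ℝ) : ℕ := ⌊2 ^ (N + 1) * t⌋₊

/-- Digit `j` of a point, counted from the top, is bit `N - j` of its cell number, since taking the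
floor commutes with division by a power of 2. -/
theorem digitSet_eq {N j : ℕ} (hj : j ≤ N) :
    digitSet j = bset fun t => (cellIndex N t).testBit (N - j) := by
  apply bset_congr
  intro t h0 h1
  rw [Nat.testBit_eq_decide_div_mod_eq, cellIndex]
  have : (2 : ℝ) ^ (j + 1) * t = 2 ^ (N + 1) * t / (2 ^ (N - j) : ℕ) := by
    have h2 : N + 1 = (j + 1) + (N - j) := by omega
    rw [h2, pow_add _ (j + 1)]; push_cast; field_simp
  rw [this, Nat.floor_div_natCast]

theorem cellIndex_dyadic (N k : ℕ) : cellIndex N (k / 2 ^ (N + 1)) = k := by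
  rw [cellIndex, mul_div_cancel₀ _ (by positivity), Nat.floor_natCast]

theorem cellIndex_add {N k : ℕ} {y : ℝ} (h0 : 0 ≤ y) (h : y < (1 / 2) ^ (N + 1)) :
    cellIndex N (y + k / 2 ^ (N + 1)) = k := by
  have hp : (0 : ℝ) < 2 ^ (N + 1) := by positivity
  rw [one_div, inv_pow] at h
  have h2 : 2 ^ (N + 1) * y < 1 := by
    calc 2 ^ (N + 1) * y < 2 ^ (N + 1) * (2 ^ (N + 1))⁻¹ := by gcongr
      _ = 1 := mul_inv_cancel₀ hp.ne'
  rw [cellIndex, mul_add, mul_div_cancel₀ _ hp.ne', Nat.floor_add_natCast (by positivity),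
    Nat.floor_eq_zero.mpr h2, zero_add]

/-- The cells before `k` are missing from the hit set, so its complement starts at 0 and runs to the
left end of cell `k`. Positivity of `k` is essential: otherwise the first component of the
complement would not start at 0. -/
theorem flength_compl {N k : ℕ} {φ : ℕ → Bool} (hk : k < 2 ^ (N + 1)) (h0 : 0 < k) (hφ : φ k = true)
    (hmin : ∀ l < k, φ l = false) :
    flength (bset fun t => !φ (cellIndex N t)) = k / 2 ^ (N + 1) := by
  have hp : (0 : ℝ) < 2 ^ (N + 1) := by positivity
  have hk1 : (k : ℝ) / 2 ^ (N + 1) < 1 := by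
    rw [div_lt_one hp]; exact_mod_cast hk
  have hk0 : (0 : ℝ) < k / 2 ^ (N + 1) := by positivity
  -- The component cannot be longer, because the left endpoint of cell `k` is itself a hit.
  refine (flength_eq (t := 0) ⟨le_rfl, hk0, hk1.le, by simp, ?_, ?_⟩).trans (sub_zero _)
  · rintro t ⟨ht0, ht⟩
    refine ⟨⟨ht0, ht.trans hk1⟩, ?_⟩
    dsimp only
    rw [hmin _ ?_, Bool.not_false]
    rw [cellIndex, Nat.floor_lt (by positivity), mul_comm]
    exact (lt_div_iff₀ hp).mp ht
  · intro s hs hsub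
    have := (hsub ⟨hk0.le, hs⟩).2
    dsimp only at this
    rw [cellIndex_dyadic, hφ] at this
    cases this

/-- Every point of the cell at 0 is translated into cell `k`, where `ψ` of the cell number is
constant; the point 0 is a witness for the converse. -/
theorem lshift_inter_nonempty {N k : ℕ} {B : Set ℝ} {ψ : ℕ → Bool} (hk : k < 2 ^ (N + 1))
    (hB : flength B = k / 2 ^ (N + 1)) :
    (lshift (bset fun t => ψ (cellIndex N t)) B ∩ Set.Ico 0 ((1 / 2) ^ (N + 1))).Nonempty ↔
      ψ k = true := by
  have hp : (0 : ℝ) < 2 ^ (N + 1) := by positivity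
  have hk1 : (k : ℝ) / 2 ^ (N + 1) < 1 := by
    rw [div_lt_one hp]; exact_mod_cast hk
  have hk0 : (0 : ℝ) ≤ k / 2 ^ (N + 1) := by positivity
  constructor
  · rintro ⟨y, ⟨-, -, -, hy⟩, hy0, hy1⟩
    dsimp only at hy
    rwa [hB, cellIndex_add hy0 hy1] at hy
  · intro h
    refine ⟨0, ⟨by simp, ?_, ?_⟩, by simp⟩
    · rw [hB, zero_add]; exact ⟨hk0, hk1⟩
    · rw [hB, zero_add]; exact ⟨⟨hk0, hk1⟩, by dsimp only; rwa [cellIndex_dyadic]⟩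

/-! ### Procedures of the register program -/

/-- `st'` comes after `st`, without output, and only the registers in `m` may have changed. -/
structure Frame (b : ℕ) (m : List Reg) (st st' : St) : Prop where
  good : Good b st'
  pre : st.prog <+: st'.prog
  env : ∀ r, r ∉ m → st'.env r = st.env r
  ans : answer st'.prog = answer st.prog
  ip : st'.ip = st.ip

theorem Frame.refl {b : ℕ} {m : List Reg} {st : St} (h : Good b st) : Frame b m st st :=
  ⟨h, List.prefix_rfl, fun _ _ => rfl, rfl, rfl⟩

theorem Frame.trans {b : ℕ} {m m' : List Reg} {s₁ s₂ s₃ : St} (h : Frame b m s₁ s₂)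
    (h' : Frame b m' s₂ s₃) (hm : m' ⊆ m) : Frame b m s₁ s₃ :=
  ⟨h'.good, h.pre.trans h'.pre, fun r hr => (h'.env r fun hh => hr (hm hh)).trans (h.env r hr),
    h'.ans.trans h.ans, h'.ip.trans h.ip⟩

theorem Frame.mono {b : ℕ} {m m' : List Reg} {s₁ s₂ : St} (h : Frame b m s₁ s₂) (hm : m ⊆ m') :
    Frame b m' s₁ s₂ := ⟨h.good, h.pre, fun r hr => h.env r fun hh => hr (hm hh), h.ans, h.ip⟩

theorem Frame.append {b : ℕ} {m m' : List Reg} {s₁ s₂ s₃ : St} (h : Frame b m s₁ s₂)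
    (h' : Frame b m' s₂ s₃) : Frame b (m ++ m') s₁ s₃ :=
  (h.mono (by simp)).trans h' (by simp)

theorem Frame.set {b : ℕ} {m : List Reg} {s₁ s₂ : St} (h : Frame b m s₁ s₂) {r : Reg} (hr : r ∈ m)
    (hc : r ≠ .cur) (ht : r ≠ .tmp) {v : ℕ} (hv : v < 2 ^ b) : Frame b m s₁ (s₂.set r v) :=
  ⟨h.good.set hc ht hv, h.pre, fun q hq => by
    have : q ≠ r := fun hh => hq (hh ▸ hr)
    simpa [this] using h.env q hq, h.ans, h.ip⟩

namespace Prog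

/-- The program leads from `st` to `st'`, in the sense of `Exec` and `Frame`. -/
structure Step (w : List Bool) (b : ℕ) (m : List Reg) (c : RProg) (st st' : St) : Prop where
  exec : Exec w b c st st'
  frame : Frame b m st st'

variable {w : List Bool} {b : ℕ} {st : St}

theorem Step.seq {m m' : List Reg} {c c' : RProg} {s₁ s₂ s₃ : St} (h : Step w b m c s₁ s₂)
    (h' : Step w b m' c' s₂ s₃) : Step w b (m ++ m') (.seq c c') s₁ s₃ :=
  ⟨h.exec.seq h'.exec, (h.frame.mono (by simp)).trans h'.frame (by simp)⟩

theorem Step.mono {m m' : List Reg} {c : RProg} {s₁ s₂ : St} (h : Step w b m c s₁ s₂)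
    (hm : m ⊆ m') : Step w b m' c s₁ s₂ := ⟨h.exec, h.frame.mono hm⟩

theorem step_add (h : Good b st) {r : Reg} (hc : r ≠ .cur) (ht : r ≠ .tmp) {k : ℕ}
    (hk : st.env r + k < 2 ^ b) :
    Step w b [r] (rep k (inc r)) st (st.set r (st.env r + k)) :=
  ⟨exec_rep_inc hk.le, (Frame.refl h).set (by simp) hc ht hk⟩

theorem step_sub (h : Good b st) {r : Reg} (hc : r ≠ .cur) (ht : r ≠ .tmp) {k : ℕ}
    (hk : k ≤ st.env r) :
    Step w b [r] (rep k (dec r)) st (st.set r (st.env r - k)) :=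
  ⟨exec_rep_dec (h.lt r) hk, (Frame.refl h).set (by simp) hc ht ((Nat.sub_le _ _).trans_lt (h.lt r))⟩

theorem step_copy (h : Good b st) {dst src : Reg} (hc : dst ≠ .cur) (ht : dst ≠ .tmp)
    (hs : src ≠ .tmp) (hds : dst ≠ src) :
    Step w b [dst] (copy dst src) st (st.set dst (st.env src)) :=
  ⟨exec_copy ht hs hds h.tmp h.lt, (Frame.refl h).set (by simp) hc ht (h.lt src)⟩

theorem step_block (h : Good b st) (gs : List Gate)
    (hno : ∀ ρ l, emitBlock ρ l gs = []) (hl : st.prog.length + gs.length + 1 < 2 ^ b)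
    (hw : BlockWf st.Ptr st.prog.length gs) :
    ∃ st', Step w b [.cur] (block gs) st st' ∧
      st'.prog.length = st.prog.length + gs.length ∧
      (values st'.prog).reverse = evalBlock st.val (values st.prog).reverse gs := by
  obtain ⟨st', e, h1, h2, h3, h4, h5, h6, h7⟩ := exec_block (w := w) gs h hl hw
  exact ⟨st', ⟨e, h1, h2, fun r hr => h5 r (by simpa using hr), by simpa [hno] using h7, h4⟩, h3, h6⟩

/-- The invariants in use do not mention the loop counter; `hset` expresses this, so that bodies
need not account for its decrement. -/
theorem step_forLoop (h : Good b st) {m : List Reg} {cnt num : Reg} {c : RProg} (hcm : cnt ∈ m)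
    (hcc : cnt ≠ .cur) (hct : cnt ≠ .tmp) (hn : num ≠ .tmp) (hcn : cnt ≠ num) {N : ℕ}
    (hN : st.env num = N) (P : ℕ → St → Prop) (h0 : P 0 st)
    (hset : ∀ i s v, P i s → P i (s.set cnt v))
    (hstep : ∀ i s, i < N → Frame b m st s → P i s →
      ∃ s', Step w b m c s s' ∧ s'.env cnt = s.env cnt ∧ P (i + 1) s') :
    ∃ s, Step w b m (forLoop cnt num c) st s ∧ P N s := by
  subst hN
  have hlt := h.lt num
  obtain ⟨s, e, f, p⟩ := exec_forLoop (w := w) (b := b) (st := st) (cnt := cnt) (num := num) (c := c)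
    hct hn hcn h.tmp h.lt (fun i s => Frame b m st s ∧ P i s)
    ⟨(Frame.refl h).set hcm hcc hct hlt, hset _ _ _ h0⟩
    (by
      rintro i s hi ⟨hf, hp⟩ hcnt
      obtain ⟨s', st', hc', hp'⟩ := hstep i s hi hf hp
      exact ⟨s', st'.exec, hc', (hf.trans st'.frame (fun _ h => h)).set hcm hcc hct (by omega),
        hset _ _ _ hp'⟩)
  exact ⟨s, ⟨e, f⟩, p⟩

end Prog

/-! ### Vectors of interval-values and the arithmetic circuits on them. -/

/-- `N`-bit numbers that depend on the point of `[0, 1)`: the values of their bits, least significant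
bit first, are found at the positions `p`, `p + 3`, `p + 6`, … -/
def Vec (S : List Instr) (p N : ℕ) (g : ℝ → ℕ) : Prop :=
  (∀ t, g t < 2 ^ N) ∧ ∀ i < N, Val S (p + 3 * i) (bset fun t => (g t).testBit i)

theorem Vec.mono {S T : List Instr} {p N : ℕ} {g : ℝ → ℕ} (h : Vec S p N g) (hST : S <+: T) :
    Vec T p N g := ⟨h.1, fun i hi => (h.2 i hi).mono hST⟩

theorem Frame.val {b : ℕ} {m : List Reg} {st st' : St} (h : Frame b m st st') {r : Reg}
    (hr : r ∉ m) {A : Set ℝ} (hv : Val st.prog (st.env r) A) : Val st'.prog (st'.env r) A := by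
  rw [h.env r hr]; exact hv.mono h.pre

theorem Frame.vec {b : ℕ} {m : List Reg} {st st' : St} (h : Frame b m st st') {r : Reg}
    (hr : r ∉ m) {N : ℕ} {g : ℝ → ℕ} (hv : Vec st.prog (st.env r) N g) :
    Vec st'.prog (st'.env r) N g := by
  rw [h.env r hr]; exact hv.mono h.pre

theorem Val.ptr {st : St} {r : Reg} (hr : r ≠ .cur) {A : Set ℝ} (h : Val st.prog (st.env r) A) :
    st.Ptr r := ⟨hr, h.1, h.2.1⟩

theorem Val.eq {st : St} {r : Reg} {A : Set ℝ} (h : Val st.prog (st.env r) A) : st.val r = A := h.2.2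

/-- The registers that are fixed in the main part of the computation. -/
structure Ambient (N p : ℕ) (st : St) : Prop where
  n : st.env .n = N
  vecP : Vec st.prog (st.env .baseP) N fun _ => p
  empty : Val st.prog (st.env .empty) (bset fun _ => false)
  full : Val st.prog (st.env .full) (bset fun _ => true)

theorem Frame.ambient {b : ℕ} {m : List Reg} {st st' : St} (h : Frame b m st st') {N p : ℕ}
    (ha : Ambient N p st) (hm : ∀ r ∈ [Reg.n, .baseP, .empty, .full], r ∉ m) : Ambient N p st' :=
  ⟨(h.env _ (hm _ (by simp))).trans ha.n, h.vec (hm _ (by simp)) ha.vecP,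
    h.val (hm _ (by simp)) ha.empty, h.val (hm _ (by simp)) ha.full⟩

namespace Prog

variable {w : List Bool} {b : ℕ} {st : St}

/-- Select the bits of one of two vectors of stride `k`. -/
def mux (k : ℕ) (sr dst : Reg) : RProg :=
  .seq (copy .nsel .cur) <| .seq (block [.not (.reg sr)]) <| .seq (copy dst .cur) <|
  .seq (rep 2 (inc dst)) <| forLoop .ctr .n <|
  .seq (block [.bin .and (.reg sr) (.reg .ptrT), .bin .and (.reg .nsel) (.reg .ptrS),
    .bin .or (.back 0) (.back 1)]) <|
  .seq (rep k (inc .ptrS)) (rep k (inc .ptrT))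

/-- Besides selecting, this brings the sources from stride `k` back to stride 3: every bit costs
three gates, and the last of them, a union, is the result. Hence `dst` starts at the third gate
after the negated selector. -/
theorem step_mux (h : Good b st) {k N : ℕ} (hk : k ≤ 20) {sr dst : Reg} (hN : st.env .n = N)
    (hsel : sr ∉ [.cur, .tmp, .nsel, .ctr, .ptrS, .ptrT, dst])
    (hdst : dst ∉ [.cur, .tmp, .nsel, .ctr, .ptrS, .ptrT, .n])
    {q : ℝ → Bool} {S T : ℕ → ℝ → Bool} (hq : Val st.prog (st.env sr) (bset q))
    (hS : ∀ i < N, Val st.prog (st.env .ptrS + k * i) (bset (S i)))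
    (hT : ∀ i < N, Val st.prog (st.env .ptrT + k * i) (bset (T i)))
    (hb : st.prog.length + 3 * N + 40 ≤ 2 ^ b) :
    ∃ st', Step w b [.cur, .nsel, .ctr, .ptrS, .ptrT, dst] (mux k sr dst) st st' ∧
      st'.prog.length = st.prog.length + 1 + 3 * N ∧
      ∀ i < N, Val st'.prog (st'.env dst + 3 * i) (bset fun t => if q t then T i t else S i t) := by
  simp only [List.mem_cons, List.not_mem_nil, or_false, not_or] at hsel hdst
  obtain ⟨hs1, hs2, hs3, hs4, hs5, hs6, hs7⟩ := hsel
  obtain ⟨hd1, hd2, hd3, hd4, hd5, hd6, hd7⟩ := hdst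
  have e1 := step_copy (w := w) h (dst := .nsel) (src := .cur) (by simp) (by simp) (by simp) (by simp)
  set s1 := st.set .nsel (st.env .cur) with hs1'
  have hq1 : Val s1.prog (s1.env sr) (bset q) := e1.frame.val (by simpa using hs3) hq
  obtain ⟨s2, e2, l2, v2⟩ := step_block (w := w) e1.frame.good [.not (.reg sr)] (fun _ _ => rfl)
    (by simp [s1]; omega) ⟨hq1.ptr hs1, trivial⟩
  simp only [List.length_singleton, evalBlock, Gate.eval, Ref.eval, hq1.eq, bset_compl] at l2 v2
  have hns : Val s2.prog (s2.env .nsel) (bset fun t => !q t) := by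
    have := Val.of_reverse (S := s2.prog) (j := 0) (by rw [v2]; rfl)
    rw [e2.frame.env _ (by simp)]
    simpa [s1, h.cur, l2] using this
  have e3 := step_copy (w := w) e2.frame.good (dst := dst) (src := .cur) hd1 hd2 (by simp) hd1
  set s3 := s2.set dst (s2.env .cur) with hs3'
  have hc2 : s2.env .cur = st.prog.length + 2 := by rw [e2.frame.good.cur, l2]; simp [s1]
  have e4 := step_add (w := w) e3.frame.good (r := dst) (k := 2) hd1 hd2 (by simp [s3, hc2]; omega)
  set s4 := s3.set dst (s3.env dst + 2) with hs4'
  have f4 := ((e1.seq (e2.seq (e3.seq e4)))).frame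
  have hd4' : s4.env dst = st.prog.length + 4 := by simp [s4, s3, hc2]
  have l4 : s4.prog.length = st.prog.length + 1 := by simp [s4, s3, l2, s1]
  have hq4 : Val s4.prog (s4.env sr) (bset q) := f4.val (by simp [hs1, hs3, hs7]) hq
  have hn4 : Val s4.prog (s4.env .nsel) (bset fun t => !q t) :=
    (e3.seq e4).frame.val (by simp [Ne.symm hd3]) hns
  have hps : s4.env .ptrS = st.env .ptrS := f4.env _ (by simp [Ne.symm hd5])
  have hpt : s4.env .ptrT = st.env .ptrT := f4.env _ (by simp [Ne.symm hd6])
  have hn : s4.env .n = N := (f4.env _ (by simp [Ne.symm hd7])).trans hN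
  obtain ⟨s5, e5, p5⟩ := step_forLoop (w := w) f4.good
    (m := [.cur, .ctr, .ptrS, .ptrT]) (cnt := .ctr) (num := .n)
    (c := .seq (block [.bin .and (.reg sr) (.reg .ptrT), .bin .and (.reg .nsel) (.reg .ptrS),
      .bin .or (.back 0) (.back 1)]) (.seq (rep k (inc .ptrS)) (rep k (inc .ptrT))))
    (by simp) (by simp) (by simp) (by simp) (by simp) hn
    (fun i s => s.prog.length = s4.prog.length + 3 * i ∧ s.env .ptrS = s4.env .ptrS + k * i ∧
      s.env .ptrT = s4.env .ptrT + k * i ∧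
      ∀ j < i, Val s.prog (s4.env dst + 3 * j) (bset fun t => if q t then T j t else S j t))
    (by simp) (by simp)
    (by
      rintro i s hi f ⟨i1, i2, i3, i4⟩
      have hqs := f.val (by simp [hs1, hs4, hs5, hs6]) hq4
      have hns := f.val (by simp) hn4
      have hpre := f4.pre.trans f.pre
      have hSi : Val s.prog (s.env .ptrS) (bset (S i)) := by
        rw [i2, hps]; exact (hS i hi).mono hpre
      have hTi : Val s.prog (s.env .ptrT) (bset (T i)) := by
        rw [i3, hpt]; exact (hT i hi).mono hpre
      obtain ⟨t1, g1, l1, v1⟩ := step_block (w := w) f.good [.bin .and (.reg sr) (.reg .ptrT),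
        .bin .and (.reg .nsel) (.reg .ptrS), .bin .or (.back 0) (.back 1)] (fun _ _ => rfl)
        (by simp; omega)
        ⟨⟨hqs.ptr hs1, hTi.ptr (by simp)⟩, ⟨hns.ptr (by simp), hSi.ptr (by simp)⟩,
          ⟨by simp [Ref.Wf], by simp [Ref.Wf]⟩, trivial⟩
      simp only [List.length_cons, List.length_nil, evalBlock, Gate.eval, Ref.eval, hqs.eq, hTi.eq,
        hns.eq, hSi.eq, BinOp.eval, bset_inter, List.getD_cons_zero, List.getD_cons_succ,
        bset_union] at l1 v1
      -- The pointer is still inside the sequence, so adding `k ≤ 20` stays below `2 ^ b` by the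
      -- slack in `hb`.
      have hS1 := hSi.2.1
      have hT1 := hTi.2.1
      have eS : t1.env .ptrS = s.env .ptrS := g1.frame.env _ (by simp)
      have eT : t1.env .ptrT = s.env .ptrT := g1.frame.env _ (by simp)
      have g2 := step_add (w := w) g1.frame.good (r := .ptrS) (k := k) (by simp) (by simp)
        (by rw [eS]; omega)
      have g3 := step_add (w := w) g2.frame.good (r := .ptrT) (k := k) (by simp) (by simp)
        (by simp [eT]; omega)
      refine ⟨_, (g1.seq (g2.seq g3)).mono (by simp), ?_, ?_, ?_, ?_, ?_⟩
      · simp [g1.frame.env]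
      · simp [l1, i1]; omega
      · simp [eS, i2]; ring
      · simp [eT, i3]; ring
      · intro j hj
        rcases Nat.lt_succ_iff_lt_or_eq.mp hj with hj | rfl
        · exact (i4 j hj).mono g1.frame.pre
        · have := Val.of_reverse (S := t1.prog) (j := 0) (by rw [v1]; rfl)
          simp only [St.set_prog]
          have hx : t1.prog.length - 0 = s4.env dst + 3 * j := by omega
          rw [hx] at this
          convert this using 3 with t
          cases q t <;> simp)
  refine ⟨s5, (e1.seq (e2.seq (e3.seq (e4.seq e5)))).mono (by simp), by rw [p5.1, l4], ?_⟩
  rw [e5.frame.env dst (by simp [hd1, hd4, hd5, hd6])]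
  exact p5.2.2.2

/-- One bit of `u + (v and c) + carry`, and of this sum plus the complement of `p`. -/
def adderGates (c : Reg) : List Gate :=
  [.bin .and (.reg .ptrV) (.reg c), .bin .and (.reg .ptrU) (.back 0),
   .bin .or (.reg .ptrU) (.back 1), .not (.back 1), .bin .and (.back 1) (.back 0),
   .bin .and (.back 0) (.back 6), .bin .or (.back 1) (.back 7), .not (.back 1),
   .bin .and (.back 1) (.back 0),
   .not (.reg .ptrP), .bin .and (.back 1) (.back 0),
   .bin .or (.back 2) (.back 1), .not (.back 1), .bin .and (.back 1) (.back 0),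
   .bin .and (.back 0) (.back 14), .bin .or (.back 1) (.back 15), .not (.back 1),
   .bin .and (.back 1) (.back 0),
   .bin .or (.back 16) (.back 12), .bin .or (.back 8) (.back 4)]

/-- Two full adders in a row, verified pointwise by their truth table. The two new carries come
last, in the places where the next block expects the old ones. -/
theorem evalBlock_adderGates {ρ : Reg → Set ℝ} {c : Reg} {u v p q c₁ c₂ : ℝ → Bool}
    {l : List (Set ℝ)} (hu : ρ .ptrU = bset u) (hv : ρ .ptrV = bset v) (hp : ρ .ptrP = bset p)
    (hc : ρ c = bset q) :
    ∃ l', evalBlock ρ (bset c₂ :: bset c₁ :: l) (adderGates c) =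
      bset (fun t => ((u t ^^ (v t && q t) ^^ c₁ t) && !p t) ||
        (((u t ^^ (v t && q t) ^^ c₁ t) ^^ !p t) && c₂ t)) ::
      bset (fun t => (u t && (v t && q t)) || ((u t ^^ (v t && q t)) && c₁ t)) ::
      bset (fun t => (u t ^^ (v t && q t) ^^ c₁ t) ^^ (!p t) ^^ c₂ t) :: l' ∧
      l'[8]? = some (bset fun t => u t ^^ (v t && q t) ^^ c₁ t) := by
  simp only [adderGates, evalBlock, Gate.eval, Ref.eval, BinOp.eval, hu, hv, hp, hc,
    List.getD_cons_zero, List.getD_cons_succ, bset_inter, bset_union, bset_compl]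
  refine ⟨_, congrArg₂ _ (bset_congr fun t _ _ => ?_) (congrArg₂ _ (bset_congr fun t _ _ => ?_)
    (congrArg₂ _ (bset_congr fun t _ _ => ?_) rfl)), congrArg some (bset_congr fun t _ _ => ?_)⟩
  all_goals
    generalize u t = u
    generalize v t = v
    generalize p t = p
    generalize q t = q
    generalize c₁ t = c₁
    generalize c₂ t = c₂
    revert u v p q c₁ c₂
    decide

/-- Addition modulo `p`, the second summand being masked. -/
def addMod (u v c : Reg) : RProg :=
  .seq (.seq (copy .ptrU u) <| .seq (copy .ptrV v) (copy .ptrP .baseP)) <|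
  .seq (block [.bin .or (.reg .empty) (.reg .empty), .bin .or (.reg .full) (.reg .full)]) <|
  .seq (.seq (copy .ptrS .cur) <| .seq (copy .ptrT .cur) <|
    .seq (rep 8 (inc .ptrS)) (rep 17 (inc .ptrT))) <|
  .seq (forLoop .ctr .n <| .seq (block (adderGates c)) <| .seq (rep 3 (inc .ptrU)) <|
    .seq (rep 3 (inc .ptrV)) (rep 3 (inc .ptrP))) <|
  .seq (copy .sel .cur) <| .seq (block [.bin .or (.back 0) (.back 1)]) (mux 20 .sel .acc)

/-- Both candidates, the sum and the sum minus `p`, are computed in one pass with interleaved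
carries. The union of the two final carries says whether `p` has to be subtracted and drives the
selection, as in `testBit_modAdd`. -/
theorem step_addMod (h : Good b st) {N p : ℕ} (ha : Ambient N p st) {u v c : Reg}
    (hu : u ∈ [Reg.acc, .fac]) (hv : v ∈ [Reg.acc, .fac]) (hc : c ∈ [Reg.full, .mulBit])
    {gu gv : ℝ → ℕ} {q : ℝ → Bool} (hgu : Vec st.prog (st.env u) N gu)
    (hgv : Vec st.prog (st.env v) N gv) (hq : Val st.prog (st.env c) (bset q))
    (hb : st.prog.length + 23 * N + 60 ≤ 2 ^ b) :
    ∃ st', Step w b [.cur, .nsel, .ctr, .ptrU, .ptrV, .ptrP, .ptrS, .ptrT, .sel, .acc]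
        (addMod u v c) st st' ∧ st'.prog.length = st.prog.length + (4 + 23 * N) ∧
      Vec st'.prog (st'.env .acc) N fun t => modAdd N p (gu t) (if q t then gv t else 0) := by
  have hu1 : u ≠ .ptrU ∧ u ≠ .tmp := by
    simp only [List.mem_cons, List.not_mem_nil, or_false] at hu
    rcases hu with rfl | rfl <;> simp
  have hv1 : v ≠ .ptrU ∧ v ≠ .tmp ∧ v ≠ .ptrV := by
    simp only [List.mem_cons, List.not_mem_nil, or_false] at hv
    rcases hv with rfl | rfl <;> simp
  have hc1 : c ∉ [Reg.cur, .tmp, .nsel, .ctr, .ptrU, .ptrV, .ptrP, .ptrS, .ptrT, .sel, .acc] := by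
    simp only [List.mem_cons, List.not_mem_nil, or_false] at hc
    rcases hc with rfl | rfl <;> simp
  have e1 := step_copy (w := w) h (dst := .ptrU) (src := u) (by simp) (by simp) hu1.2 hu1.1.symm
  have e2 := step_copy (w := w) e1.frame.good (dst := .ptrV) (src := v) (by simp) (by simp) hv1.2.1
    hv1.2.2.symm
  have e3 := step_copy (w := w) e2.frame.good (dst := .ptrP) (src := .baseP) (by simp) (by simp)
    (by simp) (by simp)
  obtain ⟨s3, e3, u3, v3, p3, l3⟩ : ∃ s3, Step w b _ _ st s3 ∧ s3.env .ptrU = st.env u ∧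
      s3.env .ptrV = st.env v ∧ s3.env .ptrP = st.env .baseP ∧ s3.prog = st.prog :=
    ⟨_, e1.seq (e2.seq e3), by simp, by simp [hv1.1], by simp, rfl⟩
  have a3 := e3.frame.ambient ha (by simp)
  -- These two gates place the initial carries, 0 for the sum and 1 for the subtraction, directly
  -- before the first adder block.
  obtain ⟨s4, e4, l4, v4⟩ := step_block (w := w) e3.frame.good
    [.bin .or (.reg .empty) (.reg .empty), .bin .or (.reg .full) (.reg .full)] (fun _ _ => rfl)
    (by simp [l3]; omega) ⟨⟨a3.empty.ptr (by simp), a3.empty.ptr (by simp)⟩,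
      ⟨a3.full.ptr (by simp), a3.full.ptr (by simp)⟩, trivial⟩
  simp only [List.length_cons, List.length_nil, evalBlock, Gate.eval, Ref.eval, a3.empty.eq,
    a3.full.eq, BinOp.eval, Set.union_self, l3] at l4 v4
  have c4 := e4.frame.good.cur
  have e5 := step_copy (w := w) e4.frame.good (dst := .ptrS) (src := .cur) (by simp) (by simp)
    (by simp) (by simp)
  have e6 := step_copy (w := w) e5.frame.good (dst := .ptrT) (src := .cur) (by simp) (by simp)
    (by simp) (by simp)
  -- In a block of 20 gates the sum bit is the gate with offset 8, and the bit of the difference is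
  -- the one with offset 17.
  have e7 := step_add (w := w) e6.frame.good (r := .ptrS) (k := 8) (by simp) (by simp)
    (by simp [c4, l4]; omega)
  have e8 := step_add (w := w) e7.frame.good (r := .ptrT) (k := 17) (by simp) (by simp)
    (by simp [c4, l4]; omega)
  obtain ⟨s8, e8, pS8, pT8, l8⟩ : ∃ s8, Step w b _ _ s4 s8 ∧ s8.env .ptrS = st.prog.length + 11 ∧
      s8.env .ptrT = st.prog.length + 20 ∧ s8.prog = s4.prog :=
    ⟨_, e5.seq (e6.seq (e7.seq e8)), by simp [c4, l4], by simp [c4, l4], rfl⟩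
  rw [← l8] at l4 v4
  have f8 := (e3.seq (e4.seq e8)).frame
  have u8 : s8.env .ptrU = st.env u := ((e4.seq e8).frame.env _ (by simp)).trans u3
  have v8 : s8.env .ptrV = st.env v := ((e4.seq e8).frame.env _ (by simp)).trans v3
  have p8 : s8.env .ptrP = st.env .baseP := ((e4.seq e8).frame.env _ (by simp)).trans p3
  have a8 := f8.ambient ha (by simp)
  have hq8 : Val s8.prog (s8.env c) (bset q) := f8.val (fun hh => hc1 (by revert hh; simp; tauto)) hq
  set m : ℝ → ℕ := fun t => if q t then gv t else 0 with hm
  have hmlt : ∀ t, m t < 2 ^ N := fun t => by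
    by_cases hqt : q t = true
    · simpa [hm, hqt] using hgv.1 t
    · simp [hm, hqt]
  have hmbit : ∀ t i, (m t).testBit i = ((gv t).testBit i && q t) := fun t i => by
    cases hqt : q t <;> simp [hm, hqt]
  set r := complBits N p with hr
  obtain ⟨s9, e9, i1, -, -, -, ⟨l', i5⟩, i6⟩ := step_forLoop (w := w) f8.good
    (m := [.cur, .ctr, .ptrU, .ptrV, .ptrP]) (cnt := .ctr) (num := .n)
    (c := .seq (block (adderGates c)) <| .seq (rep 3 (inc .ptrU)) <|
      .seq (rep 3 (inc .ptrV)) (rep 3 (inc .ptrP)))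
    (by simp) (by simp) (by simp) (by simp) (by simp) a8.n
    (fun i s => s.prog.length = st.prog.length + 2 + 20 * i ∧ s.env .ptrU = st.env u + 3 * i ∧
      s.env .ptrV = st.env v + 3 * i ∧ s.env .ptrP = st.env .baseP + 3 * i ∧
      (∃ l, (values s.prog).reverse = bset (fun t => carry (gu t + m t) r true i) ::
        bset (fun t => carry (gu t) (m t) false i) :: l) ∧
      ∀ j < i, Val s.prog (st.prog.length + 11 + 20 * j) (bset fun t => (gu t + m t).testBit j) ∧
        Val s.prog (st.prog.length + 20 + 20 * j) (bset fun t => (gu t + m t + r + 1).testBit j))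
    (by simp [u8, v8, p8, v4, l4, carry_zero])
    (by simp)
    (by
      rintro i s hi f ⟨i1, i2, i3, i4, ⟨l, i5⟩, i6⟩
      have hpre := f8.pre.trans f.pre
      have as := f.ambient a8 (by simp)
      have hqs := f.val (fun hh => hc1 (by revert hh; simp; tauto)) hq8
      have hus : Val s.prog (s.env .ptrU) (bset fun t => (gu t).testBit i) := by rw [i2]; exact (hgu.2 i hi).mono hpre
      have hvs : Val s.prog (s.env .ptrV) (bset fun t => (gv t).testBit i) := by rw [i3]; exact (hgv.2 i hi).mono hpre
      have hps : Val s.prog (s.env .ptrP) (bset fun _ => p.testBit i) := by rw [i4]; exact (ha.vecP.2 i hi).mono hpre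
      have hcc : c ≠ .cur := fun hh => hc1 (by simp [hh])
      obtain ⟨t1, g1, k1, w1⟩ := step_block (w := w) f.good (adderGates c) (fun _ _ => rfl)
        (by simp [adderGates]; omega)
        (by
          simp only [adderGates, BlockWf, Gate.Wf, Ref.Wf, hus.ptr (by simp), hvs.ptr (by simp),
            hps.ptr (by simp), hqs.ptr hcc, i1]
          refine ⟨?_, ?_, ?_, ?_, ?_, ?_, ?_, ?_, ?_, ?_, ?_, ?_, ?_, ?_, ?_, ?_, ?_, ?_, ?_, ?_, ?_⟩ <;>
            first | trivial | omega | (constructor <;> first | trivial | omega))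
      rw [i5] at w1
      obtain ⟨l', w2, w3⟩ := evalBlock_adderGates (l := l)
        (c₁ := fun t => carry (gu t) (m t) false i)
        (c₂ := fun t => carry (gu t + m t) r true i) hus.eq hvs.eq hps.eq hqs.eq
      rw [w2] at w1
      have k1' : t1.prog.length = s.prog.length + 20 := k1
      have hU1 := hus.2.1
      have hV1 := hvs.2.1
      have hP1 := hps.2.1
      have eU : t1.env .ptrU = s.env .ptrU := g1.frame.env _ (by simp)
      have eV : t1.env .ptrV = s.env .ptrV := g1.frame.env _ (by simp)
      have eP : t1.env .ptrP = s.env .ptrP := g1.frame.env _ (by simp)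
      have g2 := step_add (w := w) g1.frame.good (r := .ptrU) (k := 3) (by simp) (by simp)
        (by rw [eU]; omega)
      have g3 := step_add (w := w) g2.frame.good (r := .ptrV) (k := 3) (by simp) (by simp)
        (by simp [eV]; omega)
      have g4 := step_add (w := w) g3.frame.good (r := .ptrP) (k := 3) (by simp) (by simp)
        (by simp [eP]; omega)
      have hS : ∀ t, (gu t + m t).testBit i =
          ((gu t).testBit i ^^ ((gv t).testBit i && q t) ^^ carry (gu t) (m t) false i) := fun t => by
        rw [← hmbit, ← testBit_add_carry]; rfl
      have hrb : r.testBit i = !p.testBit i := testBit_complBits (ha.vecP.1 0) hi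
      refine ⟨_, (g1.seq (g2.seq (g3.seq g4))).mono (by simp), ?_, ?_, ?_, ?_, ?_, ⟨bset (fun t => (gu t).testBit i ^^
        ((gv t).testBit i && q t) ^^ carry (gu t) (m t) false i ^^ (!p.testBit i) ^^
          carry (gu t + m t) r true i) :: l', ?_⟩, ?_⟩
      · simp [g1.frame.env]
      · simp [k1', i1]; omega
      · simp [eU, i2]; ring
      · simp [eV, i3]; ring
      · simp [eP, i4]; ring
      · simp only [St.set_prog, w1, carry_succ, hS, hrb, hmbit, Bool.xor_assoc]
      · intro j hj
        rcases Nat.lt_succ_iff_lt_or_eq.mp hj with hj | rfl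
        · exact ⟨(i6 j hj).1.mono g1.frame.pre, (i6 j hj).2.mono g1.frame.pre⟩
        -- Seen from the end of the block, the offsets 8 and 17 are the entries 11 and 2.
        · have x1 := Val.of_reverse (S := t1.prog) (j := 11) (by rw [w1]; exact w3)
          have x2 := Val.of_reverse (S := t1.prog) (j := 2) (by rw [w1]; rfl)
          have y1 : t1.prog.length - 11 = st.prog.length + 11 + 20 * j := by omega
          have y2 : t1.prog.length - 2 = st.prog.length + 20 + 20 * j := by omega
          have hT : ∀ t, (gu t + m t + r + 1).testBit j =
              ((gu t + m t).testBit j ^^ r.testBit j ^^ carry (gu t + m t) r true j) := fun t =>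
            testBit_add_carry (gu t + m t) r true j
          rw [y1] at x1
          rw [y2] at x2
          simp only [St.set_prog, hT, hS, hrb]
          exact ⟨x1, by simpa only [Bool.xor_assoc] using x2⟩)
  have e10 := step_copy (w := w) e9.frame.good (dst := .sel) (src := .cur) (by simp) (by simp)
    (by simp) (by simp)
  obtain ⟨s11, e11, l11, v11⟩ := step_block (w := w) e10.frame.good [.bin .or (.back 0) (.back 1)]
    (fun _ _ => rfl) (by simp [i1]; omega)
    ⟨⟨by simp [Ref.Wf, i1], by simp [Ref.Wf, i1]; omega⟩, trivial⟩
  simp only [List.length_singleton, evalBlock, Gate.eval, Ref.eval, BinOp.eval, St.set_prog, i5,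
    List.getD_cons_zero, List.getD_cons_succ, bset_union] at l11 v11
  have f11 := (e9.seq (e10.seq e11)).frame
  have a11 := f11.ambient a8 (by simp)
  have hsel : Val s11.prog (s11.env .sel) (bset fun t =>
      carry (gu t) (m t) false N || carry (gu t + m t) r true N) := by
    have := Val.of_reverse (S := s11.prog) (j := 0) (by rw [v11]; rfl)
    rw [e11.frame.env _ (by simp)]
    simp only [Bool.or_comm (carry (gu _) _ _ _)]
    simpa [e9.frame.good.cur, l11] using this
  have hpS : s11.env .ptrS = st.prog.length + 11 := (f11.env _ (by simp)).trans pS8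
  have hpT : s11.env .ptrT = st.prog.length + 20 := (f11.env _ (by simp)).trans pT8
  have hpre := (e10.seq e11).frame.pre
  obtain ⟨s12, e12, l12, v12⟩ := step_mux (w := w) f11.good (k := 20) le_rfl (sr := .sel)
    (dst := .acc) a11.n (by simp) (by simp) hsel
    (S := fun i t => (gu t + m t).testBit i) (T := fun i t => (gu t + m t + r + 1).testBit i)
    (fun i hi => by rw [hpS]; exact (i6 i hi).1.mono hpre)
    (fun i hi => by rw [hpT]; exact (i6 i hi).2.mono hpre) (by rw [l11, i1]; omega)
  refine ⟨s12, (e3.seq (e4.seq (e8.seq (e9.seq (e10.seq (e11.seq e12)))))).mono ?_, ?_, ?_, ?_⟩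
  · simp
  · rw [l12, l11, i1]; omega
  · exact fun t => modAdd_lt _ _ _ _
  · intro i hi
    refine (congrArg (Val _ _) (congrArg bset (funext fun t => ?_))).mpr (v12 i hi)
    exact testBit_modAdd (ha.vecP.1 0) (hgu.1 t) (hmlt t) hi

/-- Add three times the length of the vectors to a register. -/
def addLength (r : Reg) : RProg := forLoop .ctr .n (rep 3 (inc r))

theorem step_addLength (h : Good b st) {N : ℕ} (hN : st.env .n = N) {r : Reg}
    (hr : r ∉ [Reg.cur, .tmp, .ctr, .n]) (hb : st.env r + 3 * N < 2 ^ b) :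
    ∃ st', Step w b [.ctr, r] (addLength r) st st' ∧ st'.prog = st.prog ∧
      st'.env r = st.env r + 3 * N := by
  simp only [List.mem_cons, List.not_mem_nil, or_false, not_or] at hr
  obtain ⟨h1, h2, h3, h4⟩ := hr
  exact step_forLoop h (m := [.ctr, r]) (cnt := .ctr) (num := .n) (by simp) (by simp) (by simp)
    (by simp) (by simp) hN (fun i s => s.prog = st.prog ∧ s.env r = st.env r + 3 * i) (by simp)
    (by simp [h3])
    (by
      rintro i s hi f ⟨i1, i2⟩
      refine ⟨_, (step_add f.good h1 h2 (by omega)).mono (by simp), ?_, by simpa using i1, ?_⟩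
      · simp [Ne.symm h3]
      · simp [i2]; ring)

/-- Multiplication modulo `p`. -/
def mul (y f : Reg) : RProg :=
  .seq (copy .mulBit y) <| .seq (addLength .mulBit) <|
  .seq (.seq (copy .fac f) (copy .acc .zero)) <| forLoop .mulCtr .n <|
  .seq (rep 3 (dec .mulBit)) <| .seq (addMod .acc .acc .full) (addMod .acc .fac .mulBit)

theorem Vec.end_lt {S : List Instr} {r N b : ℕ} {g : ℝ → ℕ} (h : Vec S r N g) (hr : r < 2 ^ b)
    (hb : S.length + 3 < 2 ^ b) : r + 3 * N < 2 ^ b := by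
  rcases N with _ | N
  · simpa using hr
  · have := (h.2 N (Nat.lt_succ_self N)).2.1
    omega

/-- Each of the `N` rounds consists of two modular additions: a doubling, masked by the constant 1,
and the addition of the second factor, masked by the current bit of the first. The mask is an
interval-value, so both outcomes of the bit occur at different points. -/
theorem step_mul (h : Good b st) {N p : ℕ} (ha : Ambient N p st)
    (hz : Vec st.prog (st.env .zero) N fun _ => 0) {y f : Reg}
    (hy : y ∈ [Reg.res, .baseA, .baseB]) (hf : f ∈ [Reg.res, .sq, .one])
    {gy gf : ℝ → ℕ} (hgy : Vec st.prog (st.env y) N gy) (hgf : Vec st.prog (st.env f) N gf)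
    (hb : st.prog.length + N * (8 + 46 * N) + 60 ≤ 2 ^ b) :
    ∃ st', Step w b [.cur, .nsel, .ctr, .ptrU, .ptrV, .ptrP, .ptrS, .ptrT, .sel, .acc, .mulCtr,
        .mulBit, .fac] (mul y f) st st' ∧
      st'.prog.length = st.prog.length + N * (8 + 46 * N) ∧
      Vec st'.prog (st'.env .acc) N fun t => mulMod N p (gy t) (gf t) := by
  simp only [List.mem_cons, List.not_mem_nil, or_false] at hy hf
  have hy1 : y ≠ .tmp ∧ y ≠ .mulBit := by rcases hy with rfl | rfl | rfl <;> simp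
  have hf1 : f ≠ .tmp ∧ f ≠ .fac ∧ f ≠ .mulBit ∧ f ≠ .ctr := by
    rcases hf with rfl | rfl | rfl <;> simp
  have e1 := step_copy (w := w) h (dst := .mulBit) (src := y) (by simp) (by simp) hy1.1 hy1.2.symm
  -- The bit pointer starts one stride behind the top bit; each round first moves it back, so the
  -- bits are used from the top.
  obtain ⟨s2, e2, l2, b2⟩ := step_addLength (w := w) e1.frame.good (r := .mulBit)
    (by simpa using ha.n) (by simp)
    (by simpa using Vec.end_lt hgy (h.lt y) (by omega))
  simp only [St.set_prog, St.set_env, Function.update_self] at l2 b2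
  have e3 := step_copy (w := w) e2.frame.good (dst := .fac) (src := f) (by simp) (by simp) hf1.1
    hf1.2.1.symm
  have e4 := step_copy (w := w) e3.frame.good (dst := .acc) (src := .zero) (by simp) (by simp)
    (by simp) (by simp)
  have fs2 := (e1.seq e2).frame
  obtain ⟨s4, e4, l4, b4, f4, z4⟩ : ∃ s4, Step w b _ _ s2 s4 ∧ s4.prog = st.prog ∧
      s4.env .mulBit = st.env y + 3 * N ∧ s4.env .fac = st.env f ∧ s4.env .acc = st.env .zero :=
    ⟨_, e3.seq e4, l2, by simp [b2],
      by simpa using fs2.env f (by simp [hf1]), by simpa using fs2.env .zero (by simp)⟩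
  have fs4 := (e1.seq (e2.seq e4)).frame
  have a4 := fs4.ambient ha (by simp)
  obtain ⟨s5, e5, l5, -, v5⟩ := step_forLoop (w := w) fs4.good
    (m := [.cur, .nsel, .ctr, .ptrU, .ptrV, .ptrP, .ptrS, .ptrT, .sel, .acc, .mulCtr, .mulBit])
    (cnt := .mulCtr) (num := .n)
    (c := .seq (rep 3 (dec .mulBit)) <| .seq (addMod .acc .acc .full) (addMod .acc .fac .mulBit))
    (by simp) (by simp) (by simp) (by simp) (by simp) a4.n
    (fun i s => s.prog.length = st.prog.length + i * (8 + 46 * N) ∧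
      s.env .mulBit = st.env y + 3 * (N - i) ∧
      Vec s.prog (s.env .acc) N fun t => mulIter N p (gy t) (gf t) i)
    (by rw [l4, b4, z4]; simpa [mulIter] using hz)
    (by simp)
    (by
      rintro i s hi f ⟨i1, i2, i3⟩
      have hbi : i * (8 + 46 * N) + (8 + 46 * N) ≤ N * (8 + 46 * N) := by
        rw [← Nat.succ_mul]; exact Nat.mul_le_mul_right _ hi
      have g1 := step_sub (w := w) f.good (r := .mulBit) (k := 3) (by simp) (by simp) (by omega)
      have hb1 : s.env .mulBit - 3 = st.env y + 3 * (N - 1 - i) := by omega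
      have fs1 := f.trans (g1.frame.mono (m' := [.cur, .nsel, .ctr, .ptrU, .ptrV, .ptrP, .ptrS, .ptrT,
        .sel, .acc, .mulCtr, .mulBit]) (by simp)) (fun _ h => h)
      have as1 := fs1.ambient a4 (by simp)
      have hbit : Val s.prog (st.env y + 3 * (N - 1 - i)) (bset fun t => (gy t).testBit (N - 1 - i)) :=
        (hgy.2 _ (by omega)).mono (fs4.pre.trans f.pre)
      obtain ⟨s2, g2, k2, v2⟩ := step_addMod (w := w) g1.frame.good as1 (u := .acc) (v := .acc)
        (c := .full) (by simp) (by simp) (by simp) (gu := fun t => mulIter N p (gy t) (gf t) i)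
        (gv := fun t => mulIter N p (gy t) (gf t) i) (by simpa using i3) (by simpa using i3)
        as1.full (by simp [i1]; omega)
      have hbit2 : Val s2.prog (s2.env .mulBit) (bset fun t => (gy t).testBit (N - 1 - i)) := by
        rw [g2.frame.env _ (by simp)]
        simpa [hb1] using hbit.mono g2.frame.pre
      have hfac : Vec s2.prog (s2.env .fac) N gf := by
        rw [(fs1.trans (g2.frame.mono (m' := [.cur, .nsel, .ctr, .ptrU, .ptrV, .ptrP, .ptrS, .ptrT,
          .sel, .acc, .mulCtr, .mulBit]) (by simp)) (fun _ h => h)).env _ (by simp), f4]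
        exact hgf.mono (fs4.pre.trans (fs1.pre.trans g2.frame.pre))
      simp only [St.set_prog] at k2
      obtain ⟨s3, g3, k3, v3⟩ := step_addMod (w := w) g2.frame.good
        (g2.frame.ambient as1 (by simp)) (u := .acc) (v := .fac)
        (c := .mulBit) (by simp) (by simp) (by simp) v2 hfac hbit2 (by omega)
      refine ⟨s3, (g1.seq (g2.seq g3)).mono (by simp), ?_, ?_, ?_, ?_⟩
      · rw [g3.frame.env _ (by simp), g2.frame.env _ (by simp)]; simp
      · rw [k3, k2, i1, Nat.succ_mul i]; omega
      · rw [g3.frame.env _ (by simp), g2.frame.env _ (by simp)]; simp [hb1]; omega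
      · simpa [mulIter] using v3)
  have e14 := e1.seq (e2.seq (e4.seq e5))
  exact ⟨s5, e14.mono (by simp), l5, v5⟩

/-- Exponentiation modulo `p`. -/
def exp : RProg :=
  .seq (copy .res .one) <| .seq (copy .expBit .baseX) <| forLoop .expCtr .n <|
  .seq (mul .res .res) <| .seq (copy .sq .acc) <| .seq (mul .baseA .sq) <|
  .seq (.seq (copy .ptrS .sq) (copy .ptrT .acc)) <| .seq (mux 3 .expBit .res) (rep 3 (inc .expBit))

/-- The exponent differs from point to point, so the square and its product with `a` are both
computed in every round, and the exponent bit selects one of them at each point. Two multiplications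
per bit give the cubic size. -/
theorem step_exp (h : Good b st) {N p a : ℕ} (ha : Ambient N p st)
    (hz : Vec st.prog (st.env .zero) N fun _ => 0)
    (ho : Vec st.prog (st.env .one) N fun _ => 1 % 2 ^ N)
    (hA : Vec st.prog (st.env .baseA) N fun _ => a) {x : ℝ → ℕ}
    (hX : ∀ i < N, Val st.prog (st.env .baseX + 3 * i) (bset fun t => (x t).testBit (N - 1 - i)))
    (hb : st.prog.length + N * (2 * (N * (8 + 46 * N)) + 1 + 3 * N) + 100 ≤ 2 ^ b) :
    ∃ st', Step w b [.cur, .nsel, .ctr, .ptrU, .ptrV, .ptrP, .ptrS, .ptrT, .sel, .acc, .mulCtr,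
        .mulBit, .fac, .res, .sq, .expBit, .expCtr] exp st st' ∧
      st'.prog.length = st.prog.length + N * (2 * (N * (8 + 46 * N)) + 1 + 3 * N) ∧
      Vec st'.prog (st'.env .res) N fun t => expIter N p a (x t) N := by
  have e1 := step_copy (w := w) h (dst := .res) (src := .one) (by simp) (by simp) (by simp) (by simp)
  have e2 := step_copy (w := w) e1.frame.good (dst := .expBit) (src := .baseX) (by simp) (by simp)
    (by simp) (by simp)
  have f2 := (e1.seq e2).frame
  have a2 := f2.ambient ha (by simp)
  obtain ⟨s5, e5, l5, -, v5⟩ := step_forLoop (w := w) f2.good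
    (m := [.cur, .nsel, .ctr, .ptrU, .ptrV, .ptrP, .ptrS, .ptrT, .sel, .acc, .mulCtr,
        .mulBit, .fac, .res, .sq, .expBit, .expCtr])
    (cnt := .expCtr) (num := .n)
    (c := .seq (mul .res .res) <| .seq (copy .sq .acc) <| .seq (mul .baseA .sq) <|
      .seq (.seq (copy .ptrS .sq) (copy .ptrT .acc)) <|
      .seq (mux 3 .expBit .res) (rep 3 (inc .expBit)))
    (by simp) (by simp) (by simp) (by simp) (by simp) a2.n
    (fun i s => s.prog.length = st.prog.length + i * (2 * (N * (8 + 46 * N)) + 1 + 3 * N) ∧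
      s.env .expBit = st.env .baseX + 3 * i ∧
      Vec s.prog (s.env .res) N fun t => expIter N p a (x t) i)
    (by simpa [expIter] using ho)
    (by simp)
    (by
      rintro i s hi f ⟨i1, i2, i3⟩
      have hbi : i * (2 * (N * (8 + 46 * N)) + 1 + 3 * N) + (2 * (N * (8 + 46 * N)) + 1 + 3 * N) ≤
          N * (2 * (N * (8 + 46 * N)) + 1 + 3 * N) := by
        rw [← Nat.succ_mul]; exact Nat.mul_le_mul_right _ hi
      have F := f2.append f
      have as := f.ambient a2 (by simp)
      obtain ⟨s1, g1, k1, v1⟩ := step_mul (w := w) f.good as (F.vec (by simp) hz) (y := .res)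
        (f := .res) (by simp) (by simp) i3 i3 (by omega)
      have g2 := step_copy (w := w) g1.frame.good (dst := .sq) (src := .acc) (by simp) (by simp)
        (by simp) (by simp)
      have F2 := F.append (g1.seq g2).frame
      have v2 : Vec (s1.set .sq (s1.env .acc)).prog ((s1.set .sq (s1.env .acc)).env .sq) N
          fun t => mulMod N p (expIter N p a (x t) i) (expIter N p a (x t) i) := by simpa using v1
      obtain ⟨s3, g3, k3, v3⟩ := step_mul (w := w) g2.frame.good
        ((g1.seq g2).frame.ambient as (by simp)) (F2.vec (by simp) hz) (y := .baseA)
        (f := .sq) (by simp) (by simp) (F2.vec (by simp) hA) v2 (by simp [k1]; omega)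
      have g4 := step_copy (w := w) g3.frame.good (dst := .ptrS) (src := .sq) (by simp) (by simp)
        (by simp) (by simp)
      have g5 := step_copy (w := w) g4.frame.good (dst := .ptrT) (src := .acc) (by simp) (by simp)
        (by simp) (by simp)
      have v3' := g3.frame.vec (r := .sq) (by simp) v2
      obtain ⟨s5, g5, k5, pS5, pT5⟩ : ∃ s5, Step w b _ _ s3 s5 ∧ s5.prog = s3.prog ∧
          s5.env .ptrS = s3.env .sq ∧ s5.env .ptrT = s3.env .acc :=
        ⟨_, g4.seq g5, rfl, by simp, by simp⟩
      have F5 := (g1.seq (g2.seq (g3.seq g5))).frame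
      have hx5 : s5.env .expBit = st.env .baseX + 3 * i := (F5.env _ (by simp)).trans i2
      have hsel : Val s5.prog (s5.env .expBit) (bset fun t => (x t).testBit (N - 1 - i)) := by
        rw [hx5]; exact (hX i hi).mono (F.pre.trans F5.pre)
      have l5 : s5.prog.length = s.prog.length + 2 * (N * (8 + 46 * N)) := by
        rw [k5, k3, St.set_prog, k1]; omega
      obtain ⟨s6, g6, k6, v6⟩ := step_mux (w := w) g5.frame.good (k := 3) (by simp) (sr := .expBit)
        (dst := .res) (F5.ambient as (by simp)).n (by simp) (by simp) hsel
        (fun i hi => by rw [pS5, k5]; exact v3'.2 i hi)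
        (fun i hi => by rw [pT5, k5]; exact v3.2 i hi) (by omega)
      have hx6 : s6.env .expBit = st.env .baseX + 3 * i := (g6.frame.env _ (by simp)).trans hx5
      have hx6' := (hX i hi).2.1
      have hpl := f2.pre.length_le
      have g7 := step_add (w := w) g6.frame.good (r := .expBit) (k := 3) (by simp) (by simp)
        (by simp only [St.set_prog] at hpl; omega)
      have F7 := F5.append (g6.seq g7).frame
      refine ⟨_, (g1.seq (g2.seq (g3.seq (g5.seq (g6.seq g7))))).mono (by decide +kernel),
        F7.env _ (by decide +kernel), ?_, ?_, ?_, ?_⟩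
      · rw [St.set_prog, k6, l5, i1, Nat.succ_mul i]; omega
      · simp [hx6]; ring
      · exact fun t => expIter_lt _ _ _ _ _
      · intro j hj
        have := v6 j hj
        simp only [St.set_prog, St.set_env, ne_eq, reduceCtorEq, not_false_eq_true,
          Function.update_of_ne]
        refine (congrArg (Val _ _) (congrArg bset (funext fun t => ?_))).mpr this
        rw [expIter]
        split_ifs <;> rfl)
  exact ⟨s5, (e1.seq (e2.seq e5)).mono (by simp), l5, v5⟩

/-- Compare two numbers, bit by bit. -/
def compare (u v : Reg) : RProg :=
  .seq (block [.bin .or (.reg .full) (.reg .full)]) <|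
  .seq (.seq (copy .ptrS u) (copy .ptrT v)) <| forLoop .ctr .n <|
  .seq (block [.bin .and (.reg .ptrS) (.reg .ptrT), .bin .or (.reg .ptrS) (.reg .ptrT),
    .not (.back 0), .bin .or (.back 0) (.back 2), .bin .and (.back 0) (.back 4)]) <|
  .seq (rep 3 (inc .ptrS)) (rep 3 (inc .ptrT))

/-- A running conjunction, started with the constant 1, is multiplied by the equivalence of the two
current bits. -/
theorem step_compare (h : Good b st) {N p : ℕ} (ha : Ambient N p st) {gu gv : ℝ → ℕ}
    (hu : Vec st.prog (st.env .res) N gu) (hv : Vec st.prog (st.env .acc) N gv)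
    (hb : st.prog.length + 5 * N + 20 ≤ 2 ^ b) :
    ∃ st' l, Step w b [.cur, .ctr, .ptrS, .ptrT] (compare .res .acc) st st' ∧
      st'.prog.length = st.prog.length + 1 + 5 * N ∧
      (values st'.prog).reverse = bset (fun t => decide (gu t = gv t)) :: l := by
  obtain ⟨s1, e1, l1, v1⟩ := step_block (w := w) h [.bin .or (.reg .full) (.reg .full)]
    (fun _ _ => rfl) (by simp; omega) ⟨⟨ha.full.ptr (by simp), ha.full.ptr (by simp)⟩, trivial⟩
  simp only [List.length_singleton, evalBlock, Gate.eval, Ref.eval, ha.full.eq, BinOp.eval,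
    Set.union_self] at l1 v1
  have e2 := step_copy (w := w) e1.frame.good (dst := .ptrS) (src := .res) (by simp) (by simp)
    (by simp) (by simp)
  have e3 := step_copy (w := w) e2.frame.good (dst := .ptrT) (src := .acc) (by simp) (by simp)
    (by simp) (by simp)
  obtain ⟨s3, e3, k3, pS3, pT3⟩ : ∃ s3, Step w b _ _ s1 s3 ∧ s3.prog = s1.prog ∧
      s3.env .ptrS = st.env .res ∧ s3.env .ptrT = st.env .acc :=
    ⟨_, e2.seq e3, rfl, by simp [e1.frame.env], by simp [e1.frame.env]⟩
  have F := (e1.seq e3).frame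
  obtain ⟨s4, e4, l4, -, -, l, v4⟩ := step_forLoop (w := w) F.good
    (m := [.cur, .ctr, .ptrS, .ptrT]) (cnt := .ctr) (num := .n)
    (c := .seq (block [.bin .and (.reg .ptrS) (.reg .ptrT), .bin .or (.reg .ptrS) (.reg .ptrT),
      .not (.back 0), .bin .or (.back 0) (.back 2), .bin .and (.back 0) (.back 4)]) <|
      .seq (rep 3 (inc .ptrS)) (rep 3 (inc .ptrT)))
    (by simp) (by simp) (by simp) (by simp) (by simp) (F.ambient ha (by simp)).n
    (fun i s => s.prog.length = st.prog.length + 1 + 5 * i ∧ s.env .ptrS = st.env .res + 3 * i ∧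
      s.env .ptrT = st.env .acc + 3 * i ∧ ∃ l, (values s.prog).reverse =
        bset (fun t => decide (∀ j < i, (gu t).testBit j = (gv t).testBit j)) :: l)
    (by simp [k3, l1, pS3, pT3, v1]) (by simp)
    (by
      rintro i s hi f ⟨i1, i2, i3, l, i4⟩
      have hpre := F.pre.trans f.pre
      have hus : Val s.prog (s.env .ptrS) (bset fun t => (gu t).testBit i) := by
        rw [i2]; exact (hu.2 i hi).mono hpre
      have hvs : Val s.prog (s.env .ptrT) (bset fun t => (gv t).testBit i) := by
        rw [i3]; exact (hv.2 i hi).mono hpre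
      obtain ⟨t1, g1, k1, v1⟩ := step_block (w := w) f.good
        [.bin .and (.reg .ptrS) (.reg .ptrT), .bin .or (.reg .ptrS) (.reg .ptrT),
          .not (.back 0), .bin .or (.back 0) (.back 2), .bin .and (.back 0) (.back 4)]
        (fun _ _ => rfl) (by simp; omega)
        (by
          simp only [BlockWf, Gate.Wf, Ref.Wf, hus.ptr (by simp), hvs.ptr (by simp), i1]
          refine ⟨?_, ?_, ?_, ?_, ?_, ?_⟩ <;>
            first | trivial | omega)
      simp only [List.length_cons, List.length_nil, i4, evalBlock, Gate.eval, Ref.eval, BinOp.eval,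
        hus.eq, hvs.eq, List.getD_cons_zero, List.getD_cons_succ, bset_inter, bset_union,
        bset_compl] at k1 v1
      have hU1 := hus.2.1
      have hV1 := hvs.2.1
      have eS : t1.env .ptrS = s.env .ptrS := g1.frame.env _ (by simp)
      have eT : t1.env .ptrT = s.env .ptrT := g1.frame.env _ (by simp)
      have g2 := step_add (w := w) g1.frame.good (r := .ptrS) (k := 3) (by simp) (by simp)
        (by rw [eS]; omega)
      have g3 := step_add (w := w) g2.frame.good (r := .ptrT) (k := 3) (by simp) (by simp)
        (by simp [eT]; omega)
      refine ⟨_, (g1.seq (g2.seq g3)).mono (by simp), ?_, ?_, ?_, ?_, _, v1.trans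
        (congrArg₂ _ (bset_congr fun t _ _ => ?_) rfl)⟩
      · simp [g1.frame.env]
      · simp [k1, i1]; omega
      · simp [eS, i2]; ring
      · simp [eT, i3]; ring
      · rw [Bool.eq_iff_iff]
        simp only [Bool.and_eq_true, Bool.or_eq_true, Bool.not_eq_true', decide_eq_true_eq,
          Nat.lt_succ_iff_lt_or_eq, or_imp, forall_and, forall_eq]
        cases (gu t).testBit i <;> cases (gv t).testBit i <;> simp)
  refine ⟨s4, l, (e1.seq (e3.seq e4)).mono (by simp), l4, v4.trans (congrArg₂ _
    (bset_congr fun t _ _ => ?_) rfl)⟩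
  congr 1
  rw [eq_iff_iff]
  refine ⟨fun hh => Nat.eq_of_testBit_eq fun j => ?_, fun hh => by simp [hh]⟩
  rcases lt_or_ge j N with hj | hj
  · exact hh j hj
  -- Both numbers are below 2^N, so the bits from `N` on vanish and the first `N` bits decide
  -- equality.
  · rw [Nat.testBit_lt_two_pow ((hu.1 t).trans_le (Nat.pow_le_pow_right (by simp) hj)),
      Nat.testBit_lt_two_pow ((hv.1 t).trans_le (Nat.pow_le_pow_right (by simp) hj))]

/-! ### The leftmost cell, the binary digits, and the constants 1 and 0. -/

/-- Write the intervals `[0, 2 ^ -(N + 1))`, ending with the shortest. -/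
def makeCell : RProg :=
  .seq (block [.bin .or (.reg .fst) (.reg .fst)]) <|
  .seq (forLoop .ctr .n <| block [.bin .product (.reg .fst) (.back 0)]) <|
  .seq (copy .cell .cur) (rep 1 (dec .cell))

theorem step_makeCell (h : Good b st) {N : ℕ} (hN : st.env .n = N)
    (hF : Val st.prog (st.env .fst) (Set.Ico 0 (1 / 2))) (hb : st.prog.length + N + 20 ≤ 2 ^ b) :
    ∃ st', Step w b [.cur, .ctr, .cell] makeCell st st' ∧
      st'.prog.length = st.prog.length + 1 + N ∧
      Val st'.prog (st'.env .cell) (Set.Ico 0 ((1 / 2) ^ (N + 1))) := by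
  obtain ⟨s1, e1, l1, v1⟩ := step_block (w := w) h [.bin .or (.reg .fst) (.reg .fst)]
    (fun _ _ => rfl) (by simp; omega) ⟨⟨hF.ptr (by simp), hF.ptr (by simp)⟩, trivial⟩
  simp only [List.length_singleton, evalBlock, Gate.eval, Ref.eval, hF.eq, BinOp.eval,
    Set.union_self] at l1 v1
  obtain ⟨s2, e2, l2, l, v2⟩ := step_forLoop (w := w) e1.frame.good
    (m := [.cur, .ctr]) (cnt := .ctr) (num := .n)
    (c := block [.bin .product (.reg .fst) (.back 0)])
    (by simp) (by simp) (by simp) (by simp) (by simp) ((e1.frame.env _ (by simp)).trans hN)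
    (fun i s => s.prog.length = st.prog.length + 1 + i ∧ ∃ l, (values s.prog).reverse =
        Set.Ico 0 ((1 / 2) ^ (i + 1)) :: l)
    (by simp [l1, v1]) (by simp)
    (by
      rintro i s hi f ⟨i1, l, i2⟩
      have hFs := f.val (by simp) (e1.frame.val (by simp) hF)
      obtain ⟨t1, g1, k1, v1⟩ := step_block (w := w) f.good [.bin .product (.reg .fst) (.back 0)]
        (fun _ _ => rfl) (by simp; omega)
        ⟨⟨hFs.ptr (by simp), by simp [Ref.Wf, i1]⟩, trivial⟩
      simp only [List.length_singleton, i2, evalBlock, Gate.eval, Ref.eval, BinOp.eval,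
        hFs.eq, List.getD_cons_zero] at k1 v1
      have hle : ((1 : ℝ) / 2) ^ (i + 1) ≤ 1 := pow_le_one₀ (by norm_num) (by norm_num)
      refine ⟨t1, g1.mono (by simp), g1.frame.env _ (by simp), by omega, _, v1.trans
        (congrArg₂ _ ?_ rfl)⟩
      rw [product_half_Ico hle, pow_succ _ (i + 1)]
      congr 1
      ring)
  have e3 := step_copy (w := w) e2.frame.good (dst := .cell) (src := .cur) (by simp) (by simp)
    (by simp) (by simp)
  have e4 := step_sub (w := w) e3.frame.good (r := .cell) (k := 1) (by simp) (by simp)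
    (by simp [e2.frame.good.cur])
  refine ⟨_, (e1.seq (e2.seq (e3.seq e4))).mono (by simp), l2, ?_⟩
  have := Val.of_reverse (S := s2.prog) (j := 0) (by rw [v2]; rfl)
  simpa [e2.frame.good.cur] using this

/-- Write the sets of the binary digits of a point. -/
def makeDigits : RProg :=
  .seq (.seq (copy .baseX .cur) (rep 3 (inc .baseX))) <|
  .seq (block [.bin .or (.reg .snd) (.reg .snd)]) <| forLoop .ctr .n <|
  block [.bin .product (.reg .fst) (.back 0), .bin .product (.reg .snd) (.back 1),
    .bin .or (.back 1) (.back 0)]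

theorem step_makeDigits (h : Good b st) {N : ℕ} (hN : st.env .n = N)
    (hF : Val st.prog (st.env .fst) (Set.Ico 0 (1 / 2)))
    (hS : Val st.prog (st.env .snd) (Set.Ico (1 / 2) 1)) (hb : st.prog.length + 3 * N + 20 ≤ 2 ^ b) :
    ∃ st', Step w b [.cur, .ctr, .baseX] makeDigits st st' ∧
      st'.prog.length = st.prog.length + 1 + 3 * N ∧
      ∀ i < N, Val st'.prog (st'.env .baseX + 3 * i) (digitSet (i + 1)) := by
  have e1 := step_copy (w := w) h (dst := .baseX) (src := .cur) (by simp) (by simp) (by simp) (by simp)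
  -- Digit 0 is the flag and not part of the exponent, so the pointer skips it and starts with digit
  -- 1.
  have e2 := step_add (w := w) e1.frame.good (r := .baseX) (k := 3) (by simp) (by simp)
    (by simp [h.cur]; omega)
  obtain ⟨s2, e2, k2, x2⟩ : ∃ s2, Step w b _ _ st s2 ∧ s2.prog = st.prog ∧
      s2.env .baseX = st.prog.length + 4 := ⟨_, e1.seq e2, rfl, by simp [h.cur]⟩
  have hS2 := e2.frame.val (by simp) hS
  have hF2 := e2.frame.val (by simp) hF
  obtain ⟨s3, e3, l3, v3⟩ := step_block (w := w) e2.frame.good [.bin .or (.reg .snd) (.reg .snd)]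
    (fun _ _ => rfl) (by simp [k2]; omega) ⟨⟨hS2.ptr (by simp), hS2.ptr (by simp)⟩, trivial⟩
  simp only [List.length_singleton, evalBlock, Gate.eval, Ref.eval, hS2.eq, BinOp.eval,
    Set.union_self, k2] at l3 v3
  obtain ⟨s4, e4, l4, -, v4⟩ := step_forLoop (w := w) e3.frame.good
    (m := [.cur, .ctr]) (cnt := .ctr) (num := .n)
    (c := block [.bin .product (.reg .fst) (.back 0), .bin .product (.reg .snd) (.back 1),
      .bin .or (.back 1) (.back 0)])
    (by simp) (by simp) (by simp) (by simp) (by simp)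
    (((e2.seq e3).frame.env _ (by simp)).trans hN)
    (fun i s => s.prog.length = st.prog.length + 1 + 3 * i ∧
      (∃ l, (values s.prog).reverse = digitSet i :: l) ∧
      ∀ j < i, Val s.prog (st.prog.length + 4 + 3 * j) (digitSet (j + 1)))
    (by simp [l3, v3, digitSet_zero]) (by simp)
    (by
      rintro i s hi f ⟨i1, ⟨l, i2⟩, i3⟩
      have hFs := f.val (by simp) (e3.frame.val (by simp) hF2)
      have hSs := f.val (by simp) (e3.frame.val (by simp) hS2)
      obtain ⟨t1, g1, k1, v1⟩ := step_block (w := w) f.good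
        [.bin .product (.reg .fst) (.back 0), .bin .product (.reg .snd) (.back 1),
          .bin .or (.back 1) (.back 0)]
        (fun _ _ => rfl) (by simp; omega)
        (by
          simp only [BlockWf, Gate.Wf, Ref.Wf, hFs.ptr (by simp), hSs.ptr (by simp), i1, true_and, and_true]
          omega)
      simp only [List.length_cons, List.length_nil, i2, evalBlock, Gate.eval, Ref.eval, BinOp.eval,
        hFs.eq, hSs.eq, List.getD_cons_zero, List.getD_cons_succ, digitSet_succ] at k1 v1
      refine ⟨t1, g1.mono (by simp), g1.frame.env _ (by simp), by omega, ⟨_, v1⟩, fun j hj => ?_⟩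
      rcases Nat.lt_succ_iff_lt_or_eq.mp hj with hj | rfl
      · exact (i3 j hj).mono g1.frame.pre
      · have := Val.of_reverse (S := t1.prog) (j := 0) (by rw [v1]; rfl)
        have hx : t1.prog.length - 0 = st.prog.length + 4 + 3 * j := by omega
        rwa [hx] at this)
  refine ⟨s4, (e2.seq (e3.seq e4)).mono (by simp), l4, ?_⟩
  rw [(e3.seq e4).frame.env _ (by simp), x2]
  exact v4

/-- Write the numbers `1` and `0`. -/
def makeOne : RProg :=
  .seq (.seq (copy .one .cur) (.seq (copy .zero .cur) (rep 3 (inc .zero)))) <|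
  .seq (block [.bin .or (.reg .full) (.reg .full)]) <| forLoop .ctr .n <|
  block [.bin .or (.reg .empty) (.reg .empty), .bin .or (.reg .empty) (.reg .empty),
    .bin .or (.reg .empty) (.reg .empty)]

theorem step_makeOne (h : Good b st) {N : ℕ} (hN : st.env .n = N)
    (hE : Val st.prog (st.env .empty) (bset fun _ => false))
    (hU : Val st.prog (st.env .full) (bset fun _ => true)) (hb : st.prog.length + 3 * N + 20 ≤ 2 ^ b) :
    ∃ st', Step w b [.cur, .ctr, .one, .zero] makeOne st st' ∧
      st'.prog.length = st.prog.length + 1 + 3 * N ∧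
      Vec st'.prog (st'.env .one) N (fun _ => 1 % 2 ^ N) ∧
      Vec st'.prog (st'.env .zero) N fun _ => 0 := by
  have e0 := step_copy (w := w) h (dst := .one) (src := .cur) (by simp) (by simp) (by simp) (by simp)
  have e1 := step_copy (w := w) e0.frame.good (dst := .zero) (src := .cur) (by simp) (by simp)
    (by simp) (by simp)
  -- The two constants share their instructions: the bits of 1 above the lowest are bits of 0.
  have e2 := step_add (w := w) e1.frame.good (r := .zero) (k := 3) (by simp) (by simp)
    (by simp [h.cur]; omega)
  obtain ⟨s2, e2, k2, x2, y2⟩ : ∃ s2, Step w b _ _ st s2 ∧ s2.prog = st.prog ∧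
      s2.env .one = st.prog.length + 1 ∧ s2.env .zero = st.prog.length + 4 :=
    ⟨_, e0.seq (e1.seq e2), rfl, by simp [h.cur], by simp [h.cur]⟩
  have hU2 := e2.frame.val (by simp) hU
  have hE2 := e2.frame.val (by simp) hE
  obtain ⟨s3, e3, l3, v3⟩ := step_block (w := w) e2.frame.good [.bin .or (.reg .full) (.reg .full)]
    (fun _ _ => rfl) (by simp [k2]; omega) ⟨⟨hU2.ptr (by simp), hU2.ptr (by simp)⟩, trivial⟩
  simp only [List.length_singleton, evalBlock, Gate.eval, Ref.eval, hU2.eq, BinOp.eval,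
    Set.union_self, k2] at l3 v3
  obtain ⟨s4, e4, l4, v4, z4⟩ := step_forLoop (w := w) e3.frame.good
    (m := [.cur, .ctr]) (cnt := .ctr) (num := .n)
    (c := block [.bin .or (.reg .empty) (.reg .empty), .bin .or (.reg .empty) (.reg .empty),
    .bin .or (.reg .empty) (.reg .empty)])
    (by simp) (by simp) (by simp) (by simp) (by simp)
    (((e2.seq e3).frame.env _ (by simp)).trans hN)
    (fun i s => s.prog.length = st.prog.length + 1 + 3 * i ∧
      Val s.prog (st.prog.length + 1) (bset fun _ => true) ∧
      ∀ j < i, Val s.prog (st.prog.length + 4 + 3 * j) (bset fun _ => false))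
    (by
      have := Val.of_reverse (S := s3.prog) (j := 0) (by rw [v3]; rfl)
      simpa [l3] using this) (by simp)
    (by
      rintro i s hi f ⟨i1, i2, i3⟩
      have hEs := f.val (by simp) (e3.frame.val (by simp) hE2)
      obtain ⟨t1, g1, k1, v1⟩ := step_block (w := w) f.good
        [.bin .or (.reg .empty) (.reg .empty), .bin .or (.reg .empty) (.reg .empty),
          .bin .or (.reg .empty) (.reg .empty)]
        (fun _ _ => rfl) (by simp; omega)
        (by
          simp only [BlockWf, Gate.Wf, Ref.Wf, hEs.ptr (by simp)]
          trivial)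
      simp only [List.length_cons, List.length_nil, evalBlock, Gate.eval, Ref.eval, BinOp.eval,
        hEs.eq, Set.union_self] at k1 v1
      refine ⟨t1, g1.mono (by simp), g1.frame.env _ (by simp), by omega, i2.mono g1.frame.pre,
        fun j hj => ?_⟩
      rcases Nat.lt_succ_iff_lt_or_eq.mp hj with hj | rfl
      · exact (i3 j hj).mono g1.frame.pre
      · have := Val.of_reverse (S := t1.prog) (j := 0) (by rw [v1]; rfl)
        have hx : t1.prog.length - 0 = st.prog.length + 4 + 3 * j := by omega
        rwa [hx] at this)
  refine ⟨s4, (e2.seq (e3.seq e4)).mono (by simp), l4, ⟨fun _ => Nat.mod_lt _ (by positivity), ?_⟩,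
    fun _ => by positivity, ?_⟩
  · rw [(e3.seq e4).frame.env _ (by simp), x2]
    intro i hi
    rcases i with _ | i
    · simpa [Nat.testBit_mod_two_pow, hi] using v4
    · have := z4 i (by omega)
      have hx : st.prog.length + 1 + 3 * (i + 1) = st.prog.length + 4 + 3 * i := by ring
      have hbit : (1 % 2 ^ N).testBit (i + 1) = false := by
        rw [Nat.testBit_mod_two_pow]; simp [Nat.testBit_succ]
      simpa only [hx, hbit] using this
  · rw [(e3.seq e4).frame.env _ (by simp), y2]
    intro i hi
    simpa using z4 i hi

/-! ### Output of the bits of the least hit. -/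

/-- Write the output instructions. -/
def outputs : RProg :=
  .seq (copy .expBit .baseX) <| forLoop .ctr .n <|
  .seq (block [.bin .lshift (.reg .expBit) (.reg .gap), .bin .and (.back 0) (.reg .cell),
    .out (.back 0)]) (rep 3 (inc .expBit))

-- Output instructions change the answer, which `Frame` forbids, so the loop rule `exec_forLoop` is
-- applied with the needed facts in an explicit invariant.
open Classical in
theorem exec_outputs (h : Good b st) {N : ℕ} (hN : st.env .n = N) {G E : Set ℝ} {X : ℕ → Set ℝ}
    (hX : ∀ i < N, Val st.prog (st.env .baseX + 3 * i) (X i))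
    (hG : Val st.prog (st.env .gap) G) (hE : Val st.prog (st.env .cell) E)
    (hb : st.prog.length + 3 * N + 20 ≤ 2 ^ b) :
    ∃ st', Exec w b outputs st st' ∧ Good b st' ∧ st'.prog.length = st.prog.length + 3 * N ∧
      answer st'.prog = answer st.prog ++
        (List.range N).map fun i => decide (lshift (X i) G ∩ E).Nonempty := by
  have e1 := step_copy (w := w) h (dst := .expBit) (src := .baseX) (by simp) (by simp) (by simp)
    (by simp)
  obtain ⟨s1, e1, k1, x1⟩ : ∃ s1, Step w b _ _ st s1 ∧ s1.prog = st.prog ∧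
      s1.env .expBit = st.env .baseX := ⟨_, e1, rfl, by simp⟩
  have hn1 : s1.env .n = N := (e1.frame.env _ (by simp)).trans hN
  have hG1 := e1.frame.val (by simp) hG
  have hE1 := e1.frame.val (by simp) hE
  subst hn1
  obtain ⟨s2, e2, g2, l2, -, -, -, -, a2⟩ := exec_forLoop (w := w) (b := b) (st := s1) (cnt := .ctr)
    (num := .n) (c := .seq (block [.bin .lshift (.reg .expBit) (.reg .gap),
      .bin .and (.back 0) (.reg .cell), .out (.back 0)]) (rep 3 (inc .expBit)))
    (by simp) (by simp) (by simp) e1.frame.good.tmp e1.frame.good.lt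
    (fun i s => Good b s ∧ s.prog.length = st.prog.length + 3 * i ∧
      s.env .expBit = st.env .baseX + 3 * i ∧ st.prog <+: s.prog ∧
      Val s.prog (s.env .gap) G ∧ Val s.prog (s.env .cell) E ∧
      answer s.prog = answer st.prog ++
        (List.range i).map fun i => decide (lshift (X i) G ∩ E).Nonempty)
    ⟨e1.frame.good.set (by simp) (by simp) (e1.frame.good.lt _), by simp [k1], by simp [x1],
      by simp [k1], by simpa using hG1, by simpa using hE1, by simp [k1]⟩
    (by
      rintro i s hi ⟨i1, i2, i3, i4, i5, i6, i7⟩ hc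
      have hx : Val s.prog (s.env .expBit) (X i) := by rw [i3]; exact (hX i hi).mono i4
      obtain ⟨t, g1, g2, g3, g4, g5, g6, g7, g8⟩ := exec_block (w := w)
        [.bin .lshift (.reg .expBit) (.reg .gap), .bin .and (.back 0) (.reg .cell), .out (.back 0)]
        i1 (by simp; omega)
        (by
          simp only [BlockWf, Gate.Wf, Ref.Wf, hx.ptr (by simp), i5.ptr (by simp),
            i6.ptr (by simp)]
          refine ⟨?_, ?_, ?_, ?_⟩ <;> first | trivial | omega | exact ⟨by omega, trivial⟩)
      simp only [emitBlock, Gate.emit, Gate.eval, Ref.eval, BinOp.eval, hx.eq, i5.eq, i6.eq,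
        List.getD_cons_zero, List.nil_append, List.append_nil] at g8
      have hx1 := hx.2.1
      have et := g6 .expBit (by simp)
      refine ⟨t.set .expBit (t.env .expBit + 3), g1.seq (exec_rep_inc (by omega)), ?_, ?_, ?_, ?_, ?_,
        ?_, ?_, ?_⟩
      · simp [g6]
      · exact (g2.set (by simp) (by simp) (by omega)).set (by simp) (by simp)
          (by have := i1.lt .ctr; omega)
      · simp only [St.set_prog, g4, i2, List.length_cons, List.length_nil]; ring
      · simp [et, i3]; ring
      · exact i4.trans g3
      · simpa [g6] using i5.mono g3
      · simpa [g6] using i6.mono g3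
      · simp only [St.set_prog, g8, i7, List.range_succ, List.map_append, List.map_singleton,
          List.append_assoc])
  exact ⟨s2, e1.exec.seq e2, g2, by omega, a2⟩

/-! ### Initialisation and reading of the input. -/

/-- Put the mark on all tapes. -/
def initTapes : RProg := .act fun _ _ => (.stay, fun _ => (some none, .right), none)

/-- The state in the beginning. -/
def initSt : St where
  env := fun _ => 0
  ip := 0
  prog := []

theorem run_initTapes : Run w (b + 3) initTapes (initData none) initSt.data := by
  refine (congrArg (Run w (b + 3) initTapes (initData none)) ?_).mpr
    (Run.act ⟨Nat.zero_le _, fun _ => by simp [initData]⟩)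
  rw [Data.ext_iff]
  refine ⟨?_, ?_, ?_, ?_⟩
  · simp [initData, Data.apply, initSt, St.data, conf, Machine.movePos]
  · funext j i
    rcases i with _ | i <;> simp [initData, Data.apply, initSt, St.data, conf, enc]
  · simp [initData, Data.apply, initSt, St.data, conf, Machine.movePos]
  · simp [initData, Data.apply, initSt, St.data, conf, encode]

/-- Write the instruction `FIRSTHALF`. -/
def firstGate : RProg := .seq (inc .cur) (.seq (letter .firstHalf) (inc .cur))

/-- Write the constants, and set the registers that point to them. -/
def constants : RProg :=
  .seq firstGate <| .seq (block [.not (.back 0), .bin .and (.back 0) (.back 1), .not (.back 0)]) <|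
  .seq (rep 1 (inc .fst)) <| .seq (rep 2 (inc .snd)) <| .seq (rep 3 (inc .empty)) (rep 4 (inc .full))

/-- The registers point to the constants. -/
structure Constants (st : St) : Prop where
  fst : Val st.prog (st.env .fst) (Set.Ico 0 (1 / 2))
  snd : Val st.prog (st.env .snd) (Set.Ico (1 / 2) 1)
  empty : Val st.prog (st.env .empty) (bset fun _ => false)
  full : Val st.prog (st.env .full) (bset fun _ => true)

theorem exec_constants (hb : 10 ≤ 2 ^ b) : ∃ st, Exec w b constants initSt st ∧ Good b st ∧
    st.prog.length = 4 ∧ answer st.prog = [] ∧ st.ip = 0 ∧ st.env .n = 0 ∧ Constants st := by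
  obtain ⟨s1, e1, hs1⟩ : ∃ s1, Exec w b firstGate initSt s1 ∧
      s1 = ⟨Function.update (fun _ => 0) .cur 2, 0, [.firstHalf]⟩ := by
    refine ⟨⟨Function.update (fun _ => 0) .cur 2, 0, [.firstHalf]⟩, fun h => ⟨Nat.zero_le _, ?_⟩, rfl⟩
    have h0 : (0 : ℕ) < 2 ^ b := by omega
    have := Run.seq (conf_bounded h) (run_inc (b := b) (env := initSt.env) (out := []) (r := .cur) h h0)
      (Run.seq (conf_bounded h) (run_letter h .firstHalf)
        (run_inc (r := .cur) h (by rw [Function.update_self]; change 0 + 1 < _; omega)))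
    simpa [initSt, St.data, encode, Instr.encode, firstGate] using this
  have g1 : Good b s1 := by
    subst hs1
    refine ⟨rfl, rfl, fun r => ?_, rfl, fun i hi => ?_⟩
    · by_cases hr : r = .cur
      · subst hr; simp; omega
      · simp [hr]
    · obtain rfl : i = 0 := by simpa using hi
      rfl
  have hv : (values s1.prog).reverse = [Set.Ico 0 (1 / 2)] := by subst hs1; rfl
  have hl : s1.prog.length = 1 := by subst hs1; rfl
  have ha : answer s1.prog = [] := by subst hs1; rfl
  have hi : s1.ip = 0 := by subst hs1; rfl
  have he : ∀ r, r ≠ .cur → s1.env r = 0 := by subst hs1; intro r hr; simp [hr]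
  obtain ⟨s2, e2, l2, v2⟩ := step_block (w := w) g1
    [.not (.back 0), .bin .and (.back 0) (.back 1), .not (.back 0)] (fun _ _ => rfl)
    (by simp [hl]; omega) (by simp [BlockWf, Gate.Wf, Ref.Wf, hl])
  have h1 : Set.Ico (0 : ℝ) 1 \ Set.Ico 0 (1 / 2) = Set.Ico (1 / 2) 1 := by
    ext t
    simp only [Set.mem_sdiff, Set.mem_Ico, not_and, not_lt]
    constructor
    · rintro ⟨⟨h0, h1⟩, h2⟩; exact ⟨h2 h0, h1⟩
    · rintro ⟨h0, h1⟩; exact ⟨⟨by linarith, h1⟩, fun _ => h0⟩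
  have h2 : Set.Ico (1 / 2 : ℝ) 1 ∩ Set.Ico 0 (1 / 2) = bset fun _ => false := by
    rw [bset_false, Set.Ico_inter_Ico]; simp
  simp only [List.length_cons, List.length_nil, hv, evalBlock, Gate.eval, Ref.eval, BinOp.eval,
    List.getD_cons_zero, List.getD_cons_succ, h1, h2, bset_compl, hl, Bool.not_false] at l2 v2
  have he2 : ∀ r, r ≠ .cur → s2.env r = 0 := fun r hr =>
    (e2.frame.env r (by simpa using hr)).trans (he r hr)
  have e3 := step_add (w := w) e2.frame.good (r := .fst) (k := 1) (by simp) (by simp)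
    (by rw [he2 _ (by simp)]; omega)
  have e4 := step_add (w := w) e3.frame.good (r := .snd) (k := 2) (by simp) (by simp)
    (by simp [he2]; omega)
  have e5 := step_add (w := w) e4.frame.good (r := .empty) (k := 3) (by simp) (by simp)
    (by simp [he2]; omega)
  have e6 := step_add (w := w) e5.frame.good (r := .full) (k := 4) (by simp) (by simp)
    (by simp [he2]; omega)
  have E := e2.seq (e3.seq (e4.seq (e5.seq e6)))
  refine ⟨_, e1.seq E.exec, E.frame.good, l2, E.frame.ans.trans ha, E.frame.ip.trans hi,
    by simp [he2], ?_⟩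
  have y : ∀ {j : ℕ} {A : Set ℝ}, (values s2.prog).reverse[j]? = some A → Val s2.prog (4 - j) A := by
    intro j A h
    have := Val.of_reverse h
    rwa [l2] at this
  constructor
  · simpa [he2] using y (j := 3) (A := Set.Ico 0 (1 / 2)) (by rw [v2]; rfl)
  · simpa [he2] using y (j := 2) (A := Set.Ico (1 / 2) 1) (by rw [v2]; rfl)
  · simpa [he2] using y (j := 1) (by rw [v2]; rfl)
  · simpa [he2] using y (j := 0) (by rw [v2]; rfl)

/-- The head sees the right end marker. -/
def isRight : InputCell Bool → Bool
  | .rightEnd => true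
  | _ => false

/-- The head sees the left end marker. -/
def isLeft : InputCell Bool → Bool
  | .leftEnd => true
  | _ => false

/-- The head sees the letter `1`. -/
def isOne : InputCell Bool → Bool
  | .letter c => c
  | _ => false

/-- Move the input head to the last letter of the input. -/
def seekEnd : RProg :=
  .seq (.loop (onInput fun x => !isRight x) (moveInput .right)) (moveInput .left)

theorem exec_seekEnd (h : st.ip = 0) : Exec w b seekEnd st { st with ip := w.length } := by
  obtain ⟨s, e, rfl⟩ := exec_loop (w := w) (b := b) (st := st) (t := onInput fun x => !isRight x)
    (c := moveInput .right) (N := w.length + 1) (fun i s => s = { st with ip := i })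
    (by
      rintro i _ hi rfl
      refine ⟨?_, _, exec_moveInput _, ?_⟩
      · rcases i with _ | i
        · rfl
        · have : w[i]? = some w[i] := List.getElem?_eq_getElem (by omega)
          simp [onInput, Machine.inputCell, this, isRight]
      · have : min (i + 1) (w.length + 1) = i + 1 := by omega
        simp [Machine.movePos, this])
    (by
      rintro _ rfl
      simp [onInput, Machine.inputCell, isRight]) (by cases st; simp_all)
  have := e.seq (exec_moveInput (w := w) (b := b) .left)
  simpa [seekEnd, Machine.movePos] using this

/-- The `k`-th letter of a word, counted from the end and from `0`. -/
def lastBit (w : List Bool) (k : ℕ) : Bool := w.reverse[k]?.getD false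

/-- When the letters are used up, the head rests on the left end marker, which is read as 0. So a
word whose length is not divisible by 3 is treated as if padded with zeros in front. -/
theorem isOne_inputCell (w : List Bool) (k : ℕ) :
    isOne (Machine.inputCell w (w.length - k)) = lastBit w k := by
  rw [lastBit]
  rcases lt_or_ge k w.length with hk | hk
  · obtain ⟨j, hj⟩ : ∃ j, w.length - k = j + 1 := ⟨w.length - k - 1, by omega⟩
    have h1 : w[j]? = some w[j] := List.getElem?_eq_getElem (by omega)
    have h2 : w.reverse[k]? = some w[j] := by
      rw [List.getElem?_eq_getElem (by simpa using hk), List.getElem_reverse]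
      congr 2
      omega
    rw [hj, h2]
    simp [Machine.inputCell, h1, isOne]
  · rw [Nat.sub_eq_zero_of_le hk, List.getElem?_eq_none (by simpa using hk)]
    rfl

/-- Write the constant value of an input letter, and move to the left. -/
def readLetter : RProg :=
  .seq (.ite (onInput isOne)
    (block [.bin .or (.reg .full) (.reg .full), .bin .or (.reg .full) (.reg .full),
      .bin .or (.reg .full) (.reg .full)])
    (block [.bin .or (.reg .empty) (.reg .empty), .bin .or (.reg .empty) (.reg .empty),
      .bin .or (.reg .empty) (.reg .empty)])) (moveInput .left)

/-- The state after the first `k` input letters, counted from the end. -/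
structure ReadSt (w : List Bool) (b : ℕ) (st₀ : St) (k : ℕ) (st : St) : Prop where
  good : Good b st
  ip : st.ip = w.length - k
  pre : st₀.prog <+: st.prog
  env : ∀ r, r ≠ .cur → r ≠ .n → st.env r = st₀.env r
  ans : answer st.prog = answer st₀.prog
  len : st.prog.length = st₀.prog.length + 3 * k
  val : ∀ j < k, Val st.prog (st₀.prog.length + 1 + 3 * j) (bset fun _ => lastBit w j)

theorem exec_readLetter {st₀ : St} (hc : Constants st₀) {k : ℕ} (h : ReadSt w b st₀ k st)
    (hb : st₀.prog.length + 3 * k + 10 ≤ 2 ^ b) :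
    ∃ st', Exec w b readLetter st st' ∧ ReadSt w b st₀ (k + 1) st' ∧ st'.env .n = st.env .n := by
  have hl := h.len
  have hE : Val st.prog (st.env .empty) (bset fun _ => false) := by
    rw [h.env _ (by simp) (by simp)]; exact hc.empty.mono h.pre
  have hU : Val st.prog (st.env .full) (bset fun _ => true) := by
    rw [h.env _ (by simp) (by simp)]; exact hc.full.mono h.pre
  obtain ⟨t, e, l, v⟩ : ∃ t, Step w b [.cur] (if onInput isOne (Machine.inputCell w st.ip) st.data.scan
      then (block [.bin .or (.reg .full) (.reg .full), .bin .or (.reg .full) (.reg .full),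
      .bin .or (.reg .full) (.reg .full)])
      else (block [.bin .or (.reg .empty) (.reg .empty), .bin .or (.reg .empty) (.reg .empty),
      .bin .or (.reg .empty) (.reg .empty)])) st t ∧ t.prog.length = st.prog.length + 3 ∧
      Val t.prog (st.prog.length + 1) (bset fun _ => lastBit w k) := by
    rw [h.ip]
    have hcell : onInput isOne (Machine.inputCell w (w.length - k)) st.data.scan = lastBit w k :=
      isOne_inputCell w k
    cases hk : lastBit w k
    · rw [if_neg (by simp [hcell, hk])]
      obtain ⟨t, e, l, v⟩ := step_block (w := w) h.good
        [.bin .or (.reg .empty) (.reg .empty), .bin .or (.reg .empty) (.reg .empty),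
          .bin .or (.reg .empty) (.reg .empty)] (fun _ _ => rfl) (by simp; omega)
        (by simp only [BlockWf, Gate.Wf, Ref.Wf, hE.ptr (by simp)]; trivial)
      simp only [evalBlock, Gate.eval, Ref.eval, BinOp.eval, hE.eq, Set.union_self] at v
      have x := Val.of_reverse (S := t.prog) (j := 2) (by rw [v]; rfl)
      exact ⟨t, e, l, by rw [l] at x; exact x⟩
    · rw [if_pos (by rw [hcell, hk])]
      obtain ⟨t, e, l, v⟩ := step_block (w := w) h.good
        [.bin .or (.reg .full) (.reg .full), .bin .or (.reg .full) (.reg .full),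
          .bin .or (.reg .full) (.reg .full)] (fun _ _ => rfl) (by simp; omega)
        (by simp only [BlockWf, Gate.Wf, Ref.Wf, hU.ptr (by simp)]; trivial)
      simp only [evalBlock, Gate.eval, Ref.eval, BinOp.eval, hU.eq, Set.union_self] at v
      have x := Val.of_reverse (S := t.prog) (j := 2) (by rw [v]; rfl)
      exact ⟨t, e, l, by rw [l] at x; exact x⟩
  have g := e.frame.good
  refine ⟨_, (exec_ite e.exec).seq (exec_moveInput .left), ⟨⟨g.cur, g.tmp, g.lt, g.head, g.allowed⟩,
    ?_, h.pre.trans e.frame.pre, fun r hr hn => ?_, e.frame.ans.trans h.ans, ?_, ?_⟩, ?_⟩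
  · simp only [Machine.movePos, e.frame.ip, h.ip]; omega
  · exact (e.frame.env r (by simpa using hr)).trans (h.env r hr hn)
  · simp only [l, hl]; ring
  · intro j hj
    rcases Nat.lt_succ_iff_lt_or_eq.mp hj with hj | rfl
    · exact (h.val j hj).mono e.frame.pre
    · have hx : st.prog.length + 1 = st₀.prog.length + 1 + 3 * j := by omega
      rwa [hx] at v
  · exact e.frame.env _ (by simp)

/-- Read the input from the end to the beginning. -/
def readInput : RProg :=
  .seq (.seq seekEnd (copy .baseP .cur)) <| .loop (onInput fun x => !isLeft x) <|
  .seq readLetter <| .seq readLetter <| .seq readLetter (inc .n)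

/-- Reading backwards puts least significant bits first, and writing each letter three times gives
stride 3. Three letters are read for each increment of `.n`, which computes |w|/3, rounded up,
without division. -/
theorem exec_readInput (h : Good b st) (hip : st.ip = 0) (hn : st.env .n = 0) (hc : Constants st)
    {N : ℕ} (hN : N = (w.length + 2) / 3) (hb : st.prog.length + 9 * N + 10 ≤ 2 ^ b) :
    ∃ st', Exec w b readInput st st' ∧ Good b st' ∧ answer st'.prog = answer st.prog ∧
      st'.prog.length = st.prog.length + 9 * N ∧ st'.env .n = N ∧ Constants st' ∧
      st'.env .baseP = st.prog.length + 1 ∧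
      ∀ j < 3 * N, Val st'.prog (st.prog.length + 1 + 3 * j) (bset fun _ => lastBit w j) := by
  have e1 := exec_seekEnd (w := w) (b := b) hip
  have g1 : Good b { st with ip := w.length } := ⟨h.cur, h.tmp, h.lt, h.head, h.allowed⟩
  have e2 := step_copy (w := w) g1 (dst := .baseP) (src := .cur) (by simp) (by simp) (by simp) (by simp)
  obtain ⟨s2, e2, g2, k2, p2, n2, i2, hc2⟩ : ∃ s2, Exec w b _ st s2 ∧ Good b s2 ∧ s2.prog = st.prog ∧
      s2.env .baseP = st.prog.length + 1 ∧ s2.env .n = 0 ∧ s2.ip = w.length ∧ Constants s2 :=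
    ⟨_, e1.seq e2.exec, e2.frame.good, rfl, by simp [h.cur], by simpa using hn, rfl,
      ⟨by simpa using hc.fst, by simpa using hc.snd, by simpa using hc.empty, by simpa using hc.full⟩⟩
  obtain ⟨s3, e3, r3, n3⟩ := exec_loop (w := w) (b := b) (st := s2) (t := onInput fun x => !isLeft x)
    (c := .seq readLetter <| .seq readLetter <| .seq readLetter (inc .n)) (N := N)
    (fun i s => ReadSt w b s2 (3 * i) s ∧ s.env .n = i)
    (by
      rintro i s hi ⟨h1, h2⟩
      refine ⟨?_, ?_⟩
      -- Since `i < N`, fewer than |w| letters have been read and the head is not yet on the left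
      -- end marker.
      · obtain ⟨j, hj⟩ : ∃ j, w.length - 3 * i = j + 1 := ⟨w.length - 3 * i - 1, by omega⟩
        rw [h1.ip, hj, onInput, Machine.inputCell]
        cases w[j]? <;> rfl
      · obtain ⟨t1, f1, q1, m1⟩ := exec_readLetter hc2 h1 (by rw [k2]; omega)
        obtain ⟨t2, f2, q2, m2⟩ := exec_readLetter hc2 q1 (by rw [k2]; omega)
        obtain ⟨t3, f3, q3, m3⟩ := exec_readLetter hc2 q2 (by rw [k2]; omega)
        have m : t3.env .n = i := by rw [m3, m2, m1, h2]
        have hlt := q3.good.lt .n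
        refine ⟨_, f1.seq (f2.seq (f3.seq (exec_inc hlt))), ⟨q3.good.set (by simp) (by simp) (by omega),
          q3.ip, q3.pre, fun r hr hn => ?_, q3.ans, q3.len, q3.val⟩, by simp [m]⟩
        simpa [hn] using q3.env r hr hn)
    (by
      rintro s ⟨h1, -⟩
      have : w.length - 3 * N = 0 := by omega
      rw [h1.ip, this]
      rfl)
    ⟨⟨g2, by simpa using i2, List.prefix_rfl, fun _ _ _ => rfl, rfl, by simp, by simp⟩, by simpa using n2⟩
  have hv : ∀ {r : Reg} {A : Set ℝ}, r ≠ .cur → r ≠ .n → Val s2.prog (s2.env r) A →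
      Val s3.prog (s3.env r) A := by
    intro r A h1 h2 h3
    rw [r3.env r h1 h2]; exact h3.mono r3.pre
  refine ⟨s3, e2.seq e3, r3.good, by rw [r3.ans, k2], by rw [r3.len, k2]; ring, n3,
    ⟨hv (by simp) (by simp) hc2.fst, hv (by simp) (by simp) hc2.snd, hv (by simp) (by simp) hc2.empty,
      hv (by simp) (by simp) hc2.full⟩, by rw [r3.env _ (by simp) (by simp), p2], ?_⟩
  rw [← k2]
  exact r3.val

end Prog

/-! ### The complete program. -/

/-- The number whose binary digits are the letters `off, …, off + N - 1`, counted from the end. -/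
def numOf (w : List Bool) (off N : ℕ) : ℕ := Nat.ofBits fun i : Fin N => Prog.lastBit w (off + i)

theorem numOf_lt (w : List Bool) (off N : ℕ) : numOf w off N < 2 ^ N := Nat.ofBits_lt_two_pow _

theorem testBit_numOf (w : List Bool) (off : ℕ) {N i : ℕ} (hi : i < N) :
    (numOf w off N).testBit i = Prog.lastBit w (off + i) := Nat.testBit_ofBits_lt _ _ hi

/-- The equation that the exponent in the last `N` bits of `k` has to satisfy, and the next bit of `k`
is set. -/
def hit (N p a b k : ℕ) : Bool :=
  decide (expIter N p a (k % 2 ^ N) N = mulMod N p b (1 % 2 ^ N)) && k.testBit N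

/-- The length of the computation sequence for the discrete logarithm. -/
def totalLength (N : ℕ) : ℕ :=
  4 + 9 * N + (1 + 3 * N) + (1 + 3 * N) + N * (2 * (N * (8 + 46 * N)) + 1 + 3 * N) +
    N * (8 + 46 * N) + (1 + 5 * N) + 2 + (1 + N) + 3 * N

namespace Prog
variable {w : List Bool} {b : ℕ} {st : St}

/-- Set the pointers to the three parts of the input. -/
def setPointers : RProg :=
  .seq (copy .baseB .baseP) (.seq (addLength .baseB) (.seq (copy .baseA .baseB) (addLength .baseA)))

theorem step_setPointers (h : Good b st) {N : ℕ} (hN : st.env .n = N)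
    (hb : st.env .baseP + 6 * N < 2 ^ b) :
    ∃ st', Step w b [.ctr, .baseA, .baseB] setPointers st st' ∧ st'.prog = st.prog ∧
      st'.env .baseB = st.env .baseP + 3 * N ∧ st'.env .baseA = st.env .baseP + 6 * N := by
  have e1 := step_copy (w := w) h (dst := .baseB) (src := .baseP) (by simp) (by simp) (by simp) (by simp)
  obtain ⟨s2, e2, l2, b2⟩ := step_addLength (w := w) e1.frame.good (N := N) (r := .baseB)
    (by simpa using hN) (by simp) (by simp; omega)
  simp only [St.set_env, Function.update_self, St.set_prog] at b2 l2
  have e3 := step_copy (w := w) e2.frame.good (dst := .baseA) (src := .baseB) (by simp) (by simp)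
    (by simp) (by simp)
  obtain ⟨s4, e4, l4, b4⟩ := step_addLength (w := w) e3.frame.good (N := N) (r := .baseA)
    (by simpa [e2.frame.env] using hN) (by simp) (by simp; omega)
  simp only [St.set_env, Function.update_self, St.set_prog] at b4 l4
  exact ⟨s4, (e1.seq (e2.seq (e3.seq e4))).mono (by simp), l4.trans l2,
    by rw [e4.frame.env _ (by simp)]; simp [b2], by rw [b4, b2]; ring⟩

/-- Write the complement of the intersection of the last value with the second half. -/
def makeGap : RProg :=
  .seq (block [.bin .and (.back 0) (.reg .snd), .not (.back 0)]) <|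
  .seq (copy .gap .cur) (rep 1 (dec .gap))

theorem step_makeGap (h : Good b st) {φ ψ : ℝ → Bool} {l : List (Set ℝ)}
    (hφ : (values st.prog).reverse = bset φ :: l) (hψ : Val st.prog (st.env .snd) (bset ψ))
    (hb : st.prog.length + 20 ≤ 2 ^ b) :
    ∃ st', Step w b [.cur, .gap] makeGap st st' ∧ st'.prog.length = st.prog.length + 2 ∧
      Val st'.prog (st'.env .gap) (bset fun t => !(φ t && ψ t)) := by
  have hl : 0 < st.prog.length := by
    rw [← values_length, ← List.length_reverse, hφ]; simp
  obtain ⟨s1, e1, l1, v1⟩ := step_block (w := w) h [.bin .and (.back 0) (.reg .snd), .not (.back 0)]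
    (fun _ _ => rfl) (by simp; omega) ⟨⟨hl, hψ.ptr (by simp)⟩, Nat.succ_pos _, trivial⟩
  simp only [List.length_cons, List.length_nil, evalBlock, Gate.eval, Ref.eval, hψ.eq, BinOp.eval, hφ,
    List.getD_cons_zero, bset_inter, bset_compl] at l1 v1
  have e2 := step_copy (w := w) e1.frame.good (dst := .gap) (src := .cur) (by simp) (by simp)
    (by simp) (by simp)
  have e3 := step_sub (w := w) e2.frame.good (r := .gap) (k := 1) (by simp) (by simp)
    (by simp [e1.frame.good.cur])
  refine ⟨_, (e1.seq (e2.seq e3)).mono (by simp), l1, ?_⟩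
  have := Val.of_reverse (S := s1.prog) (j := 0) (by rw [v1]; rfl)
  simpa [e1.frame.good.cur] using this

/-- The main part of the program for the discrete logarithm. -/
def search : RProg :=
  .seq setPointers <| .seq makeDigits <| .seq makeOne <| .seq exp <| .seq (mul .baseB .one) <|
  .seq (compare .res .acc) <| .seq makeGap makeCell

/-- Every part works with pointers into the sequence written so far, and the frames carry these
along. The exponent used at a point is its cell number without the top bit; the top bit is
intersected in only when the hit set is formed. -/
theorem step_search (h : Good b st) (hc : Constants st) {N p q a : ℕ} (hN : st.env .n = N)
    (hp : Vec st.prog (st.env .baseP) N fun _ => p)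
    (hq : Vec st.prog (st.env .baseP + 3 * N) N fun _ => q)
    (ha : Vec st.prog (st.env .baseP + 6 * N) N fun _ => a)
    (hl : st.prog.length = 4 + 9 * N) (hb : totalLength N + 120 ≤ 2 ^ b)
    (hbP : st.env .baseP + 6 * N < 2 ^ b) :
    ∃ st', Step w b Finset.univ.toList search st st' ∧
      st'.prog.length = totalLength N - 3 * N ∧ st'.env .n = N ∧
      (∀ i < N, Val st'.prog (st'.env .baseX + 3 * i) (digitSet (i + 1))) ∧
      Val st'.prog (st'.env .gap) (bset fun t => !hit N p a q (cellIndex N t)) ∧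
      Val st'.prog (st'.env .cell) (Set.Ico 0 ((1 / 2) ^ (N + 1))) := by
  rw [totalLength] at hb
  obtain ⟨s1, e1, l1, bB, bA⟩ := step_setPointers (w := w) h hN hbP
  have f1 := e1.frame
  have k1 := congrArg List.length l1
  have hq1 : Vec s1.prog (s1.env .baseB) N fun _ => q := by rw [l1, bB]; exact hq
  have ha1 : Vec s1.prog (s1.env .baseA) N fun _ => a := by rw [l1, bA]; exact ha
  have A1 : Ambient N p s1 := f1.ambient ⟨hN, hp, hc.empty, hc.full⟩ (by simp)
  have hF1 := f1.val (by simp) hc.fst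
  have hS1 := f1.val (by simp) hc.snd
  obtain ⟨s2, e2, l2, hX⟩ := step_makeDigits (w := w) f1.good A1.n hF1 hS1 (by omega)
  have f2 := e2.frame
  have A2 := f2.ambient A1 (by simp)
  obtain ⟨s3, e3, l3, hone, hzero⟩ := step_makeOne (w := w) f2.good A2.n A2.empty A2.full (by omega)
  have f3 := e3.frame
  have A3 := f3.ambient A2 (by simp)
  have hX3 : ∀ i < N, Val s3.prog (s3.env .baseX + 3 * i) (digitSet (i + 1)) := fun i hi => by
    rw [f3.env _ (by simp)]; exact (hX i hi).mono f3.pre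
  obtain ⟨s4, e4, l4, hres⟩ := step_exp (w := w) f3.good A3 hzero hone
    ((f2.append f3).vec (by simp) ha1) (x := fun t => cellIndex N t % 2 ^ N)
    (fun i hi => by
      -- Digit `i + 1` of the point is bit `N - 1 - i` of the cell number, and reduction modulo 2^N
      -- drops only the flag.
      have := hX3 i hi
      rw [digitSet_eq (N := N) (by omega)] at this
      convert this using 3 with t
      rw [Nat.testBit_mod_two_pow]
      have : N - (i + 1) = N - 1 - i := by omega
      simp [this]
      omega) (by omega)
  have f4 := e4.frame
  have A4 := f4.ambient A3 (by simp)
  obtain ⟨s5, e5, l5, hacc⟩ := step_mul (w := w) f4.good A4 (f4.vec (by simp) hzero)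
    (y := .baseB) (f := .one) (by simp) (by simp) ((f2.append (f3.append f4)).vec (by simp) hq1)
    (f4.vec (by simp) hone) (by omega)
  have f5 := e5.frame
  have A5 := f5.ambient A4 (by simp)
  obtain ⟨s6, l, e6, l6, v6⟩ := step_compare (w := w) f5.good A5 (f5.vec (by simp) hres) hacc (by omega)
  have f6 := e6.frame
  have hF6 := (f2.append (f3.append (f4.append (f5.append f6)))).val (by simp) hF1
  have hS6 := (f2.append (f3.append (f4.append (f5.append f6)))).val (by simp) hS1
  -- The second half of [0, 1) is the flag: bit `N` of the cell number.
  have hS0 := digitSet_eq (N := N) (j := 0) (Nat.zero_le _)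
  rw [digitSet_zero] at hS0
  rw [hS0] at hS6
  obtain ⟨s7, e7, l7, hgap⟩ := step_makeGap (w := w) f6.good v6 hS6 (by omega)
  have f7 := e7.frame
  obtain ⟨s8, e8, l8, hcell⟩ := step_makeCell (w := w) f7.good (N := N)
    (((f6.append f7).env _ (by simp)).trans A5.n) (f7.val (by simp) hF6) (by omega)
  have f8 := e8.frame
  have F := f4.append (f5.append (f6.append (f7.append f8)))
  refine ⟨s8, (e1.seq (e2.seq (e3.seq (e4.seq (e5.seq (e6.seq (e7.seq e8))))))).mono
    (fun r _ => by simp), by rw [totalLength]; omega, (F.env _ (by simp)).trans A3.n, fun i hi => ?_, ?_,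
    hcell⟩
  · rw [F.env _ (by simp)]
    exact (hX3 i hi).mono F.pre
  · exact f8.val (by simp) hgap

/-- The program that writes the computation sequence for the discrete logarithm. -/
def discreteLog : RProg :=
  .seq initTapes <| .seq constants <| .seq readInput <| .seq search outputs

open Classical in
theorem run_discreteLog (w : List Bool) {N b : ℕ} (hN : N = (w.length + 2) / 3)
    (hb : totalLength N + 120 ≤ 2 ^ b) :
    ∃ st : St, Run w (b + 3) discreteLog (initData none) st.data ∧ st.data.Bounded w (b + 3) ∧
      IsComputationSequence st.prog ∧ st.prog.length = totalLength N ∧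
      answer st.prog = (List.range N).map fun i => decide (lshift (digitSet (i + 1))
        (bset fun t => !hit N (numOf w 0 N) (numOf w (2 * N) N) (numOf w N N) (cellIndex N t)) ∩
          Set.Ico 0 ((1 / 2) ^ (N + 1))).Nonempty := by
  have ht := hb
  rw [totalLength] at ht
  obtain ⟨s1, e1, g1, l1, a1, i1, n1, c1⟩ := exec_constants (w := w) (b := b) (by omega)
  obtain ⟨s2, e2, g2, a2, l2, n2, c2, p2, v2⟩ := exec_readInput (w := w) g1 i1 n1 c1 hN (by omega)
  have hv : ∀ off, off + N ≤ 3 * N →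
      Vec s2.prog (s2.env .baseP + 3 * off) N fun _ => numOf w off N := by
    refine fun off ho => ⟨fun _ => numOf_lt w off N, fun i hi => ?_⟩
    have := v2 (off + i) (by omega)
    rw [← testBit_numOf w off hi] at this
    convert this using 1
    rw [p2]
    ring
  obtain ⟨s3, e3, l3, n3, X3, G3, C3⟩ := step_search (w := w) g2 c2 n2 (hv 0 (by omega))
    (hv N (by omega)) (by have := hv (2 * N) (by omega); rwa [← mul_assoc] at this) (by omega) hb
    (by omega)
  have l3' := l3
  rw [totalLength] at l3'
  obtain ⟨s4, e4, g4, l4, a4⟩ := exec_outputs (w := w) e3.frame.good n3 X3 G3 C3 (by omega)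
  have E := (e1.seq (e2.seq (e3.exec.seq e4))) (Nat.zero_le _)
  refine ⟨s4, Run.seq (by simp [initData, Data.Bounded]) run_initTapes E.2, conf_bounded E.1,
    ⟨g4.head, g4.allowed⟩, by rw [l4, totalLength]; omega, by rw [a4, e3.frame.ans, a2, a1]; rfl⟩

end Prog

/-! ### Bounds for the size and the space. -/

theorem totalLength_eq (N : ℕ) : totalLength N = 10 + 33 * N + 65 * N ^ 2 + 92 * N ^ 3 := by
  rw [totalLength]; ring

theorem totalLength_le {N m : ℕ} (h : N ≤ m) (hm : 0 < m) : totalLength N ≤ 200 * m ^ 3 := by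
  have h1 : totalLength N ≤ 10 + 33 * m + 65 * m ^ 2 + 92 * m ^ 3 := by
    rw [totalLength_eq]; gcongr
  have h2 : m ≤ m ^ 3 := (pow_one m).symm.trans_le <| Nat.pow_le_pow_right hm (by norm_num)
  have h3 : m ^ 2 ≤ m ^ 3 := Nat.pow_le_pow_right hm (by norm_num)
  have h4 : 1 ≤ m ^ 3 := Nat.one_le_pow _ _ hm
  omega

/-- A cubic length needs only 3 log m + O(1) bits. The weaker factor 15 is taken so that the bit
bound plus the three extra cells of `Exec` is exactly 15 (log m + 1). -/
theorem totalLength_le_two_pow {N m : ℕ} (h : N ≤ m) :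
    totalLength N + 120 ≤ 2 ^ (15 * Nat.log 2 m + 12) := by
  have h1 : m + 1 ≤ 2 ^ (Nat.log 2 m + 1) := Nat.lt_pow_succ_log_self (by norm_num) m
  have h2 : totalLength N ≤ 10 + 33 * m + 65 * m ^ 2 + 92 * m ^ 3 := by
    rw [totalLength_eq]; gcongr
  calc totalLength N + 120 ≤ (m + 1) ^ 3 * 2 ^ 9 := by nlinarith
    _ ≤ (2 ^ (Nat.log 2 m + 1)) ^ 3 * 2 ^ 9 := by gcongr
    _ = 2 ^ (3 * Nat.log 2 m + 12) := by rw [← pow_mul, ← pow_add]; congr 1; ring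
    _ ≤ 2 ^ (15 * Nat.log 2 m + 12) := Nat.pow_le_pow_right (by norm_num) (by omega)

open Classical in
theorem exists_discreteLog (w : List Bool) : ∃ S : List Instr,
    (∃ d, Prog.Run w (15 * (Nat.log 2 w.length + 1)) Prog.discreteLog (Prog.initData none) d ∧
      d.Bounded w (15 * (Nat.log 2 w.length + 1)) ∧ d.out = encode S) ∧
    IsComputationSequence S ∧ S.length = totalLength ((w.length + 2) / 3) ∧
    ∀ N, N = (w.length + 2) / 3 → answer S = (List.range N).map fun i =>
      decide (lshift (digitSet (i + 1)) (bset fun t => !hit N (numOf w 0 N) (numOf w (2 * N) N)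
        (numOf w N N) (cellIndex N t)) ∩ Set.Ico 0 ((1 / 2) ^ (N + 1))).Nonempty := by
  obtain ⟨st, h1, h2, h3, h4, h5⟩ := Prog.run_discreteLog w rfl
    (totalLength_le_two_pow (m := w.length) (by omega))
  have : 15 * Nat.log 2 w.length + 12 + 3 = 15 * (Nat.log 2 w.length + 1) := by ring
  rw [this] at h1 h2
  exact ⟨st.prog, ⟨st.data, h1, h2, rfl⟩, h3, h4, by rintro N rfl; exact h5⟩

/-! ### Correctness of the answer. -/

theorem numOf_eq {w : List Bool} {off N c : ℕ} (hc : c < 2 ^ N)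
    (h : ∀ i < N, Prog.lastBit w (off + i) = c.testBit i) : numOf w off N = c := by
  refine Nat.eq_of_testBit_eq fun i => ?_
  rcases lt_or_ge i N with hi | hi
  · rw [testBit_numOf _ _ hi, h i hi]
  · have : 2 ^ N ≤ 2 ^ i := Nat.pow_le_pow_right (by norm_num) hi
    rw [Nat.testBit_lt_two_pow ((numOf_lt w off N).trans_le this),
      Nat.testBit_lt_two_pow (hc.trans_le this)]

theorem numOf_digits {n a b p : ℕ} (ha : a < 2 ^ n) (hb : b < 2 ^ n) (hp : p < 2 ^ n) :
    numOf (digits n a ++ digits n b ++ digits n p) 0 n = p ∧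
      numOf (digits n a ++ digits n b ++ digits n p) n n = b ∧
      numOf (digits n a ++ digits n b ++ digits n p) (2 * n) n = a := by
  refine ⟨numOf_eq hp fun i hi => ?_, numOf_eq hb fun i hi => ?_, numOf_eq ha fun i hi => ?_⟩ <;>
    simp only [Prog.lastBit, digits, List.reverse_append, List.reverse_reverse]
  · rw [List.getElem?_append_left (by simpa using hi)]; simp [hi]
  · rw [List.getElem?_append_right (by simp), List.getElem?_append_left (by simpa using hi)]
    simp [hi]
  · rw [List.getElem?_append_right (by simp; omega), List.getElem?_append_right (by simp; omega)]
    have : 2 * n + i - n - n = i := by omega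
    simp [hi, this]

/-- Both sides of the comparison are reduced modulo `p`, the right one through the multiplication of
`b` by 1. Only `1 < p` is needed, not primality. -/
theorem hit_iff {N p a b k : ℕ} (hp : 1 < p) (hpN : p < 2 ^ N) (ha : a < 2 ^ N) (hb : b < 2 ^ N) :
    hit N p a b k = true ↔ a ^ (k % 2 ^ N) ≡ b [MOD p] ∧ k.testBit N = true := by
  have hx : k % 2 ^ N < 2 ^ N := Nat.mod_lt _ (by positivity)
  have h1 : 1 % 2 ^ N = 1 := Nat.mod_eq_of_lt (by omega)
  rw [hit, Bool.and_eq_true, decide_eq_true_eq, expIter_eq hpN hp ha hx N le_rfl, h1,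
    mulMod_eq hpN.le hp hb]
  simp [Nat.ModEq]

-- The least hit `k` lies between 2^n and 2^(n+1): the flag gives the lower bound and a solution
-- below 2^n the upper one. So it is the number of a cell of the second half, and its low bits are a
-- solution.
open Classical in
theorem exists_exponent_of_answer {n a b p : ℕ} (hp : p.Prime) (ha : a < 2 ^ n) (hb : b < 2 ^ n)
    (hpn : p < 2 ^ n) (h : ∃ y : ℕ, a ^ y ≡ b [MOD p]) :
    ∃ x < 2 ^ n, a ^ x ≡ b [MOD p] ∧ ((List.range n).map fun i =>
      decide (lshift (digitSet (i + 1)) (bset fun t => !hit n p a b (cellIndex n t)) ∩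
        Set.Ico 0 ((1 / 2) ^ (n + 1))).Nonempty) = digits n x := by
  obtain ⟨x, hx, hax⟩ := exists_exponent_lt hp hpn h
  have hex : ∃ k, hit n p a b k = true := by
    -- Adding 2^n sets the flag without changing the exponent.
    refine ⟨2 ^ n + x, (hit_iff hp.one_lt hpn ha hb).mpr ⟨?_, ?_⟩⟩
    · rwa [Nat.add_mod_left, Nat.mod_eq_of_lt hx]
    · rw [Nat.testBit_two_pow_add_eq, Nat.testBit_lt_two_pow hx]; rfl
  have hk := Nat.find_spec hex
  have hle : Nat.find hex ≤ 2 ^ n + x := Nat.find_min' hex (by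
    refine (hit_iff hp.one_lt hpn ha hb).mpr ⟨?_, ?_⟩
    · rwa [Nat.add_mod_left, Nat.mod_eq_of_lt hx]
    · rw [Nat.testBit_two_pow_add_eq, Nat.testBit_lt_two_pow hx]; rfl)
  have hmin : ∀ l < Nat.find hex, hit n p a b l = false := fun l hl => by
    simpa using Nat.find_min hex hl
  generalize Nat.find hex = k at hk hle hmin
  obtain ⟨h1, h2⟩ := (hit_iff hp.one_lt hpn ha hb).mp hk
  have hkn : k < 2 ^ (n + 1) := by rw [pow_succ]; omega
  -- Here the flag is used: it excludes k = 0, for which `flength_compl` would fail.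
  have hk0 : 0 < k := (Nat.two_pow_pos n).trans_le (Nat.ge_two_pow_of_testBit h2)
  refine ⟨k % 2 ^ n, Nat.mod_lt _ (by positivity), h1, ?_⟩
  have hfl := flength_compl hkn hk0 hk hmin
  refine List.ext_getElem (by simp [digits]) fun i hi _ => ?_
  have hi : i < n := by simpa using hi
  simp only [digits, List.getElem_map, List.getElem_reverse, List.getElem_range, List.length_map,
    List.length_range]
  rw [digitSet_eq (N := n) (by omega),
    lshift_inter_nonempty (ψ := fun k => k.testBit (n - (i + 1))) hkn hfl, Nat.testBit_mod_two_pow]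
  have : n - (i + 1) = n - 1 - i := by omega
  simp [this]
  omega

end IntervalComputing

theorem theorem1 :
    ∃ f : List Bool → List Bool,
      IntervalComputing.IntervalComputableInSize f (fun m => m ^ 3) ∧
      ∀ n a b p : ℕ, p.Prime → a < 2 ^ n → b < 2 ^ n → p < 2 ^ n →
        (∃ y : ℕ, a ^ y ≡ b [MOD p]) →
        ∃ x : ℕ, x < 2 ^ n ∧ a ^ x ≡ b [MOD p] ∧
          f (IntervalComputing.digits n a ++ IntervalComputing.digits n b ++
            IntervalComputing.digits n p) = IntervalComputing.digits n x := by
  choose B hrun hseq hlen hans using IntervalComputing.exists_discreteLog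
  refine ⟨fun w => IntervalComputing.answer (B w), ⟨B, ⟨_, 15,
    IntervalComputing.Prog.compile_computesInSpace IntervalComputing.Prog.discreteLog none _
      (fun m => 15 * (Nat.log 2 m + 1)) hrun⟩, fun w => ⟨hseq w, rfl⟩, 200, fun w hw => ?_⟩, ?_⟩
  · have hpos := List.length_pos_iff.mpr hw
    rw [hlen]
    exact IntervalComputing.totalLength_le (by omega) hpos
  · intro n a b p hp ha hb hpn hy
    obtain ⟨x, hx, hax, hout⟩ := IntervalComputing.exists_exponent_of_answer hp ha hb hpn hy
    refine ⟨x, hx, hax, ?_⟩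
    obtain ⟨h1, h2, h3⟩ := IntervalComputing.numOf_digits ha hb hpn
    -- The word has length 3n, and (3n + 2) / 3 = n, so the program works with the intended number
    -- of bits.
    have := hans (IntervalComputing.digits n a ++ IntervalComputing.digits n b ++
      IntervalComputing.digits n p) n (by simp [IntervalComputing.digits]; omega)
    rw [h1, h2, h3] at this
    exact this.trans hout
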